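/- **Conventions.** Let $\mathcal I$ be a countable, additively cancellative commutative semiring (a multiplicative unit is not needed) and let $p:(\mathcal I,+)\to\mathbb Z_2$ be a non-trivial homomorphism of monoids (a parity function). *Symmetric powers.* For a module $V$ over a commutative ring $R$, graded by submodules $V_i$, $i\in\mathcal I$, let $\mathrm S(V)$ be the quotient of the tensor algebra of $V$ by the two-sided ideal generated by $v\otimes w-(-1)^{p(ij)}w\otimes v$, $v\in V_i$, $w\in V_j$. Let $\mathrm S^n(V)$ be the span of the $n$-fold products of elements of $V$, and put $\overline{\mathrm S(V)}=\prod_{n\ge 0}\mathrm S^n(V)$, the algebra of formal power series. Its elements of degree $k$ are those all of whose components in $\mathrm S^n(V)$ are linear combinations of products $v_1\cdots v_n$ of homogeneous elements whose degrees add up to $k$. *Graded ringed spaces.* An $\mathcal I$-graded ringed space $(X,\mathcal O)$ is a space $X$ with a sheaf $\mathcal O$ of unital associative $\mathbb R$-algebras and $\mathbb R$-linear subsheaves $\mathcal O_i\subset\mathcal O$, $i\in\mathcal I$ (homogeneous sections of degree $i$), such that $1\in\mathcal O_0$ and $\mathcal O_i\mathcal O_j\subset\mathcal O_{i+j}$.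 (Because of formal power series, a section may be an infinite formal sum of homogeneous ones.) *Graded manifolds.* Let $M$ be a smooth $n$-dimensional manifold (Hausdorff, second countable), and let $(m_i)_{i\in\mathcal I}$ be natural numbers, finitely many of them non-zero, with $m_0=0$. Let $V=\bigoplus_i V_i$ be a real vector space with $\dim V_i=m_i$. An $\mathcal I$-graded manifold $\mathcal M=(M,\mathcal O)$ of dimension $n|(m_i)$ is an $\mathcal I$-graded ringed space over $M$ such that every point of $M$ lies in the domain $U$ of a smooth chart $U\to U'\subset\mathbb R^n$ which underlies an isomorphism of $\mathcal I$-graded ringed spaces from $(U,\mathcal O|_U)$ to $U'$ with its sheaf of smooth $\overline{\mathrm S(V)}$-valued functions. *Vector bundles.* An $\mathcal I$-graded vector bundle over $M$ is a family $E=\bigoplus_k E_k$ of smooth real vector bundles over $M$, finitely many of them of non-zero rank; $E_k^*$ is given degree $k$. **Theorem (Batchelor's theorem for $\mathcal I$-graded manifolds).** Let $\mathcal M=(M,\mathcal O)$ be an $\mathcal I$-graded manifold of dimension $n|(m_i)_{i\in\mathcal I}$. There is exactly one morphism $\epsilon:\mathcal O\to C^\infty_M$ of sheaves of graded $\mathbb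 R$-algebras over $M$, where $C^\infty_M$ is placed in degree $0$. Let $\mathcal O^1=\ker\epsilon$, let $\mathcal O^2$ be the square of this sheaf of ideals, and let $\mathcal F=\mathcal O^1/\mathcal O^2$. Then: 1. $\mathcal M$ is projected: there is a morphism $\varphi:C^\infty_M\to\mathcal O$ of sheaves of graded $\mathbb R$-algebras with $\epsilon\circ\varphi=\mathrm{id}$. 2. For every $\varphi$ as in 1, regard $\mathcal O$, $\mathcal O^1$, $\mathcal O^2$ and $\mathcal F$ as sheaves of graded $C^\infty_M$-modules through $\varphi$; the presheaf $U\mapsto\mathcal O^1(U)/\mathcal O^2(U)$ is already the quotient sheaf $\mathcal F$. Then: * $\mathcal M$ is split: the sequence $0\to\mathcal O^2\to\mathcal O^1\to\mathcal F\to 0$ of sheaves of graded $C^\infty_M$-modules has a degree-preserving $C^\infty_M$-linear splitting $\mathcal F\to\mathcal O^1$. * $\mathcal O$ is isomorphic, as a sheaf of $\mathcal I$-graded $C^\infty_M$-algebras, to $\overline{\mathrm S(\mathcal F)}$, the sheafification of $U\mapsto\overline{\mathrm S(\mathcal F(U))}$, where the symmetric powers are taken over $C^\infty(U)$. * There is an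 $\mathcal I$-graded vector bundle $E=\bigoplus_kE_k$ over $M$ with $\operatorname{rank}E_k=m_k$ such that $\mathcal O$ is isomorphic, as a sheaf of $\mathcal I$-graded $C^\infty_M$-algebras, to the sheaf of smooth sections of $\overline{\mathrm S(\bigoplus_k E_k^*)}$. -/

import Mathlib

open CategoryTheory Opposite TopologicalSpace
open scoped Manifold ContDiff DirectSum

universe u

/-! ### The graded symmetric algebra and its algebra of formal power series

`𝓘` is a commutative semiring of degrees and `p : 𝓘 →+ ZMod 2` a parity function. A graded module
is a module `V` over a commutative ring `R` with submodules `𝒱 i`, `i : 𝓘`. -/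

namespace GradedGeom

section Sym

variable {𝓘 : Type*} [NonUnitalCommSemiring 𝓘] (p : 𝓘 →+ ZMod 2)
variable {R : Type*} [CommRing R] {V : Type*} [AddCommGroup V] [Module R V]

/-- The relations `v ⊗ w = (-1) ^ p(d(v) d(w)) w ⊗ v`, for homogeneous `v` and `w`. -/
inductive SymRel (𝒱 : 𝓘 → Submodule R V) : TensorAlgebra R V → TensorAlgebra R V → Prop
  | swap {i j : 𝓘} {v w : V} (hv : v ∈ 𝒱 i) (hw : w ∈ 𝒱 j) :
      SymRel 𝒱 (TensorAlgebra.ι R v * TensorAlgebra.ι R w)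
        (((-1 : ℤ) ^ (p (i * j)).val) • (TensorAlgebra.ι R w * TensorAlgebra.ι R v))

/-- The symmetric algebra `S(V)` of a graded module: the quotient of the tensor algebra by the
two-sided ideal generated by `v ⊗ w - (-1) ^ p(d(v) d(w)) w ⊗ v`. -/
def Sym (𝒱 : 𝓘 → Submodule R V) : Type _ := RingQuot (SymRel p 𝒱)

variable (𝒱 : 𝓘 → Submodule R V)

noncomputable instance : Ring (Sym p 𝒱) := inferInstanceAs (Ring (RingQuot (SymRel p 𝒱)))

noncomputable instance : Algebra R (Sym p 𝒱) :=
  inferInstanceAs (Algebra R (RingQuot (SymRel p 𝒱)))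

namespace Sym

/-- The canonical map `V → S(V)`. -/
noncomputable def ι : V →ₗ[R] Sym p 𝒱 :=
  (RingQuot.mkAlgHom R (SymRel p 𝒱)).toLinearMap ∘ₗ TensorAlgebra.ι R

theorem ι_mul_ι {i j : 𝓘} {v w : V} (hv : v ∈ 𝒱 i) (hw : w ∈ 𝒱 j) :
    ι p 𝒱 v * ι p 𝒱 w = ((-1 : ℤ) ^ (p (i * j)).val) • (ι p 𝒱 w * ι p 𝒱 v) := by
  have h := RingQuot.mkAlgHom_rel R (SymRel.swap (p := p) (𝒱 := 𝒱) hv hw)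
  rw [map_mul (RingQuot.mkAlgHom R (SymRel p 𝒱)), map_zsmul,
    map_mul (RingQuot.mkAlgHom R (SymRel p 𝒱))] at h
  exact h

/-- The component `Sⁿ(V)`, spanned by the products of `n` elements of `V`. -/
noncomputable def power (n : ℕ) : Submodule R (Sym p 𝒱) := LinearMap.range (ι p 𝒱) ^ n

/-- The component `Sⁿ(V)ₖ`, spanned by the products of `n` homogeneous elements of `V` whose
degrees add up to `k`. -/
noncomputable def component (n : ℕ) (k : 𝓘) : Submodule R (Sym p 𝒱) :=
  Submodule.span R {x | ∃ (d : Fin n → 𝓘) (v : Fin n → V), (∀ a, v a ∈ 𝒱 (d a)) ∧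
    ∑ a, d a = k ∧ x = (List.ofFn fun a => ι p 𝒱 (v a)).prod}

end Sym

/-- The algebra of formal power series `∏ₙ Sⁿ(V)`: the formal sums `∑ₙ fₙ tⁿ` with `fₙ ∈ Sⁿ(V)`,
where `t` only records the index `n`. -/
noncomputable def FormalSym : Subalgebra R (PowerSeries (Sym p 𝒱)) where
  carrier := {f | ∀ n, PowerSeries.coeff n f ∈ Sym.power p 𝒱 n}
  mul_mem' := by
    intro f g hf hg n
    rw [PowerSeries.coeff_mul]
    refine Submodule.sum_mem _ fun ij hij => ?_
    rw [← Finset.HasAntidiagonal.mem_antidiagonal.1 hij, Sym.power, pow_add]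
    exact Submodule.mul_mem_mul (hf _) (hg _)
  add_mem' := by
    intro f g hf hg n
    rw [map_add]
    exact Submodule.add_mem _ (hf n) (hg n)
  algebraMap_mem' := by
    intro r n
    rw [PowerSeries.algebraMap_apply, PowerSeries.coeff_C]
    split_ifs with h
    · subst h
      rw [Sym.power, pow_zero]
      exact Submodule.algebraMap_mem r
    · exact Submodule.zero_mem _

/-- The elements of degree `k` of `∏ₙ Sⁿ(V)`, namely `∏ₙ Sⁿ(V)ₖ`. -/
noncomputable def FormalSym.deg (k : 𝓘) : Submodule R (FormalSym p 𝒱) where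
  carrier := {f | ∀ n, PowerSeries.coeff n f.1 ∈ Sym.component p 𝒱 n k}
  add_mem' := by
    intro f g hf hg n
    simpa using Submodule.add_mem _ (hf n) (hg n)
  zero_mem' := by
    intro n
    simp
  smul_mem' := by
    intro r f hf n
    simpa using Submodule.smul_mem _ r (hf n)

end Sym

section Map

variable {𝓘 : Type*} [NonUnitalCommSemiring 𝓘] (p : 𝓘 →+ ZMod 2)
variable {R : Type*} [CommRing R] {V : Type*} [AddCommGroup V] [Module R V]
variable {R' : Type*} [CommRing R'] {V' : Type*} [AddCommGroup V'] [Module R' V']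
variable {R'' : Type*} [CommRing R''] {V'' : Type*} [AddCommGroup V''] [Module R'' V'']
variable {𝒱 : 𝓘 → Submodule R V} {𝒱' : 𝓘 → Submodule R' V'} {𝒱'' : 𝓘 → Submodule R'' V''}
variable {ρ : R →+* R'} {ρ' : R' →+* R''} {ρ'' : R →+* R''}

theorem Sym.exists_map (g : V →ₛₗ[ρ] V') (hg : ∀ i, ∀ v ∈ 𝒱 i, g v ∈ 𝒱' i) :
    ∃ F : Sym p 𝒱 →+* Sym p 𝒱',
      (∀ r, F (algebraMap R _ r) = algebraMap R' _ (ρ r)) ∧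
      ∀ v, F (Sym.ι p 𝒱 v) = Sym.ι p 𝒱' (g v) := by
  let _ : Algebra R (Sym p 𝒱') := Algebra.compHom _ ρ
  let g' : V →ₗ[R] Sym p 𝒱' :=
    { toFun := fun v => Sym.ι p 𝒱' (g v)
      map_add' := fun v w => by rw [map_add, map_add]
      map_smul' := fun r v => by
        rw [map_smulₛₗ, map_smul]
        rfl }
  have hrel : ∀ ⦃x y : TensorAlgebra R V⦄, SymRel p 𝒱 x y →
      TensorAlgebra.lift R g' x = TensorAlgebra.lift R g' y := by
    rintro _ _ ⟨hv, hw⟩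
    rw [map_mul (TensorAlgebra.lift R g'), map_zsmul, map_mul (TensorAlgebra.lift R g'),
      TensorAlgebra.lift_ι_apply, TensorAlgebra.lift_ι_apply]
    exact Sym.ι_mul_ι p 𝒱' (hg _ _ hv) (hg _ _ hw)
  let F : RingQuot (SymRel p 𝒱) →ₐ[R] Sym p 𝒱' := RingQuot.liftAlgHom R ⟨_, hrel⟩
  refine ⟨F.toRingHom, fun r => F.commutes r, fun v => ?_⟩
  have h := RingQuot.liftAlgHom_mkAlgHom_apply R (TensorAlgebra.lift R g') hrel
    (TensorAlgebra.ι R v)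
  rw [TensorAlgebra.lift_ι_apply] at h
  exact h

theorem Sym.ringHom_ext {B : Type*} [Ring B] {F G : Sym p 𝒱 →+* B}
    (h : ∀ r, F (algebraMap R _ r) = G (algebraMap R _ r))
    (h' : ∀ v, F (Sym.ι p 𝒱 v) = G (Sym.ι p 𝒱 v)) : F = G := by
  ext x
  obtain ⟨y, rfl⟩ := RingQuot.mkAlgHom_surjective R (SymRel p 𝒱) x
  induction y using TensorAlgebra.induction with
  | algebraMap r => rw [AlgHom.commutes]; exact h r
  | ι v => exact h' v
  | mul a b ha hb => rw [map_mul]; exact (map_mul F _ _).trans ((congrArg₂ _ ha hb).trans (map_mul G _ _).symm)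
  | add a b ha hb => rw [map_add]; exact (map_add F _ _).trans ((congrArg₂ _ ha hb).trans (map_add G _ _).symm)

/-- The ring homomorphism `S(V) → S(V')` induced by a degree-preserving map `V → V'` which is
semilinear over a ring homomorphism `R → R'`. -/
noncomputable def Sym.map (g : V →ₛₗ[ρ] V') (hg : ∀ i, ∀ v ∈ 𝒱 i, g v ∈ 𝒱' i) :
    Sym p 𝒱 →+* Sym p 𝒱' :=
  (Sym.exists_map p g hg).choose

theorem Sym.map_algebraMap (g : V →ₛₗ[ρ] V') (hg : ∀ i, ∀ v ∈ 𝒱 i, g v ∈ 𝒱' i) (r : R) :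
    Sym.map p g hg (algebraMap R _ r) = algebraMap R' _ (ρ r) :=
  (Sym.exists_map p g hg).choose_spec.1 r

theorem Sym.map_ι (g : V →ₛₗ[ρ] V') (hg : ∀ i, ∀ v ∈ 𝒱 i, g v ∈ 𝒱' i) (v : V) :
    Sym.map p g hg (Sym.ι p 𝒱 v) = Sym.ι p 𝒱' (g v) :=
  (Sym.exists_map p g hg).choose_spec.2 v

theorem Sym.map_mem_power (g : V →ₛₗ[ρ] V') (hg : ∀ i, ∀ v ∈ 𝒱 i, g v ∈ 𝒱' i) (n : ℕ)
    {x : Sym p 𝒱} (hx : x ∈ Sym.power p 𝒱 n) : Sym.map p g hg x ∈ Sym.power p 𝒱' n := by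
  rw [Sym.power] at hx ⊢
  induction hx using Submodule.pow_induction_on_left' with
  | algebraMap r =>
    rw [Sym.map_algebraMap, pow_zero]
    exact Submodule.algebraMap_mem _
  | add x y i _ _ hx hy =>
    rw [map_add]
    exact Submodule.add_mem _ hx hy
  | mem_mul m hm i x _ hx =>
    obtain ⟨v, rfl⟩ := hm
    rw [map_mul, Sym.map_ι, pow_succ']
    exact Submodule.mul_mem_mul ⟨_, rfl⟩ hx

/-- The ring homomorphism `∏ₙ Sⁿ(V) → ∏ₙ Sⁿ(V')` induced by `V → V'`. -/
noncomputable def FormalSym.map (g : V →ₛₗ[ρ] V') (hg : ∀ i, ∀ v ∈ 𝒱 i, g v ∈ 𝒱' i) :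
    FormalSym p 𝒱 →+* FormalSym p 𝒱' :=
  ((PowerSeries.map (Sym.map p g hg)).comp (FormalSym p 𝒱).val.toRingHom).codRestrict
    (FormalSym p 𝒱') (by
      intro f n
      have h := Sym.map_mem_power p g hg n (f.2 n)
      rw [← PowerSeries.coeff_map] at h
      exact h)

theorem FormalSym.coeff_map (g : V →ₛₗ[ρ] V') (hg : ∀ i, ∀ v ∈ 𝒱 i, g v ∈ 𝒱' i)
    (f : FormalSym p 𝒱) (n : ℕ) :
    PowerSeries.coeff n (FormalSym.map p g hg f).1 =
      Sym.map p g hg (PowerSeries.coeff n f.1) :=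
  PowerSeries.coeff_map _ _ _

theorem FormalSym.map_algebraMap (g : V →ₛₗ[ρ] V') (hg : ∀ i, ∀ v ∈ 𝒱 i, g v ∈ 𝒱' i) (r : R) :
    FormalSym.map p g hg (algebraMap R _ r) = algebraMap R' _ (ρ r) := by
  apply Subtype.ext
  ext n
  rw [FormalSym.coeff_map]
  change Sym.map p g hg (PowerSeries.coeff n (algebraMap R _ r)) =
    PowerSeries.coeff n (algebraMap R' _ (ρ r))
  rw [PowerSeries.algebraMap_apply, PowerSeries.algebraMap_apply, PowerSeries.coeff_C,
    PowerSeries.coeff_C]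
  split_ifs
  · exact Sym.map_algebraMap p g hg r
  · exact map_zero _

theorem FormalSym.map_eq_self (g : V →ₛₗ[RingHom.id R] V) (hg : ∀ i, ∀ v ∈ 𝒱 i, g v ∈ 𝒱 i)
    (h : ∀ v, g v = v) (f : FormalSym p 𝒱) : FormalSym.map p g hg f = f := by
  have key : Sym.map p g hg = RingHom.id _ :=
    Sym.ringHom_ext p (fun r => Sym.map_algebraMap p g hg r)
      (fun v => (Sym.map_ι p g hg v).trans (by rw [h]; rfl))
  apply Subtype.ext
  ext n
  rw [FormalSym.coeff_map, key]
  rfl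

theorem FormalSym.map_map (g : V →ₛₗ[ρ] V') (hg : ∀ i, ∀ v ∈ 𝒱 i, g v ∈ 𝒱' i)
    (g' : V' →ₛₗ[ρ'] V'') (hg' : ∀ i, ∀ v ∈ 𝒱' i, g' v ∈ 𝒱'' i)
    (g'' : V →ₛₗ[ρ''] V'') (hg'' : ∀ i, ∀ v ∈ 𝒱 i, g'' v ∈ 𝒱'' i)
    (hρ : ∀ r, ρ'' r = ρ' (ρ r)) (h : ∀ v, g'' v = g' (g v)) (f : FormalSym p 𝒱) :
    FormalSym.map p g'' hg'' f = FormalSym.map p g' hg' (FormalSym.map p g hg f) := by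
  have key : Sym.map p g'' hg'' = (Sym.map p g' hg').comp (Sym.map p g hg) :=
    Sym.ringHom_ext p
      (fun r => by
        rw [RingHom.comp_apply, Sym.map_algebraMap, Sym.map_algebraMap, Sym.map_algebraMap, hρ])
      (fun v => by rw [RingHom.comp_apply, Sym.map_ι, Sym.map_ι, Sym.map_ι, h])
  apply Subtype.ext
  ext n
  rw [FormalSym.coeff_map, FormalSym.coeff_map, FormalSym.coeff_map, key]
  rfl

end Map

/-! ### Smooth functions with values in formal power series -/

section Smooth

variable {𝓘 : Type*} [NonUnitalCommSemiring 𝓘] (p : 𝓘 →+ ZMod 2)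
variable {n : ℕ} {N : Type*} [TopologicalSpace N] [ChartedSpace (EuclideanSpace ℝ (Fin n)) N]

theorem contMDiffAt_functional_mul {A : Type*} [Ring A] [Algebra ℝ A] (S T : Submodule ℝ A)
    [FiniteDimensional ℝ S] [FiniteDimensional ℝ T] {f g : N → A} {x : N}
    (hfS : ∀ y, f y ∈ S) (hgT : ∀ y, g y ∈ T)
    (hf : ∀ l : Module.Dual ℝ A, ContMDiffAt (𝓡 n) 𝓘(ℝ) ∞ (fun y => l (f y)) x)
    (hg : ∀ l : Module.Dual ℝ A, ContMDiffAt (𝓡 n) 𝓘(ℝ) ∞ (fun y => l (g y)) x)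
    (l : Module.Dual ℝ A) : ContMDiffAt (𝓡 n) 𝓘(ℝ) ∞ (fun y => l (f y * g y)) x := by
  let b := Module.finBasis ℝ S
  let c := Module.finBasis ℝ T
  choose B hB using fun i => LinearMap.exists_extend (b.coord i)
  choose C hC using fun j => LinearMap.exists_extend (c.coord j)
  have hB' : ∀ i y, B i (f y) = b.coord i ⟨f y, hfS y⟩ := fun i y => by rw [← hB i]; rfl
  have hC' : ∀ j y, C j (g y) = c.coord j ⟨g y, hgT y⟩ := fun j y => by rw [← hC j]; rfl
  have e1 : ∀ y, f y = ∑ i, B i (f y) • (b i : A) := fun y => by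
    have h := congrArg S.subtype (b.sum_repr ⟨f y, hfS y⟩)
    rw [map_sum] at h
    simp only [hB']
    exact h.symm
  have e2 : ∀ y, g y = ∑ j, C j (g y) • (c j : A) := fun y => by
    have h := congrArg T.subtype (c.sum_repr ⟨g y, hgT y⟩)
    rw [map_sum] at h
    simp only [hC']
    exact h.symm
  have e3 : (fun y => l (f y * g y)) =
      fun y => ∑ i, ∑ j, B i (f y) * C j (g y) * l ((b i : A) * (c j : A)) := by
    funext y
    conv_lhs => rw [e1 y, e2 y]
    simp only [Finset.sum_mul, Finset.mul_sum, map_sum, smul_mul_assoc, mul_smul_comm, map_smul,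
      smul_eq_mul]
    rw [Finset.sum_comm]
    refine Finset.sum_congr rfl fun i _ => Finset.sum_congr rfl fun j _ => ?_
    ring
  rw [e3]
  refine ContMDiffAt.sum fun i _ => ContMDiffAt.sum fun j _ => ?_
  exact ((hf (B i)).mul (hg (C j))).mul contMDiffAt_const

variable {V : Type*} [AddCommGroup V] [Module ℝ V] (𝒱 : 𝓘 → Submodule ℝ V)

instance [FiniteDimensional ℝ V] (k : ℕ) : FiniteDimensional ℝ (Sym.power p 𝒱 k) := by
  refine Module.Finite.iff_fg.2 ?_
  rw [Sym.power]
  refine Submodule.FG.pow ?_ k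
  rw [LinearMap.range_eq_map]
  exact Submodule.FG.map _ Module.Finite.fg_top

variable {p 𝒱}

variable (n) in
/-- A function with values in `∏ₖ Sᵏ(V)` is smooth at a point if each of its components, which
takes its values in the finite dimensional space `Sᵏ(V)` when `V` is finite dimensional, is. -/
def SmoothAt (f : N → FormalSym p 𝒱) (x : N) : Prop :=
  ∀ (k : ℕ) (l : Module.Dual ℝ (Sym p 𝒱)),
    ContMDiffAt (𝓡 n) 𝓘(ℝ) ∞ (fun y => l (PowerSeries.coeff k (f y).1)) x

theorem SmoothAt.const (a : FormalSym p 𝒱) (x : N) : SmoothAt n (fun _ : N => a) x :=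
  fun _ _ => contMDiffAt_const

theorem SmoothAt.add {f g : N → FormalSym p 𝒱} {x : N} (hf : SmoothAt n f x) (hg : SmoothAt n g x) :
    SmoothAt n (fun y => f y + g y) x := by
  intro k l
  have h : (fun y => l (PowerSeries.coeff k (f y + g y).1)) =
      fun y => l (PowerSeries.coeff k (f y).1) + l (PowerSeries.coeff k (g y).1) := by
    funext y
    change l (PowerSeries.coeff k ((f y).1 + (g y).1)) = _
    rw [map_add, map_add]
  rw [h]
  exact (hf k l).add (hg k l)

theorem SmoothAt.mul [FiniteDimensional ℝ V] {f g : N → FormalSym p 𝒱} {x : N}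
    (hf : SmoothAt n f x) (hg : SmoothAt n g x) : SmoothAt n (fun y => f y * g y) x := by
  intro k l
  have h : (fun y => l (PowerSeries.coeff k (f y * g y).1)) =
      fun y => ∑ ij ∈ Finset.HasAntidiagonal.antidiagonal k,
        l (PowerSeries.coeff ij.1 (f y).1 * PowerSeries.coeff ij.2 (g y).1) := by
    funext y
    change l (PowerSeries.coeff k ((f y).1 * (g y).1)) = _
    rw [PowerSeries.coeff_mul, map_sum]
  rw [h]
  exact ContMDiffAt.sum fun ij _ => contMDiffAt_functional_mul (Sym.power p 𝒱 ij.1)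
    (Sym.power p 𝒱 ij.2) (fun y => (f y).2 _) (fun y => (g y).2 _) (hf _) (hg _) l

end Smooth

section Model

variable {𝓘 : Type*} (m : 𝓘 →₀ ℕ)

/-- The graded real vector space with `dim Vₖ = m k`. -/
abbrev Model : Type _ := ⨁ k : 𝓘, (Fin (m k) → ℝ)

open Classical in
/-- The homogeneous components of the model space. -/
noncomputable def modelGrading (k : 𝓘) : Submodule ℝ (Model m) :=
  LinearMap.range (DirectSum.lof ℝ 𝓘 (fun k => Fin (m k) → ℝ) k)

instance : FiniteDimensional ℝ (Model m) := by
  let F : Model m →ₗ[ℝ] ((k : m.support) → (Fin (m k.1) → ℝ)) :=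
    LinearMap.pi fun k => DirectSum.component ℝ 𝓘 (fun k => Fin (m k) → ℝ) k.1
  refine FiniteDimensional.of_injective F fun x y h => ?_
  refine DFinsupp.ext fun k => ?_
  by_cases hk : k ∈ m.support
  · exact congrFun h ⟨k, hk⟩
  · have h0 : m k = 0 := by simpa using hk
    funext a
    exact (Fin.cast h0 a).elim0

end Model

/-! ### Graded ringed spaces and graded manifolds -/

/-- An `𝓘`-graded ringed space over `ℝ`: a sheaf of `ℝ`-algebras with subsheaves of homogeneous
sections of degree `i`, compatible with products. Since formal power series are allowed, a section
is a possibly infinite formal sum of homogeneous ones, so no finite decomposition is required. -/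
structure GradedRingedSpace (𝓘 : Type*) [NonUnitalCommSemiring 𝓘] (X : TopCat.{u}) where
  /-- the structure sheaf -/
  sheaf : TopCat.Sheaf (AlgCat.{u} ℝ) X
  /-- the homogeneous sections -/
  deg : (U : Opens X) → 𝓘 → Submodule ℝ (sheaf.presheaf.obj (op U))
  one_mem : ∀ U, 1 ∈ deg U 0
  mul_mem : ∀ U i j a b, a ∈ deg U i → b ∈ deg U j → a * b ∈ deg U (i + j)
  map_mem : ∀ (U V : Opens X) (h : V ≤ U) (i : 𝓘) (a : sheaf.presheaf.obj (op U)), a ∈ deg U i →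
    (sheaf.presheaf.map (homOfLE h).op).hom a ∈ deg V i
  mem_of_local : ∀ (U : Opens X) (i : 𝓘) (a : sheaf.presheaf.obj (op U)),
    (∀ x ∈ U, ∃ (V : Opens X) (h : V ≤ U), x ∈ V ∧
      (sheaf.presheaf.map (homOfLE h).op).hom a ∈ deg V i) → a ∈ deg U i

namespace GradedRingedSpace

variable {𝓘 : Type*} [NonUnitalCommSemiring 𝓘] {X : TopCat.{u}} (𝓜 : GradedRingedSpace 𝓘 X)

/-- The sections over `U`. -/
abbrev sec (U : Opens X) : Type u := 𝓜.sheaf.presheaf.obj (op U)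

/-- The restriction maps. -/
abbrev res {U V : Opens X} (h : V ≤ U) : 𝓜.sec U →ₐ[ℝ] 𝓜.sec V :=
  (𝓜.sheaf.presheaf.map (homOfLE h).op).hom

theorem res_self {U : Opens X} (h : U ≤ U) (a : 𝓜.sec U) : 𝓜.res h a = a := by
  have e : (homOfLE h).op = 𝟙 (op U) := rfl
  rw [res, e, CategoryTheory.Functor.map_id]
  rfl

theorem res_res {U V W : Opens X} (h : V ≤ U) (h' : W ≤ V) (a : 𝓜.sec U) :
    𝓜.res h' (𝓜.res h a) = 𝓜.res (h'.trans h) a := by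
  have e : (homOfLE (h'.trans h)).op = (homOfLE h).op ≫ (homOfLE h').op := rfl
  rw [res, res, res, e, CategoryTheory.Functor.map_comp]
  rfl

end GradedRingedSpace

section Manifold

variable {𝓘 : Type*} [NonUnitalCommSemiring 𝓘] (p : 𝓘 →+ ZMod 2) (n : ℕ) (m : 𝓘 →₀ ℕ)

/-- The sections over `W` of the structure sheaf of a graded domain of dimension `n | m`: the smooth
functions with values in `∏ₖ Sᵏ(V)`, where `V` is the model space. -/
noncomputable def domainSec (W : Opens (EuclideanSpace ℝ (Fin n))) :
    Subalgebra ℝ (W → FormalSym p (modelGrading m)) where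
  carrier := {f | ∀ x, SmoothAt n f x}
  mul_mem' hf hg x := (hf x).mul (hg x)
  add_mem' hf hg x := (hf x).add (hg x)
  algebraMap_mem' r x := SmoothAt.const (n := n) (algebraMap ℝ _ r) x

variable {n} {M : Type u} [TopologicalSpace M]

/-- The preimage of an open subset of `ℝⁿ` under a chart. -/
def chartPreimage (e : OpenPartialHomeomorph M (EuclideanSpace ℝ (Fin n)))
    (W : Opens (EuclideanSpace ℝ (Fin n))) : Opens (TopCat.of M) :=
  ⟨e.source ∩ e ⁻¹' W, e.isOpen_inter_preimage W.2⟩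

theorem chartPreimage_mono (e : OpenPartialHomeomorph M (EuclideanSpace ℝ (Fin n)))
    {W W' : Opens (EuclideanSpace ℝ (Fin n))} (h : W' ≤ W) :
    chartPreimage e W' ≤ chartPreimage e W :=
  fun _ hx => ⟨hx.1, h hx.2⟩

variable (n) [ChartedSpace (EuclideanSpace ℝ (Fin n)) M]

/-- A chart of a graded ringed space over the smooth manifold `M`: an isomorphism of graded ringed
spaces from the restriction to an open subset of `M` to a graded domain, whose underlying
homeomorphism `e` is a smooth chart of `M`. -/
structure GradedChart (𝓜 : GradedRingedSpace 𝓘 (TopCat.of M)) where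
  /-- the underlying chart of `M` -/
  e : OpenPartialHomeomorph M (EuclideanSpace ℝ (Fin n))
  mem_atlas : e ∈ IsManifold.maximalAtlas (𝓡 n) ∞ M
  /-- the isomorphisms on sections -/
  iso : ∀ W : Opens (EuclideanSpace ℝ (Fin n)), (W : Set (EuclideanSpace ℝ (Fin n))) ⊆ e.target →
    (domainSec p n m W ≃ₐ[ℝ] 𝓜.sec (chartPreimage e W))
  natural : ∀ (W : Opens (EuclideanSpace ℝ (Fin n))) hW (W' : Opens (EuclideanSpace ℝ (Fin n))) hW'
    (h : W' ≤ W) (f : domainSec p n m W) (f' : domainSec p n m W'),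
    (∀ y : W', f'.1 y = f.1 ⟨y, h y.2⟩) →
      𝓜.res (chartPreimage_mono e h) (iso W hW f) = iso W' hW' f'
  deg_iff : ∀ W hW (f : domainSec p n m W) (i : 𝓘),
    iso W hW f ∈ 𝓜.deg _ i ↔ ∀ y, f.1 y ∈ FormalSym.deg p (modelGrading m) i

/-- An `𝓘`-graded manifold of dimension `n | m` with underlying manifold `M`: a graded ringed space
over `M` which is locally isomorphic to a graded domain of dimension `n | m`. -/
def IsGradedManifold (𝓜 : GradedRingedSpace 𝓘 (TopCat.of M)) : Prop :=
  m 0 = 0 ∧ ∀ x : M, ∃ c : GradedChart p n m 𝓜, x ∈ c.e.source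

end Manifold

/-! ### The body map, projections and splittings -/

section Batchelor

variable {𝓘 : Type*} [NonUnitalCommSemiring 𝓘] (p : 𝓘 →+ ZMod 2) (n : ℕ)
variable {M : Type u} [TopologicalSpace M] [ChartedSpace (EuclideanSpace ℝ (Fin n)) M]

/-- The algebra `C^∞(U)`. -/
abbrev Csm (U : Opens (TopCat.of M)) : Type u := C^∞⟮𝓡 n, (U : Opens M); 𝓘(ℝ), ℝ⟯

/-- The restriction maps `C^∞(U) → C^∞(V)`. -/
noncomputable def smoothRes {U V : Opens (TopCat.of M)} (h : V ≤ U) : Csm n U →ₐ[ℝ] Csm n V :=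
  { ContMDiffMap.restrictRingHom (𝓡 n) 𝓘(ℝ) ℝ h with commutes' := fun _ => rfl }

variable (M) in
/-- The (pre)sheaf `C^∞` of smooth functions on `M`, as `ℝ`-algebras. -/
noncomputable def smoothFunctions : TopCat.Presheaf (AlgCat.{u} ℝ) (TopCat.of M) where
  obj U := AlgCat.of ℝ (Csm n U.unop)
  map h := AlgCat.ofHom (smoothRes n (leOfHom h.unop))

variable (𝓜 : GradedRingedSpace 𝓘 (TopCat.of M))

/-- A morphism `𝓞 → C^∞` of sheaves of graded algebras over `M`, where `C^∞` is concentrated in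
degree zero. -/
structure BodyMap where
  /-- the morphism of sheaves of algebras -/
  hom : 𝓜.sheaf.presheaf ⟶ smoothFunctions n M
  map_deg : ∀ (U : Opens (TopCat.of M)) (i : 𝓘), i ≠ 0 → ∀ a ∈ 𝓜.deg U i,
    (hom.app (op U)).hom a = 0

variable {n} {𝓜}

/-- The map `𝓞(U) → C^∞(U)` given by a body map. -/
noncomputable def BodyMap.app (ε : BodyMap n 𝓜) (U : Opens (TopCat.of M)) : 𝓜.sec U →ₐ[ℝ] Csm n U :=
  (ε.hom.app (op U)).hom

theorem BodyMap.app_res (ε : BodyMap n 𝓜) {U V : Opens (TopCat.of M)} (h : V ≤ U) (a : 𝓜.sec U) :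
    ε.app V (𝓜.res h a) = smoothRes n h (ε.app U a) :=
  congrArg (fun F => F.hom a) (ε.hom.naturality (homOfLE h).op)

theorem BodyMap.res_mem_sq (ε : BodyMap n 𝓜) {V W : Opens (TopCat.of M)} (h : W ≤ V)
    {a : 𝓜.sec V} (ha : a ∈ RingHom.ker (ε.app V) * RingHom.ker (ε.app V)) :
    𝓜.res h a ∈ RingHom.ker (ε.app W) * RingHom.ker (ε.app W) := by
  have hker : ∀ d ∈ RingHom.ker (ε.app V), 𝓜.res h d ∈ RingHom.ker (ε.app W) := by
    intro d hd
    rw [RingHom.mem_ker] at hd ⊢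
    rw [ε.app_res, hd, map_zero]
  refine Submodule.smul_induction_on ha ?_ ?_
  · intro r hr s hs
    rw [smul_eq_mul, map_mul]
    exact Ideal.mul_mem_mul (hker r hr) (hker s hs)
  · intro r s hr hs
    rw [map_add]
    exact Ideal.add_mem _ hr hs

/-- The section `a` belongs to the square of the sheaf of ideals `ker ε`: locally it belongs to the
square of the ideal `ker ε`. -/
def BodyMap.MemSq (ε : BodyMap n 𝓜) {U : Opens (TopCat.of M)} (a : 𝓜.sec U) : Prop :=
  ∀ x ∈ U, ∃ (V : Opens (TopCat.of M)) (h : V ≤ U), x ∈ V ∧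
    𝓜.res h a ∈ RingHom.ker (ε.app V) * RingHom.ker (ε.app V)

theorem BodyMap.MemSq.add {ε : BodyMap n 𝓜} {U : Opens (TopCat.of M)} {a b : 𝓜.sec U}
    (ha : ε.MemSq a) (hb : ε.MemSq b) : ε.MemSq (a + b) := by
  intro x hx
  obtain ⟨V, hV, hxV, h1⟩ := ha x hx
  obtain ⟨W, hW, hxW, h2⟩ := hb x hx
  refine ⟨V ⊓ W, inf_le_left.trans hV, ⟨hxV, hxW⟩, ?_⟩
  have h3 := Ideal.add_mem _ (ε.res_mem_sq (inf_le_left : V ⊓ W ≤ V) h1)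
    (ε.res_mem_sq (inf_le_right : V ⊓ W ≤ W) h2)
  rw [𝓜.res_res, 𝓜.res_res] at h3
  rw [map_add]
  exact h3

theorem BodyMap.MemSq.zero (ε : BodyMap n 𝓜) (U : Opens (TopCat.of M)) :
    ε.MemSq (0 : 𝓜.sec U) := by
  intro x hx
  refine ⟨U, le_rfl, hx, ?_⟩
  rw [map_zero]
  exact Ideal.zero_mem _

theorem BodyMap.MemSq.mul_left {ε : BodyMap n 𝓜} {U : Opens (TopCat.of M)} (c : 𝓜.sec U)
    {a : 𝓜.sec U} (ha : ε.MemSq a) : ε.MemSq (c * a) := by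
  intro x hx
  obtain ⟨V, hV, hxV, h⟩ := ha x hx
  refine ⟨V, hV, hxV, ?_⟩
  rw [map_mul]
  exact Ideal.mul_mem_left _ _ h

theorem BodyMap.MemSq.res {ε : BodyMap n 𝓜} {U V : Opens (TopCat.of M)} (h : V ≤ U)
    {a : 𝓜.sec U} (ha : ε.MemSq a) : ε.MemSq (𝓜.res h a) := by
  intro x hx
  obtain ⟨W, hW, hxW, h1⟩ := ha x (h hx)
  refine ⟨V ⊓ W, inf_le_left, ⟨hx, hxW⟩, ?_⟩
  have h2 := ε.res_mem_sq (inf_le_right : V ⊓ W ≤ W) h1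
  rw [𝓜.res_res] at h2 ⊢
  exact h2

/-- A splitting of `0 → 𝓞¹ → 𝓞 → C^∞ → 0`, where `𝓞¹ = ker ε`: a morphism `C^∞ → 𝓞` of sheaves of
graded algebras which is a section of `ε`. -/
structure Projection (ε : BodyMap n 𝓜) where
  /-- the morphism of sheaves of algebras -/
  hom : smoothFunctions n M ⟶ 𝓜.sheaf.presheaf
  hom_comp : hom ≫ ε.hom = 𝟙 _
  map_deg : ∀ (U : Opens (TopCat.of M)) (c : Csm n U), (hom.app (op U)).hom c ∈ 𝓜.deg U 0

variable {ε : BodyMap n 𝓜} (φ : Projection ε)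

/-- The map `C^∞(U) → 𝓞(U)` given by a projection. -/
noncomputable def Projection.app (U : Opens (TopCat.of M)) : Csm n U →ₐ[ℝ] 𝓜.sec U :=
  (φ.hom.app (op U)).hom

theorem Projection.app_res {U V : Opens (TopCat.of M)} (h : V ≤ U) (c : Csm n U) :
    φ.app V (smoothRes n h c) = 𝓜.res h (φ.app U c) :=
  congrArg (fun F => F.hom c) (φ.hom.naturality (homOfLE h).op)

/-- `𝓞(U)` as a module over `C^∞(U)`, through a projection. -/
def Projection.Sec (_φ : Projection ε) (U : Opens (TopCat.of M)) : Type u := 𝓜.sec U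

noncomputable instance (U : Opens (TopCat.of M)) : AddCommGroup (φ.Sec U) :=
  inferInstanceAs (AddCommGroup (𝓜.sec U))

noncomputable instance (U : Opens (TopCat.of M)) : Module (Csm n U) (φ.Sec U) :=
  Module.compHom (𝓜.sec U) (φ.app U).toRingHom

namespace Projection

theorem smul_def {U : Opens (TopCat.of M)} (c : Csm n U) (a : φ.Sec U) :
    c • a = (show φ.Sec U from φ.app U c * (show 𝓜.sec U from a)) := rfl

/-- The restriction maps of `𝓞`, as semilinear maps. -/
noncomputable def resₛₗ {U V : Opens (TopCat.of M)} (h : V ≤ U) :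
    φ.Sec U →ₛₗ[(smoothRes n h).toRingHom] φ.Sec V where
  toFun a := 𝓜.res h a
  map_add' a b := map_add (𝓜.res h) a b
  map_smul' c a := (map_mul (𝓜.res h) (φ.app U c) a).trans
    (congrArg (· * 𝓜.res h a) (φ.app_res h c).symm)

/-- The homogeneous sections of degree `i` of `𝓞`. -/
noncomputable def degSec (U : Opens (TopCat.of M)) (i : 𝓘) : Submodule (Csm n U) (φ.Sec U) where
  carrier := {a | (show 𝓜.sec U from a) ∈ 𝓜.deg U i}
  add_mem' := (𝓜.deg U i).add_mem
  zero_mem' := (𝓜.deg U i).zero_mem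
  smul_mem' c a ha := by
    have h := 𝓜.mul_mem U 0 i _ _ (φ.map_deg U c) ha
    rw [zero_add] at h
    exact h

/-- `𝓞¹ = ker ε`. -/
noncomputable def O1 (U : Opens (TopCat.of M)) : Submodule (Csm n U) (φ.Sec U) where
  carrier := {a | ε.app U a = 0}
  add_mem' {a b} ha hb := (map_add (ε.app U) a b).trans
    ((congrArg₂ (· + ·) ha hb).trans (add_zero 0))
  zero_mem' := map_zero (ε.app U)
  smul_mem' c a ha := (map_mul (ε.app U) (φ.app U c) a).trans
    ((congrArg (ε.app U (φ.app U c) * ·) ha).trans (mul_zero _))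

/-- `𝓞²`, the square of the sheaf of ideals `𝓞¹`. -/
noncomputable def O2 (U : Opens (TopCat.of M)) : Submodule (Csm n U) (φ.Sec U) where
  carrier := {a | ε.MemSq (show 𝓜.sec U from a)}
  add_mem' ha hb := BodyMap.MemSq.add ha hb
  zero_mem' := BodyMap.MemSq.zero ε U
  smul_mem' c _ ha := BodyMap.MemSq.mul_left (φ.app U c) ha

theorem res_mem_O1 {U V : Opens (TopCat.of M)} (h : V ≤ U) {a : φ.Sec U} (ha : a ∈ φ.O1 U) :
    φ.resₛₗ h a ∈ φ.O1 V :=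
  (ε.app_res h a).trans ((congrArg (smoothRes n h) ha).trans (map_zero _))

theorem res_mem_O2 {U V : Opens (TopCat.of M)} (h : V ≤ U) {a : φ.Sec U} (ha : a ∈ φ.O2 U) :
    φ.resₛₗ h a ∈ φ.O2 V :=
  BodyMap.MemSq.res h ha

/-- The `C^∞(U)`-module of sections over `U` of the quotient `𝓕 = 𝓞¹ / 𝓞²`. -/
abbrev F (U : Opens (TopCat.of M)) : Type u := ↥(φ.O1 U) ⧸ (φ.O2 U).submoduleOf (φ.O1 U)

/-- The quotient map `𝓞¹(U) → 𝓕(U)`. -/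
noncomputable def π (U : Opens (TopCat.of M)) : φ.O1 U →ₗ[Csm n U] φ.F U :=
  ((φ.O2 U).submoduleOf (φ.O1 U)).mkQ

/-- The restriction maps of `𝓞¹`. -/
noncomputable def resO1 {U V : Opens (TopCat.of M)} (h : V ≤ U) :
    φ.O1 U →ₛₗ[(smoothRes n h).toRingHom] φ.O1 V :=
  (φ.resₛₗ h).restrict fun _ ha => φ.res_mem_O1 h ha

/-- The restriction maps of `𝓕`. -/
noncomputable def resF {U V : Opens (TopCat.of M)} (h : V ≤ U) :
    φ.F U →ₛₗ[(smoothRes n h).toRingHom] φ.F V :=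
  Submodule.mapQ _ _ (φ.resO1 h) fun _ ha => φ.res_mem_O2 h ha

/-- The homogeneous sections of degree `i` of `𝓕`. -/
noncomputable def degF (U : Opens (TopCat.of M)) (i : 𝓘) : Submodule (Csm n U) (φ.F U) :=
  ((φ.degSec U i).submoduleOf (φ.O1 U)).map (φ.π U)

theorem resF_π {U V : Opens (TopCat.of M)} (h : V ≤ U) (a : φ.O1 U) :
    φ.resF h (φ.π U a) = φ.π V (φ.resO1 h a) := rfl

theorem resF_mem_degF {U V : Opens (TopCat.of M)} (h : V ≤ U) (i : 𝓘) (s : φ.F U)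
    (hs : s ∈ φ.degF U i) : φ.resF h s ∈ φ.degF V i := by
  obtain ⟨a, ha, rfl⟩ := hs
  exact ⟨φ.resO1 h a, 𝓜.map_mem U V h i _ ha, rfl⟩

theorem resF_self {U : Opens (TopCat.of M)} (h : U ≤ U) (s : φ.F U) : φ.resF h s = s := by
  obtain ⟨a, rfl⟩ := Submodule.mkQ_surjective _ s
  exact congrArg (φ.π U) (Subtype.ext (𝓜.res_self h a.1))

theorem resF_resF {U V W : Opens (TopCat.of M)} (h : V ≤ U) (h' : W ≤ V) (s : φ.F U) :
    φ.resF (h'.trans h) s = φ.resF h' (φ.resF h s) := by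
  obtain ⟨a, rfl⟩ := Submodule.mkQ_surjective _ s
  exact congrArg (φ.π W) (Subtype.ext (𝓜.res_res h h' a.1).symm)

/-- The presheaf of abelian groups `U ↦ 𝓞¹(U) / 𝓞²(U)`. -/
noncomputable def presheafF : TopCat.Presheaf AddCommGrpCat.{u} (TopCat.of M) where
  obj U := AddCommGrpCat.of (φ.F U.unop)
  map h := AddCommGrpCat.ofHom (φ.resF (leOfHom h.unop)).toAddMonoidHom
  map_id U := by
    ext s
    exact φ.resF_self _ s
  map_comp h h' := by
    ext s
    exact φ.resF_resF _ _ s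

/-- A splitting of the sequence `0 → 𝓞² → 𝓞¹ → 𝓕 → 0` of graded `C^∞`-modules exists. -/
def IsSplit : Prop :=
  ∃ σ : ∀ U : Opens (TopCat.of M), φ.F U →ₗ[Csm n U] φ.O1 U,
    (∀ U s, φ.π U (σ U s) = s) ∧
    (∀ (U V : Opens (TopCat.of M)) (h : V ≤ U) (s : φ.F U),
      φ.resO1 h (σ U s) = σ V (φ.resF h s)) ∧
    (∀ U i, ∀ s ∈ φ.degF U i, (σ U s : φ.Sec U) ∈ φ.degSec U i)

/-- The algebra of formal power series on the graded `C^∞(U)`-module `𝓕(U)`. -/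
abbrev SymF (U : Opens (TopCat.of M)) : Type u := FormalSym p (φ.degF U)

noncomputable instance (U : Opens (TopCat.of M)) : Algebra ℝ (φ.SymF p U) :=
  Algebra.compHom _ (algebraMap ℝ (Csm n U))

/-- The restriction maps `∏ₖ Sᵏ(𝓕(U)) → ∏ₖ Sᵏ(𝓕(V))`. -/
noncomputable def resSymF {U V : Opens (TopCat.of M)} (h : V ≤ U) :
    φ.SymF p U →ₐ[ℝ] φ.SymF p V :=
  { FormalSym.map p (φ.resF h) (φ.resF_mem_degF h) with
    commutes' := fun r => FormalSym.map_algebraMap p (φ.resF h) (φ.resF_mem_degF h)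
      (algebraMap ℝ (Csm n U) r) }

/-- The presheaf `U ↦ ∏ₖ Sᵏ(𝓕(U))`. -/
noncomputable def presheafSymF : TopCat.Presheaf (AlgCat.{u} ℝ) (TopCat.of M) where
  obj U := AlgCat.of ℝ (φ.SymF p U.unop)
  map h := AlgCat.ofHom (φ.resSymF p (leOfHom h.unop))
  map_id U := by
    refine AlgCat.Hom.ext (AlgHom.ext fun f => ?_)
    exact FormalSym.map_eq_self p _ _ (φ.resF_self _) f
  map_comp h h' := by
    refine AlgCat.Hom.ext (AlgHom.ext fun f => ?_)
    exact FormalSym.map_map p (φ.resF (leOfHom h.unop)) (φ.resF_mem_degF _)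
      (φ.resF (leOfHom h'.unop)) (φ.resF_mem_degF _) _ (φ.resF_mem_degF _) (fun _ => rfl)
      (φ.resF_resF _ _) f

/-- The formal symmetric power of `𝓕`: the sheafification of `U ↦ ∏ₖ Sᵏ(𝓕(U))`. -/
noncomputable def sheafSymF : TopCat.Presheaf (AlgCat.{u} ℝ) (TopCat.of M) :=
  sheafify (Opens.grothendieckTopology (TopCat.of M)) (φ.presheafSymF p)

/-- The canonical map `∏ₖ Sᵏ(𝓕(U)) → Γ(U, S(𝓕))`. -/
noncomputable def toSheafSymF (U : Opens (TopCat.of M)) :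
    φ.SymF p U →ₐ[ℝ] (φ.sheafSymF p).obj (op U) :=
  ((toSheafify (Opens.grothendieckTopology (TopCat.of M)) (φ.presheafSymF p)).app (op U)).hom

/-- A section of the formal symmetric power of `𝓕` is homogeneous of degree `k` if locally it comes
from homogeneous elements of degree `k`. -/
def IsHomogeneousSymF (U : Opens (TopCat.of M)) (k : 𝓘) (s : (φ.sheafSymF p).obj (op U)) : Prop :=
  ∀ x ∈ U, ∃ (V : Opens (TopCat.of M)) (h : V ≤ U), x ∈ V ∧
    ∃ f ∈ FormalSym.deg p (φ.degF V) k,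
      φ.toSheafSymF p V f = ((φ.sheafSymF p).map (homOfLE h).op).hom s

/-- `𝓞` is isomorphic, as a sheaf of graded `C^∞`-algebras, to the formal symmetric power of
`𝓕 = 𝓞¹ / 𝓞²`. -/
def IsoFormalSym : Prop :=
  ∃ Ψ : 𝓜.sheaf.presheaf ≅ φ.sheafSymF p,
    (∀ (U : Opens (TopCat.of M)) (c : Csm n U),
      (Ψ.hom.app (op U)).hom (φ.app U c) =
        φ.toSheafSymF p U (algebraMap (Csm n U) (φ.SymF p U) c)) ∧
    (∀ (U : Opens (TopCat.of M)) (k : 𝓘) (a : 𝓜.sec U),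
      a ∈ 𝓜.deg U k ↔ φ.IsHomogeneousSymF p U k ((Ψ.hom.app (op U)).hom a))

end Projection

/-! ### Graded vector bundles -/

variable (n M) in
/-- A smooth `𝓘`-graded vector bundle `E = ⨁ₖ Eₖ` over `M`, where `Eₖ` has rank `m k`. -/
structure GradedVectorBundle (m : 𝓘 →₀ ℕ) where
  /-- the fibres of `Eₖ` -/
  fiber : 𝓘 → M → Type
  [addCommGroup : ∀ k x, AddCommGroup (fiber k x)]
  [module : ∀ k x, Module ℝ (fiber k x)]
  [topFiber : ∀ k x, TopologicalSpace (fiber k x)]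
  [topTotal : ∀ k, TopologicalSpace (Bundle.TotalSpace (Fin (m k) → ℝ) (fiber k))]
  [fiberBundle : ∀ k, FiberBundle (Fin (m k) → ℝ) (fiber k)]
  [vectorBundle : ∀ k, VectorBundle ℝ (Fin (m k) → ℝ) (fiber k)]
  [smooth : ∀ k, ContMDiffVectorBundle ∞ (Fin (m k) → ℝ) (fiber k) (𝓡 n)]

namespace GradedVectorBundle

attribute [instance] addCommGroup module topFiber topTotal fiberBundle vectorBundle smooth

variable {m : 𝓘 →₀ ℕ} (E : GradedVectorBundle n M m)

/-- The fibre `⨁ₖ Eₖ*` over `x`. -/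
def Dual (x : M) : Type _ := ⨁ k : 𝓘, Module.Dual ℝ (E.fiber k x)

noncomputable instance (x : M) : AddCommGroup (E.Dual x) :=
  inferInstanceAs (AddCommGroup (⨁ k : 𝓘, Module.Dual ℝ (E.fiber k x)))

noncomputable instance (x : M) : Module ℝ (E.Dual x) :=
  inferInstanceAs (Module ℝ (⨁ k : 𝓘, Module.Dual ℝ (E.fiber k x)))

open Classical in
/-- The component `Eₖ*`, which consists of elements of degree `k`. -/
noncomputable def dualGrading (x : M) (k : 𝓘) : Submodule ℝ (E.Dual x) :=
  LinearMap.range (DirectSum.lof ℝ 𝓘 (fun k => Module.Dual ℝ (E.fiber k x)) k)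

/-- The fibre `∏ⱼ Sʲ(⨁ₖ Eₖ*)` over `x`. -/
noncomputable abbrev SymDual (x : M) : Subalgebra ℝ (PowerSeries (Sym p (E.dualGrading x))) :=
  FormalSym p (E.dualGrading x)

/-- The map `Eₖ* → ℝ^(m k)` over `y` given by the preferred local trivialization around `x`. -/
noncomputable def dualCoord (x y : M) (k : 𝓘) :
    Module.Dual ℝ (E.fiber k y) →ₗ[ℝ] (Fin (m k) → ℝ) :=
  LinearMap.pi fun a => Module.Dual.eval ℝ (E.fiber k y)
    ((trivializationAt (Fin (m k) → ℝ) (E.fiber k) x).symmₗ ℝ y (Pi.single a 1))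

/-- The map from the fibre of `⨁ₖ Eₖ*` over `y` to the model space given by the preferred local
trivializations around `x`. -/
noncomputable def dualTriv (x y : M) : E.Dual y →ₗ[ℝ] Model m :=
  DirectSum.lmap (E.dualCoord x y)

theorem dualTriv_mem (x y : M) (k : 𝓘) (v : E.Dual y) (hv : v ∈ E.dualGrading y k) :
    E.dualTriv x y v ∈ modelGrading m k := by
  classical
  obtain ⟨l, rfl⟩ := hv
  refine ⟨E.dualCoord x y k l, ?_⟩
  exact (DirectSum.lmap_lof (f := E.dualCoord x y) k l).symm

/-- The sections over `U` of the bundle with fibres `∏ⱼ Sʲ(⨁ₖ Eₖ*)`: the families that are smooth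
in local trivializations. -/
noncomputable def sections (U : Opens (TopCat.of M)) :
    Subalgebra ℝ ((y : (U : Opens M)) → E.SymDual p y) where
  carrier := {s | ∀ x : (U : Opens M), SmoothAt n
    (fun y : (U : Opens M) => FormalSym.map p (E.dualTriv x y) (E.dualTriv_mem x y) (s y)) x}
  mul_mem' {s t} hs ht x := by
    have h := (hs x).mul (ht x)
    simp only [← map_mul] at h
    exact h
  add_mem' {s t} hs ht x := by
    have h := (hs x).add (ht x)
    simp only [← map_add] at h
    exact h
  algebraMap_mem' r x := by
    have h := SmoothAt.const (p := p) (n := n) (N := (U : Opens M))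
      (algebraMap ℝ (FormalSym p (modelGrading m)) r) x
    have e : (fun y : (U : Opens M) => FormalSym.map p (E.dualTriv x y) (E.dualTriv_mem x y)
        (algebraMap ℝ (E.SymDual p y) r)) = fun _ => algebraMap ℝ _ r :=
      funext fun y => FormalSym.map_algebraMap p _ _ r
    rw [← e] at h
    exact h

end GradedVectorBundle

/-- `𝓞` is isomorphic, as a sheaf of graded `C^∞`-algebras, to the sheaf of sections of the bundle
with fibres `∏ⱼ Sʲ(⨁ₖ Eₖ*)`. -/
def Projection.IsoBundle {m : 𝓘 →₀ ℕ} (E : GradedVectorBundle n M m) : Prop :=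
  ∃ Ψ : ∀ U : Opens (TopCat.of M), 𝓜.sec U ≃ₐ[ℝ] E.sections p U,
    (∀ (U V : Opens (TopCat.of M)) (h : V ≤ U) (a : 𝓜.sec U) (y : V),
      (Ψ V (𝓜.res h a)).1 y = (Ψ U a).1 ⟨y, h y.2⟩) ∧
    (∀ (U : Opens (TopCat.of M)) (c : Csm n U) (y : (U : Opens M)),
      (Ψ U (φ.app U c)).1 y = algebraMap ℝ _ (c y)) ∧
    (∀ (U : Opens (TopCat.of M)) (k : 𝓘) (a : 𝓜.sec U),
      a ∈ 𝓜.deg U k ↔ ∀ y : (U : Opens M), (Ψ U a).1 y ∈ FormalSym.deg p (E.dualGrading y.1) k)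

end Batchelor

end GradedGeom

/-!
# Batchelor's theorem for `𝓘`-graded manifolds

The structure sheaf `𝓞` is handled through its *trivializations* (`Triv`): isomorphisms, over open
sets `W ⊆ M`, with the sheaf of smooth functions with values in the formal power series `∏ₖ Sᵏ(V)`
(`SmoothSec`). They cover `M` (`GradedChart.toTriv`). The proof compares them, glues what is
canonical, and averages the rest by a partition of unity.

*The body.* A section `f` differs from its constant term by a combination of the linear coordinates,
which lie in non-zero degrees because `V₀ = 0`. So the value of the constant term at `x` is the
only character of the stalk of `𝓞` at `x` which kills the sections of non-zero degree
(`Triv.functional_eq`). It is thus independent of the trivialization, which gives existence and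
uniqueness of `ε` (`exists_bodyMap`, `BodyMap.ext_of_atlas`). The sections whose components in
`Sᵏ(V)` vanish for `k < j` are, locally, combinations of `j`-fold products of sections without
constant term, so that the filtration by order is independent of the trivialization as well
(`MemFil`, `MemFil.of_triv`), and `𝓞¹`, `𝓞²` are the sections of order at least `1` and `2`
(`memFil_one_iff`, `memFil_two_iff`).

*Euler operators.* In a trivialization, multiplication of `Sᵏ(V)` by `k` is a degree-preserving
derivation, which acts as `j` on the sections of order `j` modulo those of order `j + 1`. Whatever
the trivialization, this action is the same; hence the sum of the Euler operators of several
trivializations, weighted by a partition of unity, has the property as well (`exists_eulerOp`). For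
such an operator every class in the `j`-th graded piece is represented by exactly one section with
eigenvalue `j`: terms of order `j + t + 1` are removed successively, dividing by
`(j + t + 1) - j ≠ 0`, and the procedure converges as formal power series are complete
(`SmoothSec.existsUnique_eigenvector`); uniqueness makes the local solutions glue
(`EulerOp.exists_eig`). Eigenvalues add up in products.

*Projection and splitting.* For `j = 0` the eigenvectors form a subalgebra on which `ε` is
bijective, and its inverse is a projection `φ` (`EulerOp.exists_projection`). If `φ` is given,
every trivialization can be changed so that `φ` becomes the inclusion of the functions without
terms of positive order (`Triv.exists_change_ofFun`). The Euler operator obtained from the new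
trivializations kills the image of `φ`, so it is linear over `C^∞`, and its eigenvectors for `j = 1`
form a `C^∞`-linear complement of `𝓞²` in `𝓞¹` (`EulerOp.isSplit`). As a direct summand of the sheaf
`𝓞¹`, the presheaf `𝓞¹/𝓞²` is a sheaf (`Projection.isSheaf_presheafF`).

*Linear transition maps.* The trivializations can be changed once more, so that the splitting maps
`𝓕` to the linear coordinates (`Triv.exists_adapted`). The transition maps then preserve real
functions and linear sections; homomorphisms that respect the order are determined by their values
on these (`SmoothSec.ringHom_ext`), so the transition maps are induced by automorphisms of the
graded vector space `V` that depend smoothly on the point (`Projection.IsSplit.exists_linearAtlas`).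
Multiplication of linear sections gives homomorphisms from the formal symmetric powers of `𝓕(U)` to
`𝓞(U)` which are bijective over the domain of a trivialization, hence an isomorphism on the
sheafification (`LinearAtlas.isoFormalSym`). The transposes of the blocks of the transition maps are
the cocycle of the bundle `E` (`LinearAtlas.core`, `LinearAtlas.exists_isoBundle`).

Both changes of trivialization rest on `SmoothSec.exists_change_of_generators`: real functions and
linear coordinates may be perturbed by terms of higher order, and the perturbation extends to an
automorphism of the algebra of smooth functions with values in `∏ₖ Sᵏ(V)`.
-/

namespace GradedGeom

/-! ### The graded symmetric algebra -/

section Algebra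

variable {𝓘 : Type*} [NonUnitalCommSemiring 𝓘] (p : 𝓘 →+ ZMod 2)
variable {R : Type*} [CommRing R] {V : Type*} [AddCommGroup V] [Module R V]
variable (𝒱 : 𝓘 → Submodule R V)

theorem neg_one_pow_val_add (a b : ZMod 2) :
    (-1 : ℤ) ^ (a + b).val = (-1 : ℤ) ^ a.val * (-1 : ℤ) ^ b.val := by
  revert a b
  decide

namespace Sym

variable {p 𝒱} in
/-- The universal property of the graded symmetric algebra. -/
theorem exists_lift {A : Type*} [Ring A] [Algebra R A] (g : V →ₗ[R] A)
    (hg : ∀ i j, ∀ v ∈ 𝒱 i, ∀ w ∈ 𝒱 j,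
      g v * g w = ((-1 : ℤ) ^ (p (i * j)).val) • (g w * g v)) :
    ∃ F : Sym p 𝒱 →ₐ[R] A, ∀ v, F (ι p 𝒱 v) = g v := by
  have hrel : ∀ ⦃x y : TensorAlgebra R V⦄, SymRel p 𝒱 x y →
      TensorAlgebra.lift R g x = TensorAlgebra.lift R g y := by
    rintro _ _ ⟨hv, hw⟩
    rw [map_mul (TensorAlgebra.lift R g), map_zsmul, map_mul (TensorAlgebra.lift R g),
      TensorAlgebra.lift_ι_apply, TensorAlgebra.lift_ι_apply]
    exact hg _ _ _ hv _ hw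
  let F : RingQuot (SymRel p 𝒱) →ₐ[R] A := RingQuot.liftAlgHom R ⟨_, hrel⟩
  refine ⟨F, fun v => ?_⟩
  have h := RingQuot.liftAlgHom_mkAlgHom_apply R (TensorAlgebra.lift R g) hrel
    (TensorAlgebra.ι R v)
  rw [TensorAlgebra.lift_ι_apply] at h
  exact h

variable {p 𝒱} in
theorem induction {P : Sym p 𝒱 → Prop} (algebraMap : ∀ r, P (algebraMap R _ r))
    (ι : ∀ v, P (ι p 𝒱 v)) (mul : ∀ a b, P a → P b → P (a * b))
    (add : ∀ a b, P a → P b → P (a + b)) (x : Sym p 𝒱) : P x := by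
  obtain ⟨y, rfl⟩ := RingQuot.mkAlgHom_surjective R (SymRel p 𝒱) x
  induction y using TensorAlgebra.induction with
  | algebraMap r => rw [AlgHom.commutes]; exact algebraMap r
  | ι v => exact ι v
  | mul a b ha hb => rw [map_mul]; exact mul _ _ ha hb
  | add a b ha hb => rw [map_add]; exact add _ _ ha hb

/-- The augmentation `S(V) → R`, which kills `V`. -/
noncomputable def aug : Sym p 𝒱 →ₐ[R] R :=
  (exists_lift (p := p) (𝒱 := 𝒱) (0 : V →ₗ[R] R) (by intros; simp)).choose

/-- The map `V → End (R × V)` sending `v` to `(r, w) ↦ (0, r v)`; products of two values vanish. -/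
def nilRep : V →ₗ[R] Module.End R (R × V) where
  toFun v := LinearMap.inr R R V ∘ₗ LinearMap.toSpanSingleton R V v ∘ₗ LinearMap.fst R R V
  map_add' v w := by
    ext <;> simp
  map_smul' r v := by
    ext <;> simp

theorem nilRep_mul (v w : V) : nilRep (R := R) v * nilRep (R := R) w = 0 := by
  ext <;> simp [nilRep]

theorem exists_rep : ∃ F : Sym p 𝒱 →ₐ[R] Module.End R (R × V),
    ∀ v, F (ι p 𝒱 v) = nilRep v :=
  exists_lift _ fun i j v _ w _ => by rw [nilRep_mul, nilRep_mul, smul_zero]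

/-- The projection `S(V) → V` onto the linear part. -/
noncomputable def lin : Sym p 𝒱 →ₗ[R] V :=
  LinearMap.snd R R V ∘ₗ LinearMap.applyₗ ((1, 0) : R × V) ∘ₗ
    (exists_rep p 𝒱).choose.toLinearMap

@[simp]
theorem lin_ι (v : V) : lin p 𝒱 (ι p 𝒱 v) = v := by
  have h := (exists_rep p 𝒱).choose_spec v
  change ((exists_rep p 𝒱).choose (ι p 𝒱 v) (1, 0)).2 = v
  rw [h]
  simp [nilRep]

variable {p 𝒱}

theorem mem_power_zero {x : Sym p 𝒱} (hx : x ∈ power p 𝒱 0) :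
    x = algebraMap R _ (aug p 𝒱 x) := by
  rw [power, pow_zero, Submodule.mem_one] at hx
  obtain ⟨r, rfl⟩ := hx
  rw [AlgHom.commutes]
  rfl

theorem mem_power_one {x : Sym p 𝒱} (hx : x ∈ power p 𝒱 1) : x = ι p 𝒱 (lin p 𝒱 x) := by
  rw [power, pow_one] at hx
  obtain ⟨v, rfl⟩ := hx
  rw [lin_ι]

theorem one_mem_power : (1 : Sym p 𝒱) ∈ power p 𝒱 0 := by
  rw [power, pow_zero]
  exact Submodule.one_le.1 le_rfl

theorem ι_mem_power (v : V) : ι p 𝒱 v ∈ power p 𝒱 1 := by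
  rw [power, pow_one]
  exact ⟨v, rfl⟩

theorem mul_mem_power {a b : ℕ} {x y : Sym p 𝒱} (hx : x ∈ power p 𝒱 a) (hy : y ∈ power p 𝒱 b) :
    x * y ∈ power p 𝒱 (a + b) := by
  rw [power, pow_add]
  exact Submodule.mul_mem_mul hx hy

theorem one_mem_component : (1 : Sym p 𝒱) ∈ component p 𝒱 0 0 :=
  Submodule.subset_span ⟨Fin.elim0, Fin.elim0, fun a => a.elim0, by simp, by simp⟩

theorem ι_mul_mem_component {i j : 𝓘} {k : ℕ} {v : V} (hv : v ∈ 𝒱 i) {x : Sym p 𝒱}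
    (hx : x ∈ component p 𝒱 k j) : ι p 𝒱 v * x ∈ component p 𝒱 (k + 1) (i + j) := by
  induction hx using Submodule.span_induction with
  | mem x hx =>
    obtain ⟨d, w, hw, rfl, rfl⟩ := hx
    refine Submodule.subset_span ⟨Fin.cons i d, Fin.cons v w, fun a => ?_, ?_, ?_⟩
    · induction a using Fin.cases with
      | zero => exact hv
      | succ a => exact hw a
    · rw [Fin.sum_univ_succ]
      simp
    · rw [List.ofFn_succ, List.prod_cons]
      simp
  | zero => rw [mul_zero]; exact Submodule.zero_mem _
  | add x y _ _ hx hy => rw [mul_add]; exact Submodule.add_mem _ hx hy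
  | smul r x _ hx => rw [mul_smul_comm]; exact Submodule.smul_mem _ _ hx

/-- Induction on homogeneous products, adding one factor on the left at a time. -/
theorem component_induction {P : ℕ → 𝓘 → Sym p 𝒱 → Prop} (zero : ∀ k i, P k i 0)
    (add : ∀ k i x y, P k i x → P k i y → P k i (x + y))
    (smul : ∀ k i (r : R) x, P k i x → P k i (r • x)) (one : P 0 0 1)
    (ι_mul : ∀ k i j, ∀ v ∈ 𝒱 i, ∀ x ∈ component p 𝒱 k j, P k j x →
      P (k + 1) (i + j) (ι p 𝒱 v * x))
    {k : ℕ} {i : 𝓘} {x : Sym p 𝒱} (hx : x ∈ component p 𝒱 k i) : P k i x := by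
  induction hx using Submodule.span_induction with
  | mem x hx =>
    obtain ⟨d, v, hv, hd, rfl⟩ := hx
    suffices h : ∀ (k : ℕ) (d : Fin k → 𝓘) (v : Fin k → V), (∀ a, v a ∈ 𝒱 (d a)) →
        (List.ofFn fun a => ι p 𝒱 (v a)).prod ∈ component p 𝒱 k (∑ a, d a) ∧
        P k (∑ a, d a) (List.ofFn fun a => ι p 𝒱 (v a)).prod by
      rw [← hd]
      exact (h k d v hv).2
    intro k
    induction k with
    | zero =>
      intro d v _
      simpa using ⟨one_mem_component, one⟩
    | succ k ih =>
      intro d v hv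
      have h := ih (fun a => d a.succ) (fun a => v a.succ) fun a => hv a.succ
      rw [List.ofFn_succ, List.prod_cons, Fin.sum_univ_succ]
      exact ⟨ι_mul_mem_component (hv 0) h.1, ι_mul _ _ _ _ (hv 0) _ h.1 h.2⟩
  | zero => exact zero _ _
  | add x y _ _ hx hy => exact add _ _ _ _ hx hy
  | smul r x _ hx => exact smul _ _ _ _ hx

theorem mul_mem_component {i j : 𝓘} {k l : ℕ} {x y : Sym p 𝒱} (hx : x ∈ component p 𝒱 k i)
    (hy : y ∈ component p 𝒱 l j) : x * y ∈ component p 𝒱 (k + l) (i + j) := by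
  refine component_induction (P := fun k i x => x * y ∈ component p 𝒱 (k + l) (i + j))
    ?_ ?_ ?_ ?_ ?_ hx
  · intro k i
    rw [zero_mul]
    exact Submodule.zero_mem _
  · intro k i x x' hx hx'
    rw [add_mul]
    exact Submodule.add_mem _ hx hx'
  · intro k i r x hx
    rw [smul_mul_assoc]
    exact Submodule.smul_mem _ _ hx
  · simpa using hy
  · intro k i j' v hv x _ hx
    have h := ι_mul_mem_component hv hx
    rwa [← mul_assoc, ← add_assoc, add_right_comm k l 1] at h

theorem ι_mem_component {i : 𝓘} {v : V} (hv : v ∈ 𝒱 i) : ι p 𝒱 v ∈ component p 𝒱 1 i := by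
  have h := ι_mul_mem_component (p := p) hv one_mem_component
  rwa [mul_one, add_zero] at h

theorem component_le_power (k : ℕ) (i : 𝓘) : component p 𝒱 k i ≤ power p 𝒱 k := by
  intro x hx
  refine component_induction (P := fun k i x => x ∈ power p 𝒱 k)
    (fun _ _ => Submodule.zero_mem _) (fun _ _ _ _ => Submodule.add_mem _)
    (fun _ _ r _ => Submodule.smul_mem _ r) one_mem_power ?_ hx
  intro k i j v _ x _ hx
  rw [add_comm]
  exact mul_mem_power (ι_mem_power v) hx

theorem component_zero_eq_zero {i : 𝓘} (hi : i ≠ 0) {x : Sym p 𝒱} (hx : x ∈ component p 𝒱 0 i) :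
    x = 0 := by
  refine component_induction (P := fun k i x => k = 0 → i ≠ 0 → x = 0) ?_ ?_ ?_ ?_ ?_ hx rfl hi
  · intros; rfl
  · intro k i x y hx hy hk hi
    rw [hx hk hi, hy hk hi, add_zero]
  · intro k i r x hx hk hi
    rw [hx hk hi, smul_zero]
  · intro _ h
    exact absurd rfl h
  · intro k i j v _ x _ _ h
    exact absurd h (Nat.succ_ne_zero k)

theorem ι_mul_comm {i j : 𝓘} {k : ℕ} {v : V} (hv : v ∈ 𝒱 i) {x : Sym p 𝒱}
    (hx : x ∈ component p 𝒱 k j) :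
    ι p 𝒱 v * x = ((-1 : ℤ) ^ (p (i * j)).val) • (x * ι p 𝒱 v) := by
  refine component_induction
    (P := fun k j x => ι p 𝒱 v * x = ((-1 : ℤ) ^ (p (i * j)).val) • (x * ι p 𝒱 v))
    ?_ ?_ ?_ ?_ ?_ hx
  · intros; simp
  · intro k j x y hx hy
    rw [mul_add, hx, hy, add_mul, smul_add]
  · intro k i r x hx
    rw [mul_smul_comm, hx, smul_mul_assoc, smul_comm]
  · simp
  · intro k i' j w hw x _ hx
    rw [← mul_assoc, ι_mul_ι p 𝒱 hv hw, smul_mul_assoc, mul_assoc, hx, mul_smul_comm, smul_smul,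
      ← neg_one_pow_val_add, ← map_add, ← mul_add, mul_assoc]

theorem component_mul_comm {i j : 𝓘} {k l : ℕ} {x y : Sym p 𝒱} (hx : x ∈ component p 𝒱 k i)
    (hy : y ∈ component p 𝒱 l j) :
    x * y = ((-1 : ℤ) ^ (p (i * j)).val) • (y * x) := by
  refine component_induction
    (P := fun k i x => x * y = ((-1 : ℤ) ^ (p (i * j)).val) • (y * x))
    ?_ ?_ ?_ ?_ ?_ hx
  · intros; simp
  · intro k i x x' hx hx'
    rw [add_mul, hx, hx', mul_add, smul_add]
  · intro k i r x hx
    rw [mul_smul_comm, smul_mul_assoc, hx, smul_comm]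
  · simp
  · intro k i i' v hv x _ hx
    rw [mul_assoc, hx, mul_smul_comm, ← mul_assoc, ι_mul_comm hv hy, smul_mul_assoc, smul_smul,
      ← neg_one_pow_val_add, ← map_add, mul_assoc, add_mul, add_comm]

theorem commute_of_mem_component_zero (h𝒱 : ⨆ i, 𝒱 i = ⊤) {k : ℕ} {x : Sym p 𝒱}
    (hx : x ∈ component p 𝒱 k 0) (y : Sym p 𝒱) : x * y = y * x := by
  induction y using induction with
  | algebraMap r => exact (Algebra.commutes r x).symm
  | ι v =>
    have hv : v ∈ ⨆ i, 𝒱 i := h𝒱 ▸ Submodule.mem_top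
    induction hv using Submodule.iSup_induction' with
    | mem i v hv => simpa using component_mul_comm hx (ι_mem_component hv)
    | zero => simp
    | add v w _ _ hv hw => rw [map_add, mul_add, hv, hw, add_mul]
  | mul a b ha hb => rw [← mul_assoc, ha, mul_assoc, hb, mul_assoc]
  | add a b ha hb => rw [mul_add, ha, hb, add_mul]

section Map

variable {R' : Type*} [CommRing R'] {V' : Type*} [AddCommGroup V'] [Module R' V']
variable {𝒱' : 𝓘 → Submodule R' V'} {ρ : R →+* R'}

theorem map_mem_component (g : V →ₛₗ[ρ] V') (hg : ∀ i, ∀ v ∈ 𝒱 i, g v ∈ 𝒱' i) {k : ℕ} {i : 𝓘}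
    {x : Sym p 𝒱} (hx : x ∈ component p 𝒱 k i) : map p g hg x ∈ component p 𝒱' k i := by
  refine component_induction (P := fun k i x => map p g hg x ∈ component p 𝒱' k i) ?_ ?_ ?_ ?_ ?_ hx
  · intros
    rw [map_zero]
    exact Submodule.zero_mem _
  · intro k i x y hx hy
    rw [map_add]
    exact Submodule.add_mem _ hx hy
  · intro k i r x hx
    rw [Algebra.smul_def, map_mul, map_algebraMap, ← Algebra.smul_def]
    exact Submodule.smul_mem _ _ hx
  · rw [map_one]
    exact one_mem_component
  · intro k i j v hv x _ hx
    rw [map_mul, map_ι]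
    exact ι_mul_mem_component (hg _ _ hv) hx

theorem map_smul (g : V →ₛₗ[ρ] V') (hg : ∀ i, ∀ v ∈ 𝒱 i, g v ∈ 𝒱' i) (r : R) (x : Sym p 𝒱) :
    map p g hg (r • x) = ρ r • map p g hg x := by
  rw [Algebra.smul_def, map_mul, map_algebraMap, ← Algebra.smul_def]

end Map

end Sym

/-! ### Formal power series on a graded module -/

namespace FormalSym

variable {p 𝒱}

/-- The component of a formal power series in `Sᵏ(V)`. -/
noncomputable def coeff (k : ℕ) : FormalSym p 𝒱 →ₗ[R] Sym p 𝒱 :=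
  ((PowerSeries.coeff (R := Sym p 𝒱) k).restrictScalars R) ∘ₗ (FormalSym p 𝒱).val.toLinearMap

theorem coeff_mem_power (k : ℕ) (f : FormalSym p 𝒱) : coeff k f ∈ Sym.power p 𝒱 k := f.2 k

@[ext]
theorem ext {f g : FormalSym p 𝒱} (h : ∀ k, coeff k f = coeff k g) : f = g :=
  Subtype.ext (PowerSeries.ext h)

theorem coeff_mul (k : ℕ) (f g : FormalSym p 𝒱) :
    coeff k (f * g) = ∑ ij ∈ Finset.HasAntidiagonal.antidiagonal k, coeff ij.1 f * coeff ij.2 g :=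
  PowerSeries.coeff_mul _ _ _

theorem coeff_algebraMap (k : ℕ) (r : R) :
    coeff k (algebraMap R (FormalSym p 𝒱) r) = if k = 0 then algebraMap R _ r else 0 := by
  change PowerSeries.coeff k (algebraMap R (PowerSeries (Sym p 𝒱)) r) = _
  rw [PowerSeries.algebraMap_apply, PowerSeries.coeff_C]

/-- The formal power series with given components. -/
def mk (c : ℕ → Sym p 𝒱) (hc : ∀ k, c k ∈ Sym.power p 𝒱 k) : FormalSym p 𝒱 :=
  ⟨PowerSeries.mk c, fun k => by rw [PowerSeries.coeff_mk]; exact hc k⟩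

@[simp]
theorem coeff_mk (c : ℕ → Sym p 𝒱) (hc : ∀ k, c k ∈ Sym.power p 𝒱 k) (k : ℕ) :
    coeff k (mk c hc) = c k :=
  PowerSeries.coeff_mk _ _

theorem mem_deg {f : FormalSym p 𝒱} {i : 𝓘} :
    f ∈ deg p 𝒱 i ↔ ∀ k, coeff k f ∈ Sym.component p 𝒱 k i := Iff.rfl

theorem ite_mem_power (k : ℕ) (x : Sym.power p 𝒱 k) (l : ℕ) :
    (if l = k then (x : Sym p 𝒱) else 0) ∈ Sym.power p 𝒱 l := by
  split_ifs with h
  · rw [h]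
    exact x.2
  · exact Submodule.zero_mem _

variable (p 𝒱) in
/-- An element of `Sᵏ(V)` as a formal power series. -/
noncomputable def single (k : ℕ) : Sym.power p 𝒱 k →ₗ[R] FormalSym p 𝒱 where
  toFun x := mk (fun l => if l = k then x else 0) (ite_mem_power k x)
  map_add' x y := by
    ext l
    rw [map_add, coeff_mk, coeff_mk, coeff_mk]
    split_ifs <;> simp
  map_smul' r x := by
    ext l
    rw [map_smul, coeff_mk, coeff_mk]
    split_ifs <;> simp

theorem coeff_single (k l : ℕ) (x : Sym.power p 𝒱 k) :
    coeff l (single p 𝒱 k x) = if l = k then (x : Sym p 𝒱) else 0 :=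
  coeff_mk _ (ite_mem_power k x) l

variable (p 𝒱) in
/-- The canonical map from `V` to formal power series. -/
noncomputable def ι : V →ₗ[R] FormalSym p 𝒱 :=
  single p 𝒱 1 ∘ₗ (Sym.ι p 𝒱).codRestrict _ Sym.ι_mem_power

theorem coeff_ι (l : ℕ) (v : V) : coeff l (ι p 𝒱 v) = if l = 1 then Sym.ι p 𝒱 v else 0 :=
  coeff_single _ _ _

theorem ι_mem_deg {i : 𝓘} {v : V} (hv : v ∈ 𝒱 i) : ι p 𝒱 v ∈ deg p 𝒱 i := by
  refine mem_deg.2 fun k => ?_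
  rw [coeff_ι]
  split_ifs with h
  · subst h
    exact Sym.ι_mem_component hv
  · exact Submodule.zero_mem _

theorem algebraMap_mem_deg (r : R) : algebraMap R _ r ∈ deg p 𝒱 0 := by
  refine mem_deg.2 fun k => ?_
  rw [coeff_algebraMap]
  split_ifs with h
  · subst h
    rw [Algebra.algebraMap_eq_smul_one]
    exact Submodule.smul_mem _ _ Sym.one_mem_component
  · exact Submodule.zero_mem _

theorem mul_mem_deg {i j : 𝓘} {f g : FormalSym p 𝒱} (hf : f ∈ deg p 𝒱 i) (hg : g ∈ deg p 𝒱 j) :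
    f * g ∈ deg p 𝒱 (i + j) := by
  refine mem_deg.2 fun k => ?_
  rw [coeff_mul]
  refine Submodule.sum_mem _ fun ab hab => ?_
  rw [← Finset.HasAntidiagonal.mem_antidiagonal.1 hab]
  exact Sym.mul_mem_component (hf _) (hg _)

theorem deg_mul_comm {i j : 𝓘} {f g : FormalSym p 𝒱} (hf : f ∈ deg p 𝒱 i)
    (hg : g ∈ deg p 𝒱 j) : f * g = ((-1 : ℤ) ^ (p (i * j)).val) • (g * f) := by
  ext k
  rw [map_zsmul, coeff_mul, coeff_mul, Finset.smul_sum, ← Finset.Nat.sum_antidiagonal_swap]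
  exact Finset.sum_congr rfl fun ab _ => Sym.component_mul_comm (hf _) (hg _)

theorem commute_of_mem_deg_zero (h𝒱 : ⨆ i, 𝒱 i = ⊤) {f : FormalSym p 𝒱} (hf : f ∈ deg p 𝒱 0)
    (g : FormalSym p 𝒱) : f * g = g * f := by
  ext k
  rw [coeff_mul, coeff_mul, ← Finset.Nat.sum_antidiagonal_swap]
  exact Finset.sum_congr rfl fun ab _ => Sym.commute_of_mem_component_zero h𝒱 (hf _) _

variable (p 𝒱) in
/-- The formal power series whose components of index less than `j` vanish. -/
noncomputable def fil (j : ℕ) : Submodule R (FormalSym p 𝒱) where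
  carrier := {f | ∀ k < j, coeff k f = 0}
  add_mem' hf hg k hk := by rw [map_add, hf k hk, hg k hk, add_zero]
  zero_mem' k _ := map_zero _
  smul_mem' r f hf k hk := by rw [map_smul, hf k hk, smul_zero]

theorem fil_anti {i j : ℕ} (h : i ≤ j) : fil p 𝒱 j ≤ fil p 𝒱 i :=
  fun _ hf k hk => hf k (hk.trans_le h)

theorem mem_fil_succ {j : ℕ} {f : FormalSym p 𝒱} :
    f ∈ fil p 𝒱 (j + 1) ↔ f ∈ fil p 𝒱 j ∧ coeff j f = 0 := by
  refine ⟨fun h => ⟨fil_anti (Nat.le_succ j) h, h j (Nat.lt_succ_self j)⟩, fun h k hk => ?_⟩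
  rcases Nat.lt_succ_iff_lt_or_eq.1 hk with hk | rfl
  · exact h.1 k hk
  · exact h.2

theorem mem_fil_zero (f : FormalSym p 𝒱) : f ∈ fil p 𝒱 0 := fun k hk => absurd hk k.not_lt_zero

theorem eq_zero_of_mem_fil {f : FormalSym p 𝒱} (h : ∀ j, f ∈ fil p 𝒱 j) : f = 0 := by
  ext k
  rw [map_zero]
  exact h (k + 1) k (Nat.lt_succ_self k)

theorem mul_mem_fil {i j : ℕ} {f g : FormalSym p 𝒱} (hf : f ∈ fil p 𝒱 i)
    (hg : g ∈ fil p 𝒱 j) : f * g ∈ fil p 𝒱 (i + j) := by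
  intro k hk
  rw [coeff_mul]
  refine Finset.sum_eq_zero fun ab hab => ?_
  rw [Finset.HasAntidiagonal.mem_antidiagonal] at hab
  by_cases ha : ab.1 < i
  · rw [hf _ ha, zero_mul]
  · rw [hg _ (by omega), mul_zero]

theorem ι_mem_fil (v : V) : ι p 𝒱 v ∈ fil p 𝒱 1 := by
  intro k hk
  rw [coeff_ι, if_neg (by omega)]

variable (p 𝒱) in
/-- The constant term of a formal power series. -/
noncomputable def body : FormalSym p 𝒱 →ₐ[R] R :=
  AlgHom.ofLinearMap ((Sym.aug p 𝒱).toLinearMap ∘ₗ coeff 0)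
    (by
      change Sym.aug p 𝒱 (coeff 0 (1 : FormalSym p 𝒱)) = 1
      have h := coeff_algebraMap (p := p) (𝒱 := 𝒱) 0 1
      rw [map_one (algebraMap R (FormalSym p 𝒱)), if_pos rfl, map_one (algebraMap R _)] at h
      rw [h, map_one])
    (fun f g => by
      change Sym.aug p 𝒱 (coeff 0 (f * g)) = Sym.aug p 𝒱 (coeff 0 f) * Sym.aug p 𝒱 (coeff 0 g)
      rw [coeff_mul, Finset.Nat.antidiagonal_zero, Finset.sum_singleton, map_mul])

theorem body_apply (f : FormalSym p 𝒱) : body p 𝒱 f = Sym.aug p 𝒱 (coeff 0 f) := rfl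

theorem coeff_zero (f : FormalSym p 𝒱) : coeff 0 f = algebraMap R _ (body p 𝒱 f) :=
  Sym.mem_power_zero (coeff_mem_power 0 f)

theorem mem_fil_one {f : FormalSym p 𝒱} : f ∈ fil p 𝒱 1 ↔ body p 𝒱 f = 0 := by
  rw [mem_fil_succ, coeff_zero]
  refine ⟨fun h => ?_, fun h => ⟨mem_fil_zero f, by rw [h, map_zero]⟩⟩
  rw [body_apply, coeff_zero, h.2, map_zero]

theorem body_eq_zero_of_mem_deg {i : 𝓘} (hi : i ≠ 0) {f : FormalSym p 𝒱} (hf : f ∈ deg p 𝒱 i) :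
    body p 𝒱 f = 0 := by
  rw [body_apply, Sym.component_zero_eq_zero hi (mem_deg.1 hf 0), map_zero]

theorem body_ι (v : V) : body p 𝒱 (ι p 𝒱 v) = 0 := mem_fil_one.1 (ι_mem_fil v)

/-- The linear part of a formal power series. -/
noncomputable def lin : FormalSym p 𝒱 →ₗ[R] V := Sym.lin p 𝒱 ∘ₗ coeff 1

theorem coeff_one (f : FormalSym p 𝒱) : coeff 1 f = Sym.ι p 𝒱 (lin f) :=
  Sym.mem_power_one (coeff_mem_power 1 f)

@[simp]
theorem lin_ι (v : V) : lin (ι p 𝒱 v) = v := by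
  change Sym.lin p 𝒱 (coeff 1 _) = v
  rw [coeff_ι, if_pos rfl, Sym.lin_ι]

theorem lin_eq_zero_of_mem_fil {f : FormalSym p 𝒱} (hf : f ∈ fil p 𝒱 2) : lin f = 0 := by
  change Sym.lin p 𝒱 (coeff 1 f) = 0
  rw [hf 1 (by norm_num), map_zero]

theorem mem_fil_two {f : FormalSym p 𝒱} (hf : f ∈ fil p 𝒱 1) (h : lin f = 0) :
    f ∈ fil p 𝒱 2 := by
  refine mem_fil_succ.2 ⟨hf, ?_⟩
  rw [coeff_one, h, map_zero]

theorem lin_algebraMap_mul (r : R) (f : FormalSym p 𝒱) :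
    lin (algebraMap R _ r * f) = r • lin f := by
  rw [← Algebra.smul_def, map_smul]

section Map

variable {R' : Type*} [CommRing R'] {V' : Type*} [AddCommGroup V'] [Module R' V']
variable {𝒱' : 𝓘 → Submodule R' V'} {ρ : R →+* R'}
variable (g : V →ₛₗ[ρ] V') (hg : ∀ i, ∀ v ∈ 𝒱 i, g v ∈ 𝒱' i)

theorem coeff_map' (k : ℕ) (f : FormalSym p 𝒱) :
    coeff k (map p g hg f) = Sym.map p g hg (coeff k f) :=
  FormalSym.coeff_map p g hg f k

theorem map_ι (v : V) : map p g hg (ι p 𝒱 v) = ι p 𝒱' (g v) := by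
  ext k
  rw [coeff_map', coeff_ι, coeff_ι]
  split_ifs
  · exact Sym.map_ι p g hg v
  · exact map_zero _

theorem map_mem_fil {j : ℕ} {f : FormalSym p 𝒱} (hf : f ∈ fil p 𝒱 j) :
    map p g hg f ∈ fil p 𝒱' j := by
  intro k hk
  rw [coeff_map', hf k hk, map_zero]

theorem map_mem_deg {i : 𝓘} {f : FormalSym p 𝒱} (hf : f ∈ deg p 𝒱 i) :
    map p g hg f ∈ deg p 𝒱' i := by
  refine mem_deg.2 fun k => ?_
  rw [coeff_map']
  exact Sym.map_mem_component g hg (hf k)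

theorem lin_map (f : FormalSym p 𝒱) : lin (map p g hg f) = g (lin f) := by
  change Sym.lin p 𝒱' (coeff 1 _) = _
  rw [coeff_map', coeff_one, Sym.map_ι, Sym.lin_ι]

end Map

end FormalSym

end Algebra

section Algebra

variable {𝓘 : Type*} [NonUnitalCommSemiring 𝓘] {p : 𝓘 →+ ZMod 2}
variable {R : Type*} [CommRing R] {V : Type*} [AddCommGroup V] [Module R V]
variable {𝒱 : 𝓘 → Submodule R V}

namespace Sym

/-- Each element of `Sᵏ⁺¹(V)` is a combination of the elements of a basis of `V`, with coefficients
in `Sᵏ(V)` which can be chosen to depend linearly on it. -/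
theorem exists_division {ι' : Type*} [Fintype ι'] (b : Module.Basis ι' R V) (k : ℕ)
    [Module.Projective R (power p 𝒱 (k + 1))] :
    ∃ q : ι' → power p 𝒱 (k + 1) →ₗ[R] power p 𝒱 k,
      ∀ x : power p 𝒱 (k + 1), (x : Sym p 𝒱) = ∑ a, ι p 𝒱 (b a) * (q a x : Sym p 𝒱) := by
  let Λ' : (ι' → power p 𝒱 k) →ₗ[R] Sym p 𝒱 :=
    ∑ a, LinearMap.mulLeft R (ι p 𝒱 (b a)) ∘ₗ (power p 𝒱 k).subtype ∘ₗ LinearMap.proj a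
  have hΛ' : ∀ g, Λ' g = ∑ a, ι p 𝒱 (b a) * (g a : Sym p 𝒱) := fun g => by
    simp only [Λ', LinearMap.sum_apply]
    rfl
  let Λ : (ι' → power p 𝒱 k) →ₗ[R] power p 𝒱 (k + 1) := Λ'.codRestrict _ fun g => by
    rw [hΛ']
    refine Submodule.sum_mem _ fun a _ => ?_
    rw [add_comm]
    exact mul_mem_power (ι_mem_power _) (g a).2
  have hΛ : Function.Surjective Λ := by
    rintro ⟨x, hx⟩
    suffices h : ∃ g, Λ' g = x by
      obtain ⟨g, hg⟩ := h
      exact ⟨g, Subtype.ext hg⟩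
    rw [power, pow_succ'] at hx
    refine Submodule.mul_induction_on hx ?_ ?_
    · rintro _ ⟨v, rfl⟩ y hy
      refine ⟨fun a => b.repr v a • ⟨y, hy⟩, ?_⟩
      rw [hΛ']
      conv_rhs => rw [← b.sum_repr v, map_sum, Finset.sum_mul]
      refine Finset.sum_congr rfl fun a _ => ?_
      rw [_root_.map_smul, smul_mul_assoc]
      exact mul_smul_comm _ _ _
    · rintro x y ⟨g, rfl⟩ ⟨g', rfl⟩
      exact ⟨g + g', map_add Λ' g g'⟩
  obtain ⟨q, hq⟩ := Module.projective_lifting_property Λ LinearMap.id hΛ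
  refine ⟨fun a => LinearMap.proj a ∘ₗ q, fun x => ?_⟩
  have h := congrArg Subtype.val (LinearMap.congr_fun hq x)
  exact h.symm.trans (hΛ' _)

end Sym

namespace FormalSym

theorem coeff_zero_ι_mul (v : V) (f : FormalSym p 𝒱) : coeff 0 (ι p 𝒱 v * f) = 0 := by
  rw [coeff_mul, Finset.Nat.antidiagonal_zero, Finset.sum_singleton, coeff_ι, if_neg (by omega),
    zero_mul]

theorem coeff_succ_ι_mul (v : V) (f : FormalSym p 𝒱) (k : ℕ) :
    coeff (k + 1) (ι p 𝒱 v * f) = Sym.ι p 𝒱 v * coeff k f := by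
  rw [coeff_mul, Finset.sum_eq_single (1, k), coeff_ι, if_pos rfl]
  · rintro ⟨a, b⟩ hab hne
    rw [Finset.HasAntidiagonal.mem_antidiagonal] at hab
    dsimp only at hab ⊢
    rw [coeff_ι, if_neg, zero_mul]
    rintro rfl
    exact hne (Prod.ext rfl (by dsimp only; omega))
  · intro h
    refine absurd (Finset.HasAntidiagonal.mem_antidiagonal.2 ?_) h
    exact add_comm 1 k

variable (p 𝒱) in
theorem exists_toFormal : ∃ F : Sym p 𝒱 →ₐ[R] FormalSym p 𝒱, ∀ v, F (Sym.ι p 𝒱 v) = ι p 𝒱 v :=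
  Sym.exists_lift (ι p 𝒱) fun _ _ _ hv _ hw => deg_mul_comm (ι_mem_deg hv) (ι_mem_deg hw)

variable (p 𝒱) in
/-- The inclusion of the symmetric algebra in the algebra of formal power series. -/
noncomputable def ofSym : Sym p 𝒱 →ₐ[R] FormalSym p 𝒱 := (exists_toFormal p 𝒱).choose

@[simp]
theorem ofSym_ι (v : V) : ofSym p 𝒱 (Sym.ι p 𝒱 v) = ι p 𝒱 v := (exists_toFormal p 𝒱).choose_spec v

theorem coeff_ofSym {k : ℕ} {x : Sym p 𝒱} (hx : x ∈ Sym.power p 𝒱 k) (l : ℕ) :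
    coeff l (ofSym p 𝒱 x) = if l = k then x else 0 := by
  rw [Sym.power] at hx
  induction hx using Submodule.pow_induction_on_left' generalizing l with
  | algebraMap r => rw [AlgHom.commutes, coeff_algebraMap]
  | add x y i _ _ hx hy =>
    rw [map_add, map_add, hx, hy]
    split_ifs <;> simp
  | mem_mul w hw i x _ hx =>
    obtain ⟨v, rfl⟩ := hw
    rw [map_mul, ofSym_ι]
    cases l with
    | zero => rw [coeff_zero_ι_mul, if_neg (by omega)]
    | succ l =>
      rw [coeff_succ_ι_mul, hx]
      by_cases h : l = i
      · rw [if_pos h, if_pos (by omega)]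
      · rw [if_neg h, if_neg (by omega), mul_zero]

theorem ofSym_mem_fil {k : ℕ} {x : Sym p 𝒱} (hx : x ∈ Sym.power p 𝒱 k) :
    ofSym p 𝒱 x ∈ fil p 𝒱 k := by
  intro l hl
  rw [coeff_ofSym hx, if_neg hl.ne]

variable (p 𝒱) in
/-- The Euler operator, which multiplies the component in `Sᵏ(V)` by `k`. -/
noncomputable def euler : FormalSym p 𝒱 →ₗ[R] FormalSym p 𝒱 where
  toFun f := mk (fun k => (k : R) • coeff k f)
    fun k => Submodule.smul_mem _ _ (coeff_mem_power k f)
  map_add' f g := by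
    ext k
    rw [map_add, coeff_mk, coeff_mk, coeff_mk, map_add, smul_add]
  map_smul' r f := by
    ext k
    rw [map_smul, coeff_mk, coeff_mk, map_smul, RingHom.id_apply, smul_comm]

theorem coeff_euler (k : ℕ) (f : FormalSym p 𝒱) : coeff k (euler p 𝒱 f) = (k : R) • coeff k f :=
  coeff_mk _ (fun k => Submodule.smul_mem _ _ (coeff_mem_power k f)) k

theorem euler_mul (f g : FormalSym p 𝒱) :
    euler p 𝒱 (f * g) = euler p 𝒱 f * g + f * euler p 𝒱 g := by
  ext k
  rw [coeff_euler, map_add, coeff_mul, coeff_mul, coeff_mul, Finset.smul_sum,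
    ← Finset.sum_add_distrib]
  refine Finset.sum_congr rfl fun ab hab => ?_
  rw [coeff_euler, coeff_euler, smul_mul_assoc, mul_smul_comm, ← add_smul, ← Nat.cast_add,
    Finset.HasAntidiagonal.mem_antidiagonal.1 hab]

theorem euler_algebraMap (r : R) : euler p 𝒱 (algebraMap R _ r) = 0 := by
  ext k
  rw [coeff_euler, coeff_algebraMap]
  split_ifs with h
  · subst h
    simp
  · simp

theorem euler_mem_deg {i : 𝓘} {f : FormalSym p 𝒱} (hf : f ∈ deg p 𝒱 i) :
    euler p 𝒱 f ∈ deg p 𝒱 i := by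
  refine mem_deg.2 fun k => ?_
  rw [coeff_euler]
  exact Submodule.smul_mem _ _ (hf k)

theorem euler_sub_mem_fil {j : ℕ} {f : FormalSym p 𝒱} (hf : f ∈ fil p 𝒱 j) :
    euler p 𝒱 f - (j : R) • f ∈ fil p 𝒱 (j + 1) := by
  intro k hk
  rw [map_sub, coeff_euler, map_smul]
  rcases Nat.lt_succ_iff_lt_or_eq.1 hk with hk | rfl
  · rw [hf k hk, smul_zero, smul_zero, sub_zero]
  · exact sub_self _

end FormalSym

end Algebra

/-! ### Weakly smooth functions -/

section Smooth

variable {n : ℕ} {N : Type*} [TopologicalSpace N] [ChartedSpace (EuclideanSpace ℝ (Fin n)) N]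
variable {A : Type*} [AddCommGroup A] [Module ℝ A] {B : Type*} [AddCommGroup B] [Module ℝ B]

variable (n) in
/-- A function with values in a real vector space is weakly smooth at a point if its composition
with each linear functional is smooth there. -/
def WeaklySmoothAt (g : N → A) (x : N) : Prop :=
  ∀ l : Module.Dual ℝ A, ContMDiffAt (𝓡 n) 𝓘(ℝ) ∞ (fun y => l (g y)) x

namespace WeaklySmoothAt

variable {g h : N → A} {x : N}

theorem const (a : A) (x : N) : WeaklySmoothAt n (fun _ : N => a) x := fun _ => contMDiffAt_const

theorem add (hg : WeaklySmoothAt n g x) (hh : WeaklySmoothAt n h x) :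
    WeaklySmoothAt n (fun y => g y + h y) x := by
  intro l
  simp only [map_add]
  exact (hg l).add (hh l)

theorem smul {c : N → ℝ} (hc : ContMDiffAt (𝓡 n) 𝓘(ℝ) ∞ c x) (hg : WeaklySmoothAt n g x) :
    WeaklySmoothAt n (fun y => c y • g y) x := by
  intro l
  simp only [map_smul, smul_eq_mul]
  exact hc.mul (hg l)

theorem sum {ι : Type*} {s : Finset ι} {g : ι → N → A} (hg : ∀ i ∈ s, WeaklySmoothAt n (g i) x) :
    WeaklySmoothAt n (fun y => ∑ i ∈ s, g i y) x := by
  intro l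
  simp only [map_sum]
  exact ContMDiffAt.sum fun i hi => hg i hi l

theorem comp_linear (hg : WeaklySmoothAt n g x) (L : A →ₗ[ℝ] B) :
    WeaklySmoothAt n (fun y => L (g y)) x :=
  fun l => hg (l ∘ₗ L)

theorem comp_linear_on {S : Submodule ℝ A} (hS : ∀ y, g y ∈ S) (hg : WeaklySmoothAt n g x)
    (L : S →ₗ[ℝ] B) : WeaklySmoothAt n (fun y => L ⟨g y, hS y⟩) x := by
  obtain ⟨L', hL'⟩ := LinearMap.exists_extend L
  have h : (fun y => L ⟨g y, hS y⟩) = fun y => L' (g y) := by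
    funext y
    rw [← hL']
    rfl
  rw [h]
  exact hg.comp_linear L'

/-- A weakly smooth function with values in a finite dimensional subspace is a combination of
constants with smooth coefficients. -/
theorem exists_eq_sum {S : Submodule ℝ A} [FiniteDimensional ℝ S] (hS : ∀ y, g y ∈ S)
    (hg : ∀ x, WeaklySmoothAt n g x) :
    ∃ (r : ℕ) (s : Fin r → A) (c : Fin r → C^∞⟮𝓡 n, N; 𝓘(ℝ), ℝ⟯),
      (∀ j, s j ∈ S) ∧ ∀ y, g y = ∑ j, c j y • s j := by
  let b := Module.finBasis ℝ S
  refine ⟨_, fun j => b j, fun j => ⟨fun y => b.coord j ⟨g y, hS y⟩, fun x => ?_⟩,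
    fun j => (b j).2, fun y => ?_⟩
  · exact (hg x).comp_linear_on hS (b.coord j) LinearMap.id
  · have h := congrArg S.subtype (b.sum_repr ⟨g y, hS y⟩)
    rw [map_sum] at h
    exact h.symm

end WeaklySmoothAt

variable {𝓘 : Type*} [NonUnitalCommSemiring 𝓘] {p : 𝓘 →+ ZMod 2}
variable {V : Type*} [AddCommGroup V] [Module ℝ V] {𝒱 : 𝓘 → Submodule ℝ V}

theorem smoothAt_iff {f : N → FormalSym p 𝒱} {x : N} :
    SmoothAt n f x ↔ ∀ k, WeaklySmoothAt n (fun y => FormalSym.coeff k (f y)) x := Iff.rfl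

theorem SmoothAt.algebraMap {c : N → ℝ} {x : N} (hc : ContMDiffAt (𝓡 n) 𝓘(ℝ) ∞ c x) :
    SmoothAt n (fun y => algebraMap ℝ (FormalSym p 𝒱) (c y)) x := by
  refine smoothAt_iff.2 fun k => ?_
  simp only [FormalSym.coeff_algebraMap]
  split_ifs
  · simp only [Algebra.algebraMap_eq_smul_one]
    exact WeaklySmoothAt.smul hc (WeaklySmoothAt.const _ _)
  · exact WeaklySmoothAt.const _ _

theorem SmoothAt.body {f : N → FormalSym p 𝒱} {x : N} (hf : SmoothAt n f x) :
    ContMDiffAt (𝓡 n) 𝓘(ℝ) ∞ (fun y => FormalSym.body p 𝒱 (f y)) x :=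
  hf 0 (Sym.aug p 𝒱).toLinearMap

theorem SmoothAt.lin {f : N → FormalSym p 𝒱} {x : N} (hf : SmoothAt n f x) :
    WeaklySmoothAt n (fun y => FormalSym.lin (f y)) x :=
  (smoothAt_iff.1 hf 1).comp_linear (Sym.lin p 𝒱)

end Smooth

/-! ### The model space -/

section Model

variable {𝓘 : Type*} (m : 𝓘 →₀ ℕ)

theorem iSup_modelGrading : ⨆ k, modelGrading m k = ⊤ := by
  classical
  refine eq_top_iff.2 fun v _ => ?_
  induction v using DirectSum.induction_on with
  | zero => exact Submodule.zero_mem _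
  | add v w hv hw => exact Submodule.add_mem _ (hv trivial) (hw trivial)
  | of k f => exact Submodule.mem_iSup_of_mem k ⟨f, rfl⟩

theorem modelGrading_eq_bot {k : 𝓘} (h : m k = 0) : modelGrading m k = ⊥ := by
  classical
  refine eq_bot_iff.2 ?_
  rintro _ ⟨f, rfl⟩
  have hf : f = 0 := by
    funext a
    exact (Fin.cast h a).elim0
  rw [hf, map_zero]
  exact Submodule.zero_mem _

end Model

/-! ### The algebra of smooth functions with values in formal power series -/

section Sections

variable {𝓘 : Type*} [NonUnitalCommSemiring 𝓘] (p : 𝓘 →+ ZMod 2)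
variable {V : Type*} [AddCommGroup V] [Module ℝ V] [FiniteDimensional ℝ V]
variable (𝒱 : 𝓘 → Submodule ℝ V) (n : ℕ)
variable (N : Type*) [TopologicalSpace N] [ChartedSpace (EuclideanSpace ℝ (Fin n)) N]

/-- The smooth functions on `N` with values in `∏ₖ Sᵏ(V)`, as a subalgebra of all functions. -/
noncomputable def smoothSubalgebra : Subalgebra ℝ (N → FormalSym p 𝒱) where
  carrier := {f | ∀ x, SmoothAt n f x}
  mul_mem' hf hg x := (hf x).mul (hg x)
  add_mem' hf hg x := (hf x).add (hg x)
  algebraMap_mem' r x := SmoothAt.const (n := n) (algebraMap ℝ _ r) x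

/-- The algebra of smooth functions on `N` with values in `∏ₖ Sᵏ(V)`. It is a structure of its own,
with the ring structure of `smoothSubalgebra`, so that the elaborator does not unfold it to a type
of functions. -/
structure SmoothSec where
  /-- the underlying function -/
  toFun : N → FormalSym p 𝒱
  smooth : ∀ x, SmoothAt n toFun x

/-- The two descriptions of smooth functions with values in `∏ₖ Sᵏ(V)` agree. -/
def SmoothSec.equivSubalgebra : SmoothSec p 𝒱 n N ≃ smoothSubalgebra p 𝒱 n N where
  toFun f := ⟨f.1, f.2⟩
  invFun f := ⟨f.1, f.2⟩

noncomputable instance : Ring (SmoothSec p 𝒱 n N) := (SmoothSec.equivSubalgebra p 𝒱 n N).ring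

noncomputable instance : Algebra ℝ (SmoothSec p 𝒱 n N) :=
  (SmoothSec.equivSubalgebra p 𝒱 n N).algebra ℝ

namespace SmoothSec

variable {p 𝒱 n N}

theorem coeff_smooth (f : SmoothSec p 𝒱 n N) (k : ℕ) (x : N) :
    WeaklySmoothAt n (fun y => FormalSym.coeff k (f.1 y)) x :=
  smoothAt_iff.1 (f.2 x) k

theorem ext {f g : SmoothSec p 𝒱 n N} (h : ∀ y, f.1 y = g.1 y) : f = g := by
  cases f
  cases g
  congr
  exact funext h

@[simp] theorem add_apply (f g : SmoothSec p 𝒱 n N) (y : N) : (f + g).1 y = f.1 y + g.1 y := rfl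
@[simp] theorem sub_apply (f g : SmoothSec p 𝒱 n N) (y : N) : (f - g).1 y = f.1 y - g.1 y := rfl
@[simp] theorem mul_apply (f g : SmoothSec p 𝒱 n N) (y : N) : (f * g).1 y = f.1 y * g.1 y := rfl
@[simp] theorem zero_apply (y : N) : (0 : SmoothSec p 𝒱 n N).1 y = 0 := rfl

@[simp] theorem sum_apply {ι : Type*} (s : Finset ι) (f : ι → SmoothSec p 𝒱 n N) (y : N) :
    (∑ i ∈ s, f i).1 y = ∑ i ∈ s, (f i).1 y := by
  classical
  induction s using Finset.induction_on with
  | empty => rfl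
  | insert a s ha ih => rw [Finset.sum_insert ha, Finset.sum_insert ha, add_apply, ih]

variable (p 𝒱) in
/-- A smooth real function as a function with values in formal power series. -/
noncomputable def ofFun : C^∞⟮𝓡 n, N; 𝓘(ℝ), ℝ⟯ →ₐ[ℝ] SmoothSec p 𝒱 n N where
  toFun c := ⟨fun y => algebraMap ℝ _ (c y), fun x => SmoothAt.algebraMap (c.contMDiff x)⟩
  map_one' := ext fun _ => map_one (algebraMap ℝ (FormalSym p 𝒱))
  map_mul' _ _ := ext fun _ => map_mul (algebraMap ℝ (FormalSym p 𝒱)) _ _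
  map_zero' := ext fun _ => map_zero (algebraMap ℝ (FormalSym p 𝒱))
  map_add' _ _ := ext fun _ => map_add (algebraMap ℝ (FormalSym p 𝒱)) _ _
  commutes' _ := rfl

@[simp]
theorem ofFun_apply (c : C^∞⟮𝓡 n, N; 𝓘(ℝ), ℝ⟯) (y : N) :
    (ofFun p 𝒱 c).1 y = algebraMap ℝ _ (c y) := rfl

variable (n N) in
/-- Constant functions. -/
noncomputable def const : FormalSym p 𝒱 →ₐ[ℝ] SmoothSec p 𝒱 n N where
  toFun a := ⟨fun _ => a, fun x => SmoothAt.const a x⟩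
  map_one' := rfl
  map_mul' _ _ := rfl
  map_zero' := rfl
  map_add' _ _ := rfl
  commutes' _ := rfl

@[simp]
theorem const_apply (a : FormalSym p 𝒱) (y : N) :
    (const n N a).1 y = a := rfl

/-- The constant term of a smooth function with values in formal power series. -/
noncomputable def body : SmoothSec p 𝒱 n N →ₐ[ℝ] C^∞⟮𝓡 n, N; 𝓘(ℝ), ℝ⟯ where
  toFun f := ⟨fun y => FormalSym.body p _ (f.1 y), fun x => (f.2 x).body⟩
  map_one' := ContMDiffMap.ext fun _ => map_one (FormalSym.body p 𝒱)
  map_mul' _ _ := ContMDiffMap.ext fun _ => map_mul (FormalSym.body p 𝒱) _ _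
  map_zero' := ContMDiffMap.ext fun _ => map_zero (FormalSym.body p 𝒱)
  map_add' _ _ := ContMDiffMap.ext fun _ => map_add (FormalSym.body p 𝒱) _ _
  commutes' r := ContMDiffMap.ext fun _ => AlgHom.commutes (FormalSym.body p 𝒱) r

variable (p 𝒱 n N) in
/-- The functions all of whose values are of degree `i`. -/
noncomputable def deg (i : 𝓘) : Submodule ℝ (SmoothSec p 𝒱 n N) where
  carrier := {f | ∀ y, f.1 y ∈ FormalSym.deg p 𝒱 i}
  add_mem' hf hg y := Submodule.add_mem _ (hf y) (hg y)
  zero_mem' _ := Submodule.zero_mem _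
  smul_mem' r _ hf y := Submodule.smul_mem _ r (hf y)

variable (p 𝒱 n N) in
/-- The functions whose components of index less than `j` vanish. -/
noncomputable def fil (j : ℕ) : Submodule ℝ (SmoothSec p 𝒱 n N) where
  carrier := {f | ∀ y, f.1 y ∈ FormalSym.fil p 𝒱 j}
  add_mem' hf hg y := Submodule.add_mem _ (hf y) (hg y)
  zero_mem' _ := Submodule.zero_mem _
  smul_mem' r _ hf y := Submodule.smul_mem _ r (hf y)

theorem mul_mem_fil {i j : ℕ} {f g : SmoothSec p 𝒱 n N} (hf : f ∈ fil p 𝒱 n N i)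
    (hg : g ∈ fil p 𝒱 n N j) : f * g ∈ fil p 𝒱 n N (i + j) :=
  fun y => FormalSym.mul_mem_fil (hf y) (hg y)

theorem fil_anti {i j : ℕ} (h : i ≤ j) : fil p 𝒱 n N j ≤ fil p 𝒱 n N i :=
  fun _ hf y => FormalSym.fil_anti h (hf y)

theorem mem_fil_zero (f : SmoothSec p 𝒱 n N) : f ∈ fil p 𝒱 n N 0 :=
  fun y => FormalSym.mem_fil_zero (f.1 y)

theorem eq_zero_of_mem_fil {f : SmoothSec p 𝒱 n N} (h : ∀ j, f ∈ fil p 𝒱 n N j) : f = 0 :=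
  ext fun y => FormalSym.eq_zero_of_mem_fil fun j => h j y

theorem mem_fil_one {f : SmoothSec p 𝒱 n N} : f ∈ fil p 𝒱 n N 1 ↔ body f = 0 :=
  ⟨fun h => ContMDiffMap.ext fun y => FormalSym.mem_fil_one.1 (h y),
    fun h y => FormalSym.mem_fil_one.2 (DFunLike.congr_fun h y)⟩

theorem mul_mem_deg {i j : 𝓘} {f g : SmoothSec p 𝒱 n N} (hf : f ∈ deg p 𝒱 n N i)
    (hg : g ∈ deg p 𝒱 n N j) : f * g ∈ deg p 𝒱 n N (i + j) :=
  fun y => FormalSym.mul_mem_deg (hf y) (hg y)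

theorem ofFun_mem_deg (c : C^∞⟮𝓡 n, N; 𝓘(ℝ), ℝ⟯) : ofFun p 𝒱 c ∈ deg p 𝒱 n N 0 :=
  fun _ => FormalSym.algebraMap_mem_deg _

theorem commute_of_mem_deg_zero (h𝒱 : ⨆ i, 𝒱 i = ⊤) {f : SmoothSec p 𝒱 n N}
    (hf : f ∈ deg p 𝒱 n N 0)
    (g : SmoothSec p 𝒱 n N) : f * g = g * f :=
  ext fun y => FormalSym.commute_of_mem_deg_zero (h𝒱) (hf y) _

/-- The function with given smooth components. -/
noncomputable def ofCoeff (c : ℕ → N → Sym p 𝒱)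
    (hc : ∀ k y, c k y ∈ Sym.power p 𝒱 k)
    (h : ∀ k x, WeaklySmoothAt n (c k) x) : SmoothSec p 𝒱 n N :=
  ⟨fun y => FormalSym.mk (fun k => c k y) fun k => hc k y, fun x => smoothAt_iff.2 fun k => by
    simp only [FormalSym.coeff_mk]
    exact h k x⟩

@[simp]
theorem coeff_ofCoeff (c : ℕ → N → Sym p 𝒱)
    (hc : ∀ k y, c k y ∈ Sym.power p 𝒱 k)
    (h : ∀ k x, WeaklySmoothAt n (c k) x) (k : ℕ) (y : N) :
    FormalSym.coeff k ((ofCoeff c hc h).1 y) = c k y :=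
  FormalSym.coeff_mk _ (fun k => hc k y) k

/-- A sequence that is Cauchy for the filtration by order converges. -/
theorem exists_limit (f : ℕ → SmoothSec p 𝒱 n N) (hf : ∀ t, f (t + 1) - f t ∈ fil p 𝒱 n N t) :
    ∃ g : SmoothSec p 𝒱 n N, (∀ t, g - f t ∈ fil p 𝒱 n N t) ∧
      ∀ i, (∀ t, f t ∈ deg p 𝒱 n N i) → g ∈ deg p 𝒱 n N i := by
  refine ⟨ofCoeff (fun k y => FormalSym.coeff k ((f (k + 1)).1 y))
    (fun k y => FormalSym.coeff_mem_power _ _) (fun k => coeff_smooth _ k), fun t y k hk => ?_,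
    fun i hi y => FormalSym.mem_deg.2 fun k => ?_⟩
  · rw [sub_apply, map_sub, coeff_ofCoeff, sub_eq_zero]
    obtain ⟨d, rfl⟩ := Nat.exists_eq_add_of_lt hk
    clear hk
    induction d with
    | zero => rfl
    | succ d ih =>
      have h := hf (k + d + 1) y k (by omega)
      rw [sub_apply, map_sub, sub_eq_zero] at h
      rw [ih]
      exact h.symm
  · rw [coeff_ofCoeff]
    exact FormalSym.mem_deg.1 (hi (k + 1) y) k

/-- A linear endomorphism which is the identity modulo higher order is bijective. -/
theorem bijective_of_unipotent (Φ : SmoothSec p 𝒱 n N →ₗ[ℝ] SmoothSec p 𝒱 n N)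
    (hΦ : ∀ j, ∀ f ∈ fil p 𝒱 n N j, Φ f - f ∈ fil p 𝒱 n N (j + 1)) :
    Function.Injective Φ ∧ ∀ g, ∃ f, Φ f = g ∧
      ∀ i, (∀ h ∈ deg p 𝒱 n N i, Φ h ∈ deg p 𝒱 n N i) → g ∈ deg p 𝒱 n N i →
        f ∈ deg p 𝒱 n N i := by
  have hΦ' : ∀ j, ∀ f ∈ fil p 𝒱 n N j, Φ f ∈ fil p 𝒱 n N j := fun j f hf => by
    have h := Submodule.add_mem _ (fil_anti (Nat.le_succ j) (hΦ j f hf)) hf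
    rwa [sub_add_cancel] at h
  refine ⟨(injective_iff_map_eq_zero Φ).2 fun f hf => eq_zero_of_mem_fil fun j => ?_, fun g => ?_⟩
  · induction j with
    | zero => exact mem_fil_zero f
    | succ j ih =>
      have h := hΦ j f ih
      rw [hf, zero_sub] at h
      exact (Submodule.neg_mem_iff _).1 h
  -- successive approximation: the error `g - Φ f` itself is the next correction of `f`
  · let u : ℕ → SmoothSec p 𝒱 n N := fun t => Nat.rec 0 (fun _ f => f + (g - Φ f)) t
    have hu : ∀ t, u (t + 1) = u t + (g - Φ (u t)) := fun t => rfl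
    have h1 : ∀ t, g - Φ (u t) ∈ fil p 𝒱 n N t := by
      intro t
      induction t with
      | zero => exact mem_fil_zero _
      | succ t ih =>
        have h := hΦ t _ ih
        rw [hu, map_add]
        have e : g - (Φ (u t) + Φ (g - Φ (u t))) = -(Φ (g - Φ (u t)) - (g - Φ (u t))) := by abel
        rw [e]
        exact Submodule.neg_mem _ h
    obtain ⟨f, hf, hf'⟩ := exists_limit u fun t => by
      rw [hu, add_sub_cancel_left]
      exact h1 t
    refine ⟨f, ?_, fun i hi hg => hf' i fun t => ?_⟩
    · rw [eq_comm, ← sub_eq_zero]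
      refine eq_zero_of_mem_fil fun t => ?_
      have e : g - Φ f = (g - Φ (u t)) - Φ (f - u t) := by
        rw [map_sub]
        abel
      rw [e]
      exact Submodule.sub_mem _ (h1 t) (hΦ' t _ (hf t))
    · induction t with
      | zero => exact Submodule.zero_mem _
      | succ t ih =>
        rw [hu]
        exact Submodule.add_mem _ ih (Submodule.sub_mem _ hg (hi _ ih))

/-- If `L` acts on the quotients of the filtration by order like the Euler operator, then each
function of order at least `j` is congruent, modulo higher order, to a unique eigenvector of `L`
with eigenvalue `j`. -/
theorem existsUnique_eigenvector (L : SmoothSec p 𝒱 n N →ₗ[ℝ] SmoothSec p 𝒱 n N)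
    (hL : ∀ j, ∀ f ∈ fil p 𝒱 n N j, L f - (j : ℝ) • f ∈ fil p 𝒱 n N (j + 1)) (j : ℕ) :
    (∀ b ∈ fil p 𝒱 n N (j + 1), L b = (j : ℝ) • b → b = 0) ∧
    ∀ a ∈ fil p 𝒱 n N j, ∃ b, b - a ∈ fil p 𝒱 n N (j + 1) ∧ L b = (j : ℝ) • b ∧
      ∀ i, (∀ h ∈ deg p 𝒱 n N i, L h ∈ deg p 𝒱 n N i) → a ∈ deg p 𝒱 n N i →
        b ∈ deg p 𝒱 n N i := by
  have hL' : ∀ j, ∀ f ∈ fil p 𝒱 n N j, L f ∈ fil p 𝒱 n N j := fun j f hf => by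
    have h := Submodule.add_mem _ (fil_anti (Nat.le_succ j) (hL j f hf))
      (Submodule.smul_mem _ (j : ℝ) hf)
    rwa [sub_add_cancel] at h
  refine ⟨fun b hb hb' => eq_zero_of_mem_fil fun k => ?_, fun a ha => ?_⟩
  -- on the part of order `j + 1 + t` of `b`, `L` acts both as `j` and as `j + 1 + t`
  · suffices h : ∀ t, b ∈ fil p 𝒱 n N (j + 1 + t) from fil_anti (by omega) (h k)
    intro t
    induction t with
    | zero => exact hb
    | succ t ih =>
      have h := hL _ _ ih
      rw [hb', ← sub_smul] at h
      refine (Submodule.smul_mem_iff _ ?_).1 h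
      push_cast
      have : (0 : ℝ) ≤ t := Nat.cast_nonneg t
      linarith
  · obtain ⟨r, hr⟩ : ∃ r : SmoothSec p 𝒱 n N → SmoothSec p 𝒱 n N,
        ∀ f, r f = L f - (j : ℝ) • f := ⟨_, fun _ => rfl⟩
    -- `L - j` acts as `t + 1` on the part of order `j + t + 1`, so that subtracting
    -- `(L - j) u / (t + 1)` from `u` removes the part of `(L - j) u` of that order
    obtain ⟨u, hu0, hu⟩ : ∃ u : ℕ → SmoothSec p 𝒱 n N,
        u 0 = a ∧ ∀ t, u (t + 1) = u t - (1 / ((t : ℝ) + 1)) • r (u t) :=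
      ⟨fun t => Nat.rec a (fun t f => f - (1 / ((t : ℝ) + 1)) • r f) t, rfl, fun _ => rfl⟩
    have h1 : ∀ t, r (u t) ∈ fil p 𝒱 n N (j + t + 1) := by
      intro t
      induction t with
      | zero =>
        rw [hu0, hr]
        exact hL j a ha
      | succ t ih =>
        have h := hL _ _ ih
        have h0 : ((t : ℝ) + 1) ≠ 0 := by positivity
        have e : r (u (t + 1)) = -((1 / ((t : ℝ) + 1)) •
            (L (r (u t)) - ((j + t + 1 : ℕ) : ℝ) • r (u t))) := by
          have e1 : L (u t) = r (u t) + (j : ℝ) • u t := by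
            rw [hr, sub_add_cancel]
          rw [hr (u (t + 1)), hu, map_sub, map_smul, e1]
          generalize L (r (u t)) = d
          generalize r (u t) = b
          push_cast
          match_scalars <;> field_simp <;> ring
        rw [e]
        exact Submodule.neg_mem _ (Submodule.smul_mem _ _ h)
    obtain ⟨b, hb, hb'⟩ := exists_limit u fun t => by
      rw [hu, sub_sub_cancel_left]
      exact Submodule.neg_mem _ (Submodule.smul_mem _ _ (fil_anti (by omega) (h1 t)))
    have h2 : ∀ t, u t - a ∈ fil p 𝒱 n N (j + 1) := by
      intro t
      induction t with
      | zero =>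
        rw [hu0, sub_self]
        exact Submodule.zero_mem _
      | succ t ih =>
        rw [hu, sub_right_comm]
        exact Submodule.sub_mem _ ih (Submodule.smul_mem _ _ (fil_anti (by omega) (h1 t)))
    refine ⟨b, ?_, ?_, fun i hi ha' => hb' i fun t => ?_⟩
    · rw [← sub_add_sub_cancel b (u (j + 1)) a]
      exact Submodule.add_mem _ (hb _) (h2 _)
    · rw [← sub_eq_zero]
      refine eq_zero_of_mem_fil fun t => ?_
      have e : L b - (j : ℝ) • b = r (u t) + (L (b - u t) - (j : ℝ) • (b - u t)) := by
        rw [hr, map_sub, smul_sub]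
        abel
      rw [e]
      exact Submodule.add_mem _ (fil_anti (by omega) (h1 t))
        (Submodule.sub_mem _ (hL' _ _ (hb t)) (Submodule.smul_mem _ _ (hb t)))
    · induction t with
      | zero =>
        rw [hu0]
        exact ha'
      | succ t ih =>
        rw [hu]
        rw [hr]
        exact Submodule.sub_mem _ ih (Submodule.smul_mem _ _
          (Submodule.sub_mem _ (hi _ ih) (Submodule.smul_mem _ _ ih)))

/-- A function without terms of order at most `j` is a combination of the coordinates with
coefficients of order at least `j`. -/
theorem exists_eq_sum_coord {j : ℕ} {f : SmoothSec p 𝒱 n N} (hf : f ∈ fil p 𝒱 n N (j + 1)) :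
    ∃ g : Fin (Module.finrank ℝ V) → SmoothSec p 𝒱 n N, (∀ a, g a ∈ fil p 𝒱 n N j) ∧
      f = ∑ a, const n N (FormalSym.ι p _ (Module.finBasis ℝ V a)) * g a := by
  choose q hq using fun k => Sym.exists_division (p := p) (𝒱 := 𝒱) (Module.finBasis ℝ V) k
  let c : ∀ (k : ℕ) (y : N), Sym.power p 𝒱 (k + 1) :=
    fun k y => ⟨FormalSym.coeff (k + 1) (f.1 y), FormalSym.coeff_mem_power (k + 1) (f.1 y)⟩
  have hc : ∀ a k x, WeaklySmoothAt n (fun y => (q k a (c k y) : Sym p 𝒱)) x := fun a k x =>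
    (coeff_smooth f (k + 1) x).comp_linear_on
      (fun y => FormalSym.coeff_mem_power (k + 1) (f.1 y)) (Submodule.subtype _ ∘ₗ q k a)
  let g : Fin (Module.finrank ℝ V) → SmoothSec p 𝒱 n N := fun a =>
    ofCoeff (fun k y => (q k a (c k y) : Sym p 𝒱)) (fun k y => (q k a (c k y)).2) (hc a)
  have hg : ∀ a k y, FormalSym.coeff k ((g a).1 y) = (q k a (c k y) : Sym p 𝒱) :=
    fun a k y => coeff_ofCoeff _ _ _ k y
  refine ⟨g, fun a y k hk => ?_, ?_⟩
  · rw [hg]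
    have e : c k y = 0 := Subtype.ext (hf y (k + 1) (by omega))
    rw [e, map_zero]
    rfl
  · refine ext fun y => FormalSym.ext fun k => ?_
    rw [sum_apply, map_sum]
    simp only [mul_apply, const_apply]
    cases k with
    | zero =>
      simp only [FormalSym.coeff_zero_ι_mul, Finset.sum_const_zero]
      exact hf y 0 (by omega)
    | succ k =>
      simp only [FormalSym.coeff_succ_ι_mul, hg]
      exact hq k (c k y)

/-- A homomorphism that maps the coordinates to functions without constant term respects the
filtration by order. -/
theorem map_mem_fil {R : Type*} [CommRing R] {W : Type*} [AddCommGroup W] [Module R W]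
    {𝒲 : 𝓘 → Submodule R W} (Φ : SmoothSec p 𝒱 n N →+* FormalSym p 𝒲)
    (h : ∀ v, Φ (const n N (FormalSym.ι p _ v)) ∈ FormalSym.fil p 𝒲 1) {j : ℕ}
    {f : SmoothSec p 𝒱 n N} (hf : f ∈ fil p 𝒱 n N j) : Φ f ∈ FormalSym.fil p 𝒲 j := by
  induction j generalizing f with
  | zero => exact FormalSym.mem_fil_zero _
  | succ j ih =>
    obtain ⟨g, hg, rfl⟩ := exists_eq_sum_coord hf
    rw [map_sum]
    refine Submodule.sum_mem _ fun a _ => ?_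
    rw [map_mul, add_comm]
    exact FormalSym.mul_mem_fil (h _) (ih (hg a))

/-- Modulo higher order, each function is a sum of products of smooth real functions and
constants. -/
theorem exists_sub_mem_fil (D : ℕ → Submodule ℝ (Sym p 𝒱))
    (hD : ∀ k, D k ≤ Sym.power p 𝒱 k) (f : SmoothSec p 𝒱 n N)
    (hf : ∀ k y, FormalSym.coeff k (f.1 y) ∈ D k) (K : ℕ) :
    ∃ q ∈ AddSubgroup.closure {g | ∃ (k : ℕ) (s : Sym p 𝒱) (_ : s ∈ D k)
      (c : C^∞⟮𝓡 n, N; 𝓘(ℝ), ℝ⟯), g = ofFun p 𝒱 c * const n N (FormalSym.ofSym p _ s)},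
      f - q ∈ fil p 𝒱 n N K ∧ ∀ k y, FormalSym.coeff k (q.1 y) ∈ D k := by
  induction K with
  | zero => exact ⟨0, AddSubgroup.zero_mem _, mem_fil_zero _, fun k y => by
      rw [zero_apply, map_zero]
      exact Submodule.zero_mem _⟩
  | succ K ih =>
    obtain ⟨q, hq, hfq, hqD⟩ := ih
    have : FiniteDimensional ℝ (D K) := Submodule.finiteDimensional_of_le (hD K)
    obtain ⟨r, s, c, hs, h⟩ := WeaklySmoothAt.exists_eq_sum (n := n) (S := D K)
      (g := fun y => FormalSym.coeff K ((f - q).1 y))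
      (fun y => by
        rw [sub_apply, map_sub]
        exact Submodule.sub_mem _ (hf K y) (hqD K y))
      (coeff_smooth (f - q) K)
    have e : ∀ k y, FormalSym.coeff k
        ((∑ a, ofFun p 𝒱 (c a) * const n N (FormalSym.ofSym p _ (s a))).1 y) =
        if k = K then ∑ a, c a y • s a else 0 := by
      intro k y
      rw [sum_apply, map_sum]
      simp only [mul_apply, ofFun_apply, const_apply, ← Algebra.smul_def, map_smul,
        FormalSym.coeff_ofSym (hD K (hs _))]
      split_ifs <;> simp
    refine ⟨q + ∑ a, ofFun p 𝒱 (c a) * const n N (FormalSym.ofSym p _ (s a)),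
      AddSubgroup.add_mem _ hq (AddSubgroup.sum_mem _ fun a _ =>
        AddSubgroup.subset_closure ⟨K, s a, hs a, c a, rfl⟩), fun y k hk => ?_, fun k y => ?_⟩
    · rw [← sub_sub, sub_apply, map_sub, e]
      rcases Nat.lt_succ_iff_lt_or_eq.1 hk with hk | rfl
      · rw [if_neg hk.ne, sub_zero]
        exact hfq y k hk
      · rw [if_pos rfl, ← h, sub_self]
    · rw [add_apply, map_add, e]
      refine Submodule.add_mem _ (hqD k y) ?_
      split_ifs with hk
      · subst hk
        exact Submodule.sum_mem _ fun a _ => Submodule.smul_mem _ _ (hs a)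
      · exact Submodule.zero_mem _

/-- Homomorphisms to formal power series which respect the filtration by order are determined by
their values on real functions and on the coordinates. -/
theorem ringHom_ext {R : Type*} [CommRing R] {W : Type*} [AddCommGroup W] [Module R W]
    {𝒲 : 𝓘 → Submodule R W} {Φ Ψ : SmoothSec p 𝒱 n N →+* FormalSym p 𝒲}
    (hΦ : ∀ j, ∀ f ∈ fil p 𝒱 n N j, Φ f ∈ FormalSym.fil p 𝒲 j)
    (hΨ : ∀ j, ∀ f ∈ fil p 𝒱 n N j, Ψ f ∈ FormalSym.fil p 𝒲 j)
    (h : ∀ c, Φ (ofFun p 𝒱 c) = Ψ (ofFun p 𝒱 c))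
    (h' : ∀ v, Φ (const n N (FormalSym.ι p _ v)) = Ψ (const n N (FormalSym.ι p _ v))) :
    Φ = Ψ := by
  have hs : (Φ.comp (const n N).toRingHom).comp (FormalSym.ofSym p 𝒱).toRingHom =
      (Ψ.comp (const n N).toRingHom).comp (FormalSym.ofSym p 𝒱).toRingHom := by
    refine Sym.ringHom_ext p (fun r => ?_) (fun v => ?_)
    · change Φ (const n N (FormalSym.ofSym p _ (algebraMap ℝ _ r))) =
        Ψ (const n N (FormalSym.ofSym p _ (algebraMap ℝ _ r)))
      rw [AlgHom.commutes, AlgHom.commutes, ← AlgHom.commutes (ofFun p 𝒱)]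
      exact h _
    · change Φ (const n N (FormalSym.ofSym p _ (Sym.ι p _ v))) =
        Ψ (const n N (FormalSym.ofSym p _ (Sym.ι p _ v)))
      rw [FormalSym.ofSym_ι]
      exact h' v
  refine RingHom.ext fun f => ?_
  rw [← sub_eq_zero]
  refine FormalSym.eq_zero_of_mem_fil fun K => ?_
  obtain ⟨q, hq, hfq, -⟩ := exists_sub_mem_fil (Sym.power p 𝒱) (fun _ => le_rfl) f
    (fun k y => FormalSym.coeff_mem_power k _) K
  have e : Φ q = Ψ q := by
    clear hfq
    induction hq using AddSubgroup.closure_induction with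
    | mem q hq =>
      obtain ⟨k, s, _, c, rfl⟩ := hq
      rw [map_mul, map_mul, h]
      exact congrArg (Ψ (ofFun p 𝒱 c) * ·) (RingHom.congr_fun hs s)
    | zero => rw [map_zero, map_zero]
    | add a b _ _ ha hb => rw [map_add, map_add, ha, hb]
    | neg a _ ha => rw [map_neg, map_neg, ha]
  have e' : Φ f - Ψ f = Φ (f - q) - Ψ (f - q) := by
    rw [map_sub, map_sub, e]
    abel
  rw [e']
  exact Submodule.sub_mem _ (hΦ K _ hfq) (hΨ K _ hfq)

end SmoothSec

end Sections

namespace SmoothSec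

variable {𝓘 : Type*} [NonUnitalCommSemiring 𝓘] {p : 𝓘 →+ ZMod 2}
variable {V : Type*} [AddCommGroup V] [Module ℝ V] [FiniteDimensional ℝ V]
variable {𝒱 : 𝓘 → Submodule ℝ V} {n : ℕ}
variable {N : Type*} [TopologicalSpace N] [ChartedSpace (EuclideanSpace ℝ (Fin n)) N]

variable (p 𝒱 n N) in
/-- The Euler operator on smooth functions with values in formal power series. -/
noncomputable def euler : SmoothSec p 𝒱 n N →ₗ[ℝ] SmoothSec p 𝒱 n N where
  toFun f := ⟨fun y => FormalSym.euler p 𝒱 (f.1 y), fun x => smoothAt_iff.2 fun k => by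
    simp only [FormalSym.coeff_euler]
    exact WeaklySmoothAt.smul contMDiffAt_const (coeff_smooth f k x)⟩
  map_add' f g := ext fun y => map_add (FormalSym.euler p 𝒱) _ _
  map_smul' r f := ext fun y => map_smul (FormalSym.euler p 𝒱) _ _

theorem euler_mul (f g : SmoothSec p 𝒱 n N) :
    euler p 𝒱 n N (f * g) = euler p 𝒱 n N f * g + f * euler p 𝒱 n N g :=
  ext fun _ => FormalSym.euler_mul _ _

theorem euler_ofFun (c : C^∞⟮𝓡 n, N; 𝓘(ℝ), ℝ⟯) : euler p 𝒱 n N (ofFun p 𝒱 c) = 0 :=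
  ext fun _ => FormalSym.euler_algebraMap _

theorem euler_mem_deg {i : 𝓘} {f : SmoothSec p 𝒱 n N} (hf : f ∈ deg p 𝒱 n N i) :
    euler p 𝒱 n N f ∈ deg p 𝒱 n N i :=
  fun y => FormalSym.euler_mem_deg (hf y)

theorem euler_sub_mem_fil {j : ℕ} {f : SmoothSec p 𝒱 n N} (hf : f ∈ fil p 𝒱 n N j) :
    euler p 𝒱 n N f - (j : ℝ) • f ∈ fil p 𝒱 n N (j + 1) :=
  fun y => FormalSym.euler_sub_mem_fil (hf y)

theorem mem_deg_of_forall_sub_mem_fil {i : 𝓘} {f : SmoothSec p 𝒱 n N}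
    (h : ∀ K, ∃ g ∈ deg p 𝒱 n N i, f - g ∈ fil p 𝒱 n N K) : f ∈ deg p 𝒱 n N i := by
  refine fun y => FormalSym.mem_deg.2 fun k => ?_
  obtain ⟨g, hg, hfg⟩ := h (k + 1)
  have e := hfg y k (Nat.lt_succ_self k)
  rw [sub_apply, map_sub, sub_eq_zero] at e
  rw [e]
  exact FormalSym.mem_deg.1 (hg y) k

theorem eq_of_forall_sub_mem_fil {f g : SmoothSec p 𝒱 n N}
    (h : ∀ K, f - g ∈ fil p 𝒱 n N K) : f = g :=
  sub_eq_zero.1 (eq_zero_of_mem_fil h)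

/-- The monomials: products of a smooth real function and a constant element of `D k ⊆ Sᵏ(V)`. -/
def monomials (n : ℕ) (N : Type*) [TopologicalSpace N] [ChartedSpace (EuclideanSpace ℝ (Fin n)) N]
    (D : ℕ → Submodule ℝ (Sym p 𝒱)) : Set (SmoothSec p 𝒱 n N) :=
  {g | ∃ (k : ℕ) (s : Sym p 𝒱) (_ : s ∈ D k)
      (c : C^∞⟮𝓡 n, N; 𝓘(ℝ), ℝ⟯), g = ofFun p 𝒱 c * const n N (FormalSym.ofSym p _ s)}

theorem exists_mem_closure_monomials (D : ℕ → Submodule ℝ (Sym p 𝒱))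
    (hD : ∀ k, D k ≤ Sym.power p 𝒱 k) (f : SmoothSec p 𝒱 n N)
    (hf : ∀ k y, FormalSym.coeff k (f.1 y) ∈ D k) (K : ℕ) :
    ∃ q ∈ AddSubgroup.closure (monomials n N D), f - q ∈ fil p 𝒱 n N K := by
  obtain ⟨q, hq, h, -⟩ := exists_sub_mem_fil D hD f hf K
  exact ⟨q, hq, h⟩

/-- The component of a function in `Sᵏ(V)`, expanded in a basis of `Sᵏ(V)` and transformed by
homomorphisms `φ` on the coefficients and `θ` on `S(V)`, gives a linear map. -/
theorem exists_component_map (φ : C^∞⟮𝓡 n, N; 𝓘(ℝ), ℝ⟯ →ₐ[ℝ] SmoothSec p 𝒱 n N)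
    (θ : Sym p 𝒱 →ₐ[ℝ] SmoothSec p 𝒱 n N) (k : ℕ)
    (hφ : ∀ c, φ c - ofFun p 𝒱 c ∈ fil p 𝒱 n N 1)
    (hθ : ∀ s ∈ Sym.power p 𝒱 k, θ s ∈ fil p 𝒱 n N k ∧
      θ s - const n N (FormalSym.ofSym p 𝒱 s) ∈ fil p 𝒱 n N (k + 1)) :
    ∃ T : SmoothSec p 𝒱 n N →ₗ[ℝ] SmoothSec p 𝒱 n N,
      (∀ f, T f ∈ fil p 𝒱 n N k) ∧ (∀ f ∈ fil p 𝒱 n N (k + 1), T f = 0) ∧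
      (∀ f ∈ fil p 𝒱 n N k, T f - f ∈ fil p 𝒱 n N (k + 1)) ∧
      ∀ c l, ∀ s ∈ Sym.power p 𝒱 l,
        T (ofFun p 𝒱 c * const n N (FormalSym.ofSym p 𝒱 s)) = if k = l then φ c * θ s else 0 := by
  let b := Module.finBasis ℝ (Sym.power p 𝒱 k)
  let comp : SmoothSec p 𝒱 n N → N → Sym.power p 𝒱 k := fun f y =>
    ⟨FormalSym.coeff k (f.1 y), FormalSym.coeff_mem_power k (f.1 y)⟩
  have hcomp : ∀ f y, (comp f y : Sym p 𝒱) = FormalSym.coeff k (f.1 y) := fun _ _ => rfl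
  let c : Fin (Module.finrank ℝ (Sym.power p 𝒱 k)) → SmoothSec p 𝒱 n N →
      C^∞⟮𝓡 n, N; 𝓘(ℝ), ℝ⟯ := fun j f => ⟨fun y => b.coord j (comp f y), fun x =>
        (coeff_smooth f k x).comp_linear_on (fun y => FormalSym.coeff_mem_power k (f.1 y))
          (b.coord j) LinearMap.id⟩
  have hc : ∀ j f y, c j f y = b.coord j (comp f y) := fun _ _ _ => rfl
  let T : SmoothSec p 𝒱 n N →ₗ[ℝ] SmoothSec p 𝒱 n N :=
    { toFun := fun f => ∑ j, φ (c j f) * θ (b j)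
      map_add' := fun f g => by
        rw [← Finset.sum_add_distrib]
        refine Finset.sum_congr rfl fun j _ => ?_
        have e : c j (f + g) = c j f + c j g := by
          refine ContMDiffMap.ext fun y => ?_
          have e' : comp (f + g) y = comp f y + comp g y := Subtype.ext (map_add _ _ _)
          exact (congrArg (b.coord j) e').trans (map_add _ _ _)
        rw [e, map_add, add_mul]
      map_smul' := fun r f => by
        rw [Finset.smul_sum]
        refine Finset.sum_congr rfl fun j _ => ?_
        have e : c j (r • f) = r • c j f := by
          refine ContMDiffMap.ext fun y => ?_
          have e' : comp (r • f) y = r • comp f y :=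
            Subtype.ext ((FormalSym.coeff k).map_smul r (f.1 y))
          exact (congrArg (b.coord j) e').trans (map_smul _ _ _)
        rw [e, map_smul, smul_mul_assoc]
        rfl }
  have hT : ∀ f, T f = ∑ j, φ (c j f) * θ (b j) := fun _ => rfl
  refine ⟨T, fun f => ?_, fun f hf => ?_, fun f hf => ?_, fun d l s hs => ?_⟩
  · rw [hT]
    refine Submodule.sum_mem _ fun j _ => ?_
    have h := mul_mem_fil (mem_fil_zero (φ (c j f))) (hθ _ (b j).2).1
    rwa [zero_add] at h
  · rw [hT]
    refine Finset.sum_eq_zero fun j _ => ?_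
    have e : c j f = 0 := by
      refine ContMDiffMap.ext fun y => ?_
      have e' : comp f y = 0 := Subtype.ext (hf y k (Nat.lt_succ_self k))
      exact (congrArg (b.coord j) e').trans (map_zero _)
    rw [e, map_zero, zero_mul]
  · have h1 : T f - ∑ j, ofFun p 𝒱 (c j f) * const n N (FormalSym.ofSym p 𝒱 (b j)) ∈
        fil p 𝒱 n N (k + 1) := by
      rw [hT, ← Finset.sum_sub_distrib]
      refine Submodule.sum_mem _ fun j _ => ?_
      have e : φ (c j f) * θ (b j) - ofFun p 𝒱 (c j f) * const n N (FormalSym.ofSym p 𝒱 (b j)) =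
          (φ (c j f) - ofFun p 𝒱 (c j f)) * θ (b j) +
          ofFun p 𝒱 (c j f) * (θ (b j) - const n N (FormalSym.ofSym p 𝒱 (b j))) := by
        rw [sub_mul, mul_sub]
        abel
      rw [e]
      refine Submodule.add_mem _ ?_ ?_
      · rw [add_comm k]
        exact mul_mem_fil (hφ _) (hθ _ (b j).2).1
      · rw [← zero_add (k + 1)]
        exact mul_mem_fil (mem_fil_zero _) (hθ _ (b j).2).2
    have h2 : f - ∑ j, ofFun p 𝒱 (c j f) * const n N (FormalSym.ofSym p 𝒱 (b j)) ∈
        fil p 𝒱 n N (k + 1) := by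
      intro y l hl
      rw [sub_apply, map_sub, sum_apply, map_sum]
      simp only [mul_apply, ofFun_apply, const_apply, ← Algebra.smul_def, map_smul,
        FormalSym.coeff_ofSym (b _).2]
      rcases Nat.lt_succ_iff_lt_or_eq.1 hl with hl | rfl
      · rw [hf y l hl]
        simp [hl.ne]
      · have h := congrArg (Submodule.subtype _) (b.sum_repr (comp f y))
        rw [map_sum] at h
        simp only [if_true]
        rw [sub_eq_zero]
        exact h.symm
    have h3 := Submodule.sub_mem _ h1 h2
    rwa [sub_sub_sub_cancel_right] at h3
  · split_ifs with h
    · subst h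
      have e : ∀ j, c j (ofFun p 𝒱 d * const n N (FormalSym.ofSym p 𝒱 s)) =
          (b.coord j ⟨s, hs⟩) • d := by
        intro j
        refine ContMDiffMap.ext fun y => ?_
        have e' : comp (ofFun p 𝒱 d * const n N (FormalSym.ofSym p 𝒱 s)) y = d y • ⟨s, hs⟩ := by
          refine Subtype.ext ?_
          rw [hcomp, mul_apply, ofFun_apply, const_apply, ← Algebra.smul_def, map_smul,
            FormalSym.coeff_ofSym hs, if_pos rfl]
          rfl
        rw [hc, e', map_smul]
        exact mul_comm _ _
      have e2 := congrArg (fun x : Sym.power p 𝒱 k => θ x) (b.sum_repr ⟨s, hs⟩)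
      rw [hT]
      simp only [e, map_smul, smul_mul_assoc, ← mul_smul_comm]
      rw [← Finset.mul_sum]
      congr 1
      rw [← e2, AddSubmonoidClass.coe_finsetSum, map_sum]
      refine Finset.sum_congr rfl fun j _ => ?_
      exact (map_smul θ _ _).symm
    · rw [hT]
      refine Finset.sum_eq_zero fun j _ => ?_
      have e : c j (ofFun p 𝒱 d * const n N (FormalSym.ofSym p 𝒱 s)) = 0 := by
        refine ContMDiffMap.ext fun y => ?_
        have e' : comp (ofFun p 𝒱 d * const n N (FormalSym.ofSym p 𝒱 s)) y = 0 := by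
          refine Subtype.ext ?_
          rw [hcomp, mul_apply, ofFun_apply, const_apply, ← Algebra.smul_def, map_smul,
            FormalSym.coeff_ofSym hs, if_neg h, smul_zero]
          rfl
        exact (congrArg (b.coord j) e').trans (map_zero _)
      rw [e, map_zero, zero_mul]

/-- The homomorphism `S(V) → C^∞(N, ∏ₖ Sᵏ(V))` given by perturbed coordinates `ξ`. -/
theorem exists_lift_of_sub_mem_fil (ξ : V →ₗ[ℝ] SmoothSec p 𝒱 n N)
    (hξ : ∀ i, ∀ v ∈ 𝒱 i, ξ v ∈ deg p 𝒱 n N i)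
    (hξ' : ∀ v, ξ v - const n N (FormalSym.ι p 𝒱 v) ∈ fil p 𝒱 n N 2) :
    ∃ θ : Sym p 𝒱 →ₐ[ℝ] SmoothSec p 𝒱 n N, (∀ v, θ (Sym.ι p 𝒱 v) = ξ v) ∧
      (∀ k, ∀ s ∈ Sym.power p 𝒱 k, θ s ∈ fil p 𝒱 n N k ∧
        θ s - const n N (FormalSym.ofSym p 𝒱 s) ∈ fil p 𝒱 n N (k + 1)) ∧
      ∀ k i, ∀ s ∈ Sym.component p 𝒱 k i, θ s ∈ deg p 𝒱 n N i := by
  obtain ⟨θ, hθ⟩ := Sym.exists_lift (p := p) (𝒱 := 𝒱) ξ fun i j v hv w hw =>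
    ext fun y => FormalSym.deg_mul_comm (hξ i v hv y) (hξ j w hw y)
  have hc : ∀ k, ∀ s ∈ Sym.power p 𝒱 k,
      const n N (FormalSym.ofSym p 𝒱 s) ∈ fil p 𝒱 n N k := fun k s hs y =>
    FormalSym.ofSym_mem_fil hs
  refine ⟨θ, hθ, fun k s hs => ?_, fun k i s hs => ?_⟩
  · have h : θ s - const n N (FormalSym.ofSym p 𝒱 s) ∈ fil p 𝒱 n N (k + 1) := by
      rw [Sym.power] at hs
      induction hs using Submodule.pow_induction_on_left' with
      | algebraMap r =>
        rw [AlgHom.commutes, AlgHom.commutes, AlgHom.commutes, sub_self]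
        exact Submodule.zero_mem _
      | add x y i _ _ hx hy =>
        rw [map_add, map_add, map_add, add_sub_add_comm]
        exact Submodule.add_mem _ hx hy
      | mem_mul w hw k x hx ih =>
        obtain ⟨v, rfl⟩ := hw
        have e : θ (Sym.ι p 𝒱 v * x) - const n N (FormalSym.ofSym p 𝒱 (Sym.ι p 𝒱 v * x)) =
            (ξ v - const n N (FormalSym.ι p 𝒱 v)) * θ x +
            const n N (FormalSym.ι p 𝒱 v) * (θ x - const n N (FormalSym.ofSym p 𝒱 x)) := by
          rw [map_mul, map_mul, map_mul, hθ, FormalSym.ofSym_ι, sub_mul, mul_sub]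
          abel
        have h2 : θ x ∈ fil p 𝒱 n N k := by
          have h3 := Submodule.add_mem _ (fil_anti (Nat.le_succ k) ih) (hc k x hx)
          rwa [sub_add_cancel] at h3
        rw [e]
        refine Submodule.add_mem _ ?_ ?_
        · have h4 := mul_mem_fil (hξ' v) h2
          rwa [add_comm 2 k] at h4
        · have h4 := mul_mem_fil (i := 1)
            (f := const n N (FormalSym.ι p 𝒱 v)) (fun _ => FormalSym.ι_mem_fil v) ih
          rwa [add_comm 1 (k + 1)] at h4
    refine ⟨?_, h⟩
    have h3 := Submodule.add_mem _ (fil_anti (Nat.le_succ k) h) (hc k s hs)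
    rwa [sub_add_cancel] at h3
  · refine Sym.component_induction (P := fun k i s => θ s ∈ deg p 𝒱 n N i) ?_ ?_ ?_ ?_ ?_ hs
    · intros
      rw [map_zero]
      exact Submodule.zero_mem _
    · intro k i x y hx hy
      rw [map_add]
      exact Submodule.add_mem _ hx hy
    · intro k i r x hx
      rw [map_smul]
      exact Submodule.smul_mem _ _ hx
    · rw [map_one, ← map_one (ofFun p 𝒱)]
      exact ofFun_mem_deg _
    · intro k i j v hv x _ hx
      rw [map_mul, hθ]
      exact mul_mem_deg (hξ i v hv) hx

/-- Change of generators: real functions and coordinates can be perturbed by terms of higher order,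
as long as the degrees and the multiplicativity on real functions are kept. -/
theorem exists_change_of_generators (h𝒱 : ⨆ i, 𝒱 i = ⊤)
    (φ : C^∞⟮𝓡 n, N; 𝓘(ℝ), ℝ⟯ →ₐ[ℝ] SmoothSec p 𝒱 n N)
    (hφ0 : ∀ c, φ c ∈ deg p 𝒱 n N 0) (hφ : ∀ c, φ c - ofFun p 𝒱 c ∈ fil p 𝒱 n N 1)
    (ξ : V →ₗ[ℝ] SmoothSec p 𝒱 n N)
    (hξ : ∀ i, ∀ v ∈ 𝒱 i, ξ v ∈ deg p 𝒱 n N i)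
    (hξ' : ∀ v, ξ v - const n N (FormalSym.ι p 𝒱 v) ∈ fil p 𝒱 n N 2) :
    ∃ Φ : SmoothSec p 𝒱 n N ≃ₐ[ℝ] SmoothSec p 𝒱 n N,
      (∀ c, Φ (ofFun p 𝒱 c) = φ c) ∧ (∀ v, Φ (const n N (FormalSym.ι p 𝒱 v)) = ξ v) ∧
      (∀ i f, Φ f ∈ deg p 𝒱 n N i ↔ f ∈ deg p 𝒱 n N i) ∧
      ∀ j, ∀ f ∈ fil p 𝒱 n N j, Φ f - f ∈ fil p 𝒱 n N (j + 1) := by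
  -- `Φ` is the sum of the maps `T k` which transform the component in `Sᵏ(V)`; it converges, as the
  -- values of `T k` are of order at least `k`
  obtain ⟨θ, hθ, hθf, hθd⟩ := exists_lift_of_sub_mem_fil ξ hξ hξ'
  choose T hTfil hTzero hTsub hT using fun k => exists_component_map φ θ k hφ (hθf k)
  have hlim : ∀ f, ∃ g, ∀ K, g - ∑ k ∈ Finset.range K, T k f ∈ fil p 𝒱 n N K := fun f => by
    obtain ⟨g, hg, -⟩ := exists_limit (fun K => ∑ k ∈ Finset.range K, T k f) fun K => by
      rw [Finset.sum_range_succ, add_sub_cancel_left]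
      exact hTfil K f
    exact ⟨g, hg⟩
  choose Φ₀ hΦ₀ using hlim
  let Φ : SmoothSec p 𝒱 n N →ₗ[ℝ] SmoothSec p 𝒱 n N :=
    { toFun := Φ₀
      map_add' := fun f g => eq_of_forall_sub_mem_fil fun K => by
        have h := Submodule.sub_mem _ (hΦ₀ (f + g) K) (Submodule.add_mem _ (hΦ₀ f K) (hΦ₀ g K))
        have e : Φ₀ (f + g) - (Φ₀ f + Φ₀ g) = Φ₀ (f + g) - ∑ k ∈ Finset.range K, T k (f + g) -
            (Φ₀ f - ∑ k ∈ Finset.range K, T k f + (Φ₀ g - ∑ k ∈ Finset.range K, T k g)) := by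
          simp only [map_add, Finset.sum_add_distrib]
          abel
        rw [e]
        exact h
      map_smul' := fun r f => eq_of_forall_sub_mem_fil fun K => by
        have h := Submodule.sub_mem _ (hΦ₀ (r • f) K) (Submodule.smul_mem _ r (hΦ₀ f K))
        have e : Φ₀ (r • f) - r • Φ₀ f = Φ₀ (r • f) - ∑ k ∈ Finset.range K, T k (r • f) -
            r • (Φ₀ f - ∑ k ∈ Finset.range K, T k f) := by
          simp only [map_smul, ← Finset.smul_sum, smul_sub]
          abel
        rw [RingHom.id_apply, e]
        exact h }
  have hΦ : ∀ f K, Φ f - ∑ k ∈ Finset.range K, T k f ∈ fil p 𝒱 n N K := hΦ₀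
  -- `Φ` is the identity modulo higher order
  have hΦfil : ∀ j, ∀ f ∈ fil p 𝒱 n N j, Φ f - f ∈ fil p 𝒱 n N (j + 1) := by
    intro j f hf
    have h := Submodule.add_mem _ (hΦ f (j + 1)) (hTsub j f hf)
    have e : ∑ k ∈ Finset.range (j + 1), T k f = T j f := by
      rw [Finset.sum_range_succ, Finset.sum_eq_zero, zero_add]
      intro k hk
      exact hTzero k f (fil_anti (Finset.mem_range.1 hk) hf)
    rwa [e, sub_add_sub_cancel] at h
  have hΦfil' : ∀ j, ∀ f ∈ fil p 𝒱 n N j, Φ f ∈ fil p 𝒱 n N j := fun j f hf => by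
    have h := Submodule.add_mem _ (fil_anti (Nat.le_succ j) (hΦfil j f hf)) hf
    rwa [sub_add_cancel] at h
  have hmon : ∀ c k, ∀ s ∈ Sym.power p 𝒱 k,
      Φ (ofFun p 𝒱 c * const n N (FormalSym.ofSym p 𝒱 s)) = φ c * θ s := by
    intro c k s hs
    refine eq_of_forall_sub_mem_fil fun K => ?_
    have h := hΦ (ofFun p 𝒱 c * const n N (FormalSym.ofSym p 𝒱 s)) (max K (k + 1))
    simp only [hT _ c k s hs] at h
    rw [Finset.sum_ite_eq' (Finset.range (max K (k + 1))) k, if_pos] at h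
    · exact fil_anti (le_max_left _ _) h
    · exact Finset.mem_range.2 (lt_of_lt_of_le (Nat.lt_succ_self k) (le_max_right _ _))
  -- sums of monomials are dense for the filtration by order, and `Φ` is multiplicative on them
  have happrox : ∀ f K, ∃ q ∈ AddSubgroup.closure (monomials n N (Sym.power p 𝒱)),
      f - q ∈ fil p 𝒱 n N K := fun f K =>
    exists_mem_closure_monomials _ (fun _ => le_rfl) f (fun k y => FormalSym.coeff_mem_power k _) K
  have hmulmon : ∀ q ∈ AddSubgroup.closure (monomials n N (Sym.power p 𝒱)),
      ∀ q' ∈ AddSubgroup.closure (monomials n N (Sym.power p 𝒱)), Φ (q * q') = Φ q * Φ q' := by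
    intro q hq q' hq'
    induction hq, hq' using AddSubgroup.closure_induction₂ with
    | mem x y hx hy =>
      obtain ⟨k, s, hs, c, rfl⟩ := hx
      obtain ⟨l, t, ht, d, rfl⟩ := hy
      have e : ofFun p 𝒱 c * const n N (FormalSym.ofSym p 𝒱 s) *
          (ofFun p 𝒱 d * const n N (FormalSym.ofSym p 𝒱 t)) =
          ofFun p 𝒱 (c * d) * const n N (FormalSym.ofSym p 𝒱 (s * t)) := by
        rw [map_mul, map_mul, map_mul, mul_assoc, mul_assoc,
          ← mul_assoc _ (ofFun p 𝒱 d), ← commute_of_mem_deg_zero h𝒱 (ofFun_mem_deg d),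
          mul_assoc (ofFun p 𝒱 d)]
      have hcomm : φ d * θ s = θ s * φ d := commute_of_mem_deg_zero h𝒱 (hφ0 d) (θ s)
      rw [e, hmon _ _ _ (Sym.mul_mem_power hs ht), hmon _ _ _ hs, hmon _ _ _ ht, map_mul, map_mul,
        mul_assoc, mul_assoc, ← mul_assoc (φ d), hcomm, mul_assoc (θ s)]
    | zero_left => rw [zero_mul, map_zero, zero_mul]
    | zero_right => rw [mul_zero, map_zero, mul_zero]
    | add_left x y z _ _ _ hx hy => rw [add_mul, map_add, hx, hy, map_add, add_mul]
    | add_right x y z _ _ _ hx hy => rw [mul_add, map_add, hx, hy, map_add, mul_add]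
    | neg_left x y _ _ h => rw [neg_mul, map_neg, h, map_neg, neg_mul]
    | neg_right x y _ _ h => rw [mul_neg, map_neg, h, map_neg, mul_neg]
  have hmulsub : ∀ K (f g q q' : SmoothSec p 𝒱 n N), f - q ∈ fil p 𝒱 n N K →
      g - q' ∈ fil p 𝒱 n N K → f * g - q * q' ∈ fil p 𝒱 n N K := by
    intro K f g q q' h h'
    have e : f * g - q * q' = (f - q) * g + q * (g - q') := by
      rw [sub_mul, mul_sub]
      abel
    rw [e]
    refine Submodule.add_mem _ ?_ ?_
    · exact mul_mem_fil (j := 0) h (mem_fil_zero _)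
    · rw [← zero_add K]
      exact mul_mem_fil (mem_fil_zero _) h'
  have hmul : ∀ f g, Φ (f * g) = Φ f * Φ g := by
    intro f g
    refine eq_of_forall_sub_mem_fil fun K => ?_
    obtain ⟨q, hq, hfq⟩ := happrox f K
    obtain ⟨q', hq', hgq⟩ := happrox g K
    have h1 := hΦfil' K _ (hmulsub K f g q q' hfq hgq)
    have h2 := hmulsub K (Φ f) (Φ g) (Φ q) (Φ q') (by rw [← map_sub]; exact hΦfil' K _ hfq)
      (by rw [← map_sub]; exact hΦfil' K _ hgq)
    have h3 := Submodule.sub_mem _ h1 h2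
    rwa [map_sub, hmulmon q hq q' hq', sub_sub_sub_cancel_right] at h3
  have hone : Φ 1 = 1 := by
    have h := hmon 1 0 1 Sym.one_mem_power
    rwa [map_one, map_one, map_one, map_one, map_one, one_mul] at h
  have hdeg : ∀ i, ∀ f ∈ deg p 𝒱 n N i, Φ f ∈ deg p 𝒱 n N i := by
    intro i f hf
    refine mem_deg_of_forall_sub_mem_fil fun K => ?_
    obtain ⟨q, hq, hfq⟩ := exists_mem_closure_monomials (fun k => Sym.component p 𝒱 k i)
      (fun k => Sym.component_le_power k i) f (fun k y => FormalSym.mem_deg.1 (hf y) k) K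
    refine ⟨Φ q, ?_, by rw [← map_sub]; exact hΦfil' K _ hfq⟩
    clear hfq
    induction hq using AddSubgroup.closure_induction with
    | mem x hx =>
      obtain ⟨k, s, hs, c, rfl⟩ := hx
      rw [hmon _ k _ (Sym.component_le_power k i hs), ← zero_add i]
      exact mul_mem_deg (hφ0 c) (hθd k i s hs)
    | zero =>
      rw [map_zero]
      exact Submodule.zero_mem _
    | add x y _ _ hx hy =>
      rw [map_add]
      exact Submodule.add_mem _ hx hy
    | neg x _ hx =>
      rw [map_neg]
      exact Submodule.neg_mem _ hx
  obtain ⟨hinj, hsurj⟩ := bijective_of_unipotent Φ hΦfil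
  let Φ' : SmoothSec p 𝒱 n N →ₐ[ℝ] SmoothSec p 𝒱 n N := AlgHom.ofLinearMap Φ hone hmul
  refine ⟨AlgEquiv.ofBijective Φ' ⟨hinj, fun g => ?_⟩, fun c => ?_, fun v => ?_, fun i f => ?_,
    hΦfil⟩
  · obtain ⟨f, hf, -⟩ := hsurj g
    exact ⟨f, hf⟩
  · have h := hmon c 0 1 Sym.one_mem_power
    rwa [map_one, map_one, map_one, mul_one, mul_one] at h
  · have h := hmon 1 1 _ (Sym.ι_mem_power v)
    rwa [map_one, map_one, one_mul, one_mul, hθ, FormalSym.ofSym_ι] at h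
  · refine ⟨fun h => ?_, hdeg i f⟩
    obtain ⟨g, hg, hg'⟩ := hsurj (Φ f)
    rw [← hinj hg]
    exact hg' i (hdeg i) h

end SmoothSec

/-! ### Gluing sections of a sheaf of algebras -/

namespace GradedRingedSpace

variable {𝓘 : Type*} [NonUnitalCommSemiring 𝓘] {X : TopCat.{u}} (𝓜 : GradedRingedSpace 𝓘 X)

theorem eq_of_local {U : Opens X} {a b : 𝓜.sec U}
    (h : ∀ x ∈ U, ∃ (W : Opens X) (hW : W ≤ U), x ∈ W ∧ 𝓜.res hW a = 𝓜.res hW b) : a = b := by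
  choose W hW hx e using h
  refine 𝓜.sheaf.eq_of_locally_eq' (fun x : U => W x.1 x.2) U (fun x => homOfLE (hW x.1 x.2))
    (fun x hxU => Opens.mem_iSup.2 ⟨⟨x, hxU⟩, hx x hxU⟩) a b fun x => e x.1 x.2

/-- A section that locally exists and is unique, among those with a property compatible with
restrictions, exists globally. -/
theorem exists_glue {U : Opens X} (P : ∀ W : Opens X, W ≤ U → 𝓜.sec W → Prop)
    (hres : ∀ W hW W' (h : W' ≤ W) b, P W hW b → P W' (h.trans hW) (𝓜.res h b))
    (huniq : ∀ W hW b b', P W hW b → P W hW b' → b = b')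
    (hex : ∀ x ∈ U, ∃ W hW, x ∈ W ∧ ∃ b, P W hW b) :
    ∃ b : 𝓜.sec U, ∀ x ∈ U, ∃ W hW, x ∈ W ∧ P W hW (𝓜.res hW b) := by
  choose W hW hx b hb using hex
  obtain ⟨s, hs, -⟩ := 𝓜.sheaf.existsUnique_gluing' (fun x : U => W x.1 x.2) U
    (fun x => homOfLE (hW x.1 x.2)) (fun x hxU => Opens.mem_iSup.2 ⟨⟨x, hxU⟩, hx x hxU⟩)
    (fun x => b x.1 x.2) fun x y => huniq (W x.1 x.2 ⊓ W y.1 y.2)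
      (inf_le_left.trans (hW x.1 x.2)) _ _ (hres _ _ _ inf_le_left _ (hb x.1 x.2))
      (hres _ _ _ inf_le_right _ (hb y.1 y.2))
  refine ⟨s, fun x hxU => ⟨W x hxU, hW x hxU, hx x hxU, ?_⟩⟩
  have e : 𝓜.res (hW x hxU) s = b x hxU := hs ⟨x, hxU⟩
  rw [e]
  exact hb x hxU

end GradedRingedSpace

/-! ### Smoothness on open subsets -/

section Opens

variable {n : ℕ} {N : Type*} [TopologicalSpace N] [ChartedSpace (EuclideanSpace ℝ (Fin n)) N]

theorem contMDiffAt_opens_congr {F : Type*} [NormedAddCommGroup F] [NormedSpace ℝ F]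
    {U U' : Opens N} {f : U → F} {f' : U' → F} {x : N} (hx : x ∈ U)
    (hx' : x ∈ U') (h : ∀ y (hy : y ∈ U) (hy' : y ∈ U'), f ⟨y, hy⟩ = f' ⟨y, hy'⟩)
    (hf : ContMDiffAt (𝓡 n) 𝓘(ℝ, F) ∞ f ⟨x, hx⟩) :
    ContMDiffAt (𝓡 n) 𝓘(ℝ, F) ∞ f' ⟨x, hx'⟩ := by
  classical
  let g : N → F := fun y => if hy : y ∈ U then f ⟨y, hy⟩ else 0
  let g' : N → F := fun y => if hy : y ∈ U' then f' ⟨y, hy⟩ else 0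
  have e : (fun y : U => g y) = f := funext fun y => dif_pos y.2
  have e' : (fun y : U' => g' y) = f' := funext fun y => dif_pos y.2
  rw [← e']
  refine contMDiffAt_subtype_iff.2 ?_
  rw [← e] at hf
  refine (contMDiffAt_subtype_iff.1 hf).congr_of_eventuallyEq ?_
  filter_upwards [U.isOpen.mem_nhds hx, U'.isOpen.mem_nhds hx'] with y hy hy'
  have e1 : g y = f ⟨y, hy⟩ := dif_pos hy
  have e2 : g' y = f' ⟨y, hy'⟩ := dif_pos hy'
  rw [e1, e2, h y hy hy']

variable {𝓘 : Type*} [NonUnitalCommSemiring 𝓘] {p : 𝓘 →+ ZMod 2}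
variable {V : Type*} [AddCommGroup V] [Module ℝ V] {𝒱 : 𝓘 → Submodule ℝ V}

theorem SmoothAt.opens_congr {U U' : Opens N} {f : U → FormalSym p 𝒱} {f' : U' → FormalSym p 𝒱}
    {x : N} (hx : x ∈ U) (hx' : x ∈ U')
    (h : ∀ y (hy : y ∈ U) (hy' : y ∈ U'), f ⟨y, hy⟩ = f' ⟨y, hy'⟩)
    (hf : SmoothAt n f ⟨x, hx⟩) : SmoothAt n f' ⟨x, hx'⟩ := fun k l =>
  contMDiffAt_opens_congr hx hx' (fun y hy hy' => by rw [h y hy hy']) (hf k l)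

variable [FiniteDimensional ℝ V]

namespace SmoothSec

/-- Evaluation at a point. -/
noncomputable def eval (y : N) : SmoothSec p 𝒱 n N →ₐ[ℝ] FormalSym p 𝒱 where
  toFun f := f.1 y
  map_one' := rfl
  map_mul' _ _ := rfl
  map_zero' := rfl
  map_add' _ _ := rfl
  commutes' _ := rfl

variable (p 𝒱) in
/-- Restriction to a smaller open subset. -/
noncomputable def res {U U' : Opens N} (h : U' ≤ U) :
    SmoothSec p 𝒱 n U →ₐ[ℝ] SmoothSec p 𝒱 n U' where
  toFun f := ⟨fun y => f.1 ⟨y, h y.2⟩, fun y =>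
    SmoothAt.opens_congr (h y.2) y.2 (fun _ _ _ => rfl) (f.2 ⟨y, h y.2⟩)⟩
  map_one' := rfl
  map_mul' _ _ := rfl
  map_zero' := rfl
  map_add' _ _ := rfl
  commutes' _ := rfl

end SmoothSec

end Opens

/-! ### Local trivializations of a graded manifold -/

section Triv

variable {𝓘 : Type*} [NonUnitalCommSemiring 𝓘] {p : 𝓘 →+ ZMod 2} {n : ℕ}
variable {M : Type u} [TopologicalSpace M] [ChartedSpace (EuclideanSpace ℝ (Fin n)) M]
variable {V : Type*} [AddCommGroup V] [Module ℝ V] [FiniteDimensional ℝ V]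
variable {𝒱 : 𝓘 → Submodule ℝ V}

variable (p 𝒱 n) in
/-- The smooth functions on an open subset of `M` with values in formal power series. -/
abbrev LocSec (U : Opens (TopCat.of M)) := SmoothSec p 𝒱 n (U : Opens M)

variable (p 𝒱 n) in
/-- A trivialization over `W` of a graded ringed space: an isomorphism over `W` with the sheaf of
smooth functions with values in formal power series on `V`. Unlike a chart it does not involve
coordinates on `W`. -/
structure Triv (𝓜 : GradedRingedSpace 𝓘 (TopCat.of M)) (W : Opens (TopCat.of M)) where
  /-- the isomorphisms on sections -/
  equiv : ∀ U : Opens (TopCat.of M), U ≤ W → (𝓜.sec U ≃ₐ[ℝ] LocSec p n 𝒱 U)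
  natural : ∀ U hU U' (h : U' ≤ U) (a : 𝓜.sec U),
    equiv U' (h.trans hU) (𝓜.res h a) = SmoothSec.res p 𝒱 h (equiv U hU a)
  deg_iff : ∀ U hU (a : 𝓜.sec U) i, equiv U hU a ∈ SmoothSec.deg p 𝒱 n (U : Opens M) i ↔
    a ∈ 𝓜.deg U i

namespace Triv

variable {𝓜 : GradedRingedSpace 𝓘 (TopCat.of M)} {W W' : Opens (TopCat.of M)}
variable (T : Triv p n 𝒱 𝓜 W) (T' : Triv p n 𝒱 𝓜 W')

/-- The value of a section at a point in a trivialization. -/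
noncomputable def ev (U : Opens (TopCat.of M)) (y : M) (hy : y ∈ U) (hyW : y ∈ W) :
    𝓜.sec U →ₐ[ℝ] FormalSym p 𝒱 :=
  (SmoothSec.eval (⟨y, hy, hyW⟩ : ((U ⊓ W : Opens (TopCat.of M)) : Opens M))).comp
    ((T.equiv (U ⊓ W) inf_le_right).toAlgHom.comp (𝓜.res inf_le_left))

variable {T}

theorem equiv_apply {U : Opens (TopCat.of M)} (hU : U ≤ W) (a : 𝓜.sec U) (y : (U : Opens M)) :
    (T.equiv U hU a).1 y = T.ev U y y.2 (hU y.2) a := by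
  change _ = (T.equiv (U ⊓ W) inf_le_right (𝓜.res inf_le_left a)).1 _
  rw [T.natural U hU]
  rfl

theorem ev_res {U U' : Opens (TopCat.of M)} (h : U' ≤ U) {y : M} (hy : y ∈ U') (hyW : y ∈ W)
    (a : 𝓜.sec U) : T.ev U' y hy hyW (𝓜.res h a) = T.ev U y (h hy) hyW a := by
  change (T.equiv (U' ⊓ W) inf_le_right (𝓜.res inf_le_left (𝓜.res h a))).1 _ =
    (T.equiv (U ⊓ W) inf_le_right (𝓜.res inf_le_left a)).1 _
  have h' : U' ⊓ W ≤ U ⊓ W := inf_le_inf_right W h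
  have e := T.natural (U ⊓ W) inf_le_right _ h' (𝓜.res inf_le_left a)
  rw [𝓜.res_res] at e ⊢
  rw [e]
  rfl

theorem ev_symm {U : Opens (TopCat.of M)} (hU : U ≤ W) (f : LocSec p n 𝒱 U) {y : M} (hy : y ∈ U) :
    T.ev U y hy (hU hy) ((T.equiv U hU).symm f) = f.1 ⟨y, hy⟩ := by
  rw [← equiv_apply hU _ ⟨y, hy⟩, AlgEquiv.apply_symm_apply]

theorem symm_res {U U' : Opens (TopCat.of M)} (hU : U ≤ W) (h : U' ≤ U) (f : LocSec p n 𝒱 U) :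
    𝓜.res h ((T.equiv U hU).symm f) =
      (T.equiv U' (h.trans hU)).symm (SmoothSec.res p 𝒱 h f) := by
  apply (T.equiv U' (h.trans hU)).injective
  rw [T.natural U hU, AlgEquiv.apply_symm_apply, AlgEquiv.apply_symm_apply]

theorem ext_ev {U : Opens (TopCat.of M)} (hU : U ≤ W) {a b : 𝓜.sec U}
    (h : ∀ y (hy : y ∈ U), T.ev U y hy (hU hy) a = T.ev U y hy (hU hy) b) : a = b := by
  apply (T.equiv U hU).injective
  refine SmoothSec.ext fun y => ?_
  rw [equiv_apply, equiv_apply, h]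

theorem ev_mem_deg {U : Opens (TopCat.of M)} {a : 𝓜.sec U} {i : 𝓘} (ha : a ∈ 𝓜.deg U i) {y : M}
    (hy : y ∈ U) (hyW : y ∈ W) : T.ev U y hy hyW a ∈ FormalSym.deg p 𝒱 i :=
  (T.deg_iff _ _ _ i).2 (𝓜.map_mem U _ inf_le_left i a ha) ⟨y, hy, hyW⟩

theorem mem_deg_of_ev {U : Opens (TopCat.of M)} (hU : U ≤ W) {a : 𝓜.sec U} {i : 𝓘}
    (h : ∀ y (hy : y ∈ U), T.ev U y hy (hU hy) a ∈ FormalSym.deg p 𝒱 i) : a ∈ 𝓜.deg U i := by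
  refine (T.deg_iff U hU a i).1 fun y => ?_
  rw [equiv_apply]
  exact h y y.2

theorem smoothAt_ev {U : Opens (TopCat.of M)} (hU : U ≤ W) (a : 𝓜.sec U) (x : (U : Opens M)) :
    SmoothAt n (fun y : (U : Opens M) => T.ev U y y.2 (hU y.2) a) x := by
  have h := (T.equiv U hU a).2 x
  have e : (T.equiv U hU a).1 = fun y : (U : Opens M) => T.ev U y y.2 (hU y.2) a :=
    funext fun y => equiv_apply hU a y
  rwa [e] at h

variable (T) in
/-- The restriction of a trivialization. -/
def restrict (h : W' ≤ W) : Triv p n 𝒱 𝓜 W' where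
  equiv U hU := T.equiv U (hU.trans h)
  natural U _ := T.natural U _
  deg_iff U _ := T.deg_iff U _

/-- The value at a point of the constant term is the only character of the stalk of `𝓞` that kills
the sections of nonzero degree. -/
theorem functional_eq (h𝒱 : ⨆ i, 𝒱 i = ⊤) (h0 : 𝒱 0 = ⊥) {x : M} (hxW : x ∈ W)
    (χ : ∀ U : Opens (TopCat.of M), x ∈ U → (𝓜.sec U →ₐ[ℝ] ℝ))
    (hres : ∀ U U' (h : U' ≤ U) hx a, χ U' hx (𝓜.res h a) = χ U (h hx) a)
    (hdeg : ∀ U hx i, i ≠ 0 → ∀ a ∈ 𝓜.deg U i, χ U hx a = 0)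
    (U : Opens (TopCat.of M)) (hx : x ∈ U) (a : 𝓜.sec U) :
    χ U hx a = FormalSym.body p 𝒱 (T.ev U x hx hxW a) := by
  wlog hU : U ≤ W generalizing U
  · have hxUW : x ∈ U ⊓ W := ⟨hx, hxW⟩
    have h := this (U ⊓ W) hxUW (𝓜.res inf_le_left a) inf_le_right
    rw [hres U (U ⊓ W) inf_le_left hxUW a] at h
    rwa [ev_res] at h
  let f := T.equiv U hU a
  let c : Csm n U := SmoothSec.body f
  have hc : c ⟨x, hx⟩ = FormalSym.body p 𝒱 (T.ev U x hx hxW a) :=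
    congrArg (FormalSym.body p 𝒱) (equiv_apply hU a ⟨x, hx⟩)
  rw [← hc]
  -- the linear coordinates are killed, since their components have non-zero degrees
  have hι : ∀ v, χ U hx ((T.equiv U hU).symm (SmoothSec.const n _ (FormalSym.ι p 𝒱 v))) = 0 := by
    intro v
    have hv : v ∈ ⨆ i, 𝒱 i := by rw [h𝒱]; trivial
    induction hv using Submodule.iSup_induction' with
    | mem i v hv =>
      by_cases hi : i = 0
      · subst hi
        rw [h0, Submodule.mem_bot] at hv
        rw [hv, map_zero, map_zero, map_zero, map_zero]
      · refine hdeg U hx i hi _ ((T.deg_iff U hU _ i).1 ?_)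
        rw [AlgEquiv.apply_symm_apply]
        exact fun _ => FormalSym.ι_mem_deg hv
    | zero => rw [map_zero, map_zero, map_zero, map_zero]
    | add v w _ _ hv hw => rw [map_add, map_add, map_add, map_add, hv, hw, add_zero]
  -- `f - c` is a combination of the linear coordinates
  have h1 : χ U hx a = χ U hx ((T.equiv U hU).symm (SmoothSec.ofFun p 𝒱 c)) := by
    have hf : f - SmoothSec.ofFun p 𝒱 c ∈ SmoothSec.fil p 𝒱 n (U : Opens M) (0 + 1) := by
      rw [zero_add, SmoothSec.mem_fil_one, map_sub, sub_eq_zero]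
      exact ContMDiffMap.ext fun y => (FormalSym.body p 𝒱).commutes _ |>.symm
    obtain ⟨g, -, hg⟩ := SmoothSec.exists_eq_sum_coord hf
    have e := congrArg (fun z => χ U hx ((T.equiv U hU).symm z)) hg
    simp only [map_sub, map_sum, map_mul, hι, zero_mul, Finset.sum_const_zero] at e
    rw [sub_eq_zero] at e
    rw [← e]
    exact congrArg _ (AlgEquiv.symm_apply_apply _ _).symm
  by_contra hne
  -- on the open set where `c` differs from the value `χ a`, the function `c - χ a` is invertible,
  -- but it is killed by `χ`
  let U' : Opens (TopCat.of M) := ⟨Subtype.val '' {y : (U : Opens M) | c y ≠ χ U hx a},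
    U.isOpen.isOpenMap_subtype_val _ (isOpen_ne_fun c.contMDiff.continuous continuous_const)⟩
  have hU' : U' ≤ U := by
    rintro _ ⟨y, -, rfl⟩
    exact y.2
  have hcU' : ∀ y : (U' : Opens M), c ⟨y, hU' y.2⟩ ≠ χ U hx a := by
    rintro ⟨_, y, hy, rfl⟩
    exact hy
  have hxU' : x ∈ U' := ⟨⟨x, hx⟩, fun h => hne h.symm, rfl⟩
  let d : Csm n U' := smoothRes n hU' c - algebraMap ℝ _ (χ U hx a)
  have hd : ∀ y : (U' : Opens M), d y ≠ 0 := fun y => sub_ne_zero.2 (hcU' y)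
  let d' : Csm n U' := ⟨fun y => (d y)⁻¹, fun y => (d.contMDiff y).inv₀ (hd y)⟩
  have hdd' : d * d' = 1 := ContMDiffMap.ext fun y => mul_inv_cancel₀ (hd y)
  have hUW := hU'.trans hU
  have h2 : χ U' hxU' ((T.equiv U' hUW).symm (SmoothSec.ofFun p 𝒱 d)) = 0 := by
    have e : SmoothSec.ofFun p 𝒱 d = SmoothSec.res p 𝒱 hU' (SmoothSec.ofFun p 𝒱 c) -
        algebraMap ℝ _ (χ U hx a) := by
      rw [map_sub, AlgHom.commutes]
      rfl
    rw [e, map_sub, ← symm_res hU, map_sub, hres, ← h1, AlgEquiv.commutes, AlgHom.commutes]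
    exact sub_self _
  have h3 := congrArg (fun z => χ U' hxU' ((T.equiv U' hUW).symm (SmoothSec.ofFun p 𝒱 z))) hdd'
  simp only [map_mul, map_one, h2, zero_mul] at h3
  exact zero_ne_one h3

/-- The constant term of a section is independent of the trivialization. -/
theorem body_ev_eq (h𝒱 : ⨆ i, 𝒱 i = ⊤) (h0 : 𝒱 0 = ⊥) {U : Opens (TopCat.of M)} {x : M}
    (hx : x ∈ U) (hxW : x ∈ W) (hxW' : x ∈ W') (a : 𝓜.sec U) :
    FormalSym.body p 𝒱 (T'.ev U x hx hxW' a) = FormalSym.body p 𝒱 (T.ev U x hx hxW a) :=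
  functional_eq (T := T) h𝒱 h0 hxW
    (fun U hx => (FormalSym.body p 𝒱).comp (T'.ev U x hx hxW'))
    (fun _ _ h hx a => congrArg (FormalSym.body p 𝒱) (ev_res h hx hxW' a))
    (fun _ hx _ hi _ ha => FormalSym.body_eq_zero_of_mem_deg hi (ev_mem_deg ha hx hxW')) U hx a

end Triv

/-! ### The filtration by order -/

variable (p 𝒱 n) in
/-- The section `a` vanishes to order `j`: its components of order less than `j` vanish in all
trivializations. -/
def MemFil {𝓜 : GradedRingedSpace 𝓘 (TopCat.of M)} {U : Opens (TopCat.of M)} (j : ℕ)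
    (a : 𝓜.sec U) : Prop :=
  ∀ (W : Opens (TopCat.of M)) (T : Triv p n 𝒱 𝓜 W) (y : M) (hy : y ∈ U) (hyW : y ∈ W),
    T.ev U y hy hyW a ∈ FormalSym.fil p 𝒱 j

namespace MemFil

variable {𝓜 : GradedRingedSpace 𝓘 (TopCat.of M)} {U : Opens (TopCat.of M)} {j : ℕ}

theorem sub {a b : 𝓜.sec U} (ha : MemFil p n 𝒱 j a) (hb : MemFil p n 𝒱 j b) :
    MemFil p n 𝒱 j (a - b) := by
  intro W T y hy hyW
  rw [map_sub]
  exact Submodule.sub_mem _ (ha W T y hy hyW) (hb W T y hy hyW)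

theorem add {a b : 𝓜.sec U} (ha : MemFil p n 𝒱 j a) (hb : MemFil p n 𝒱 j b) :
    MemFil p n 𝒱 j (a + b) := by
  intro W T y hy hyW
  rw [map_add]
  exact Submodule.add_mem _ (ha W T y hy hyW) (hb W T y hy hyW)

theorem mul {a b : 𝓜.sec U} {i : ℕ} (ha : MemFil p n 𝒱 i a) (hb : MemFil p n 𝒱 j b) :
    MemFil p n 𝒱 (i + j) (a * b) := by
  intro W T y hy hyW
  rw [map_mul]
  exact FormalSym.mul_mem_fil (ha W T y hy hyW) (hb W T y hy hyW)

theorem zero_order (a : 𝓜.sec U) : MemFil p n 𝒱 0 a :=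
  fun _ _ _ _ _ => FormalSym.mem_fil_zero _

theorem anti {i : ℕ} (h : i ≤ j) {a : 𝓜.sec U} (ha : MemFil p n 𝒱 j a) : MemFil p n 𝒱 i a :=
  fun W T y hy hyW => FormalSym.fil_anti h (ha W T y hy hyW)

theorem mul_left {a b : 𝓜.sec U} (hb : MemFil p n 𝒱 j b) : MemFil p n 𝒱 j (a * b) := by
  have h := (zero_order (p := p) (n := n) (𝒱 := 𝒱) a).mul hb
  rwa [zero_add] at h

theorem sum {ι : Type*} (s : Finset ι) {a : ι → 𝓜.sec U} (h : ∀ i ∈ s, MemFil p n 𝒱 j (a i)) :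
    MemFil p n 𝒱 j (∑ i ∈ s, a i) := by
  intro W T y hy hyW
  rw [map_sum]
  exact Submodule.sum_mem _ fun i hi => h i hi W T y hy hyW

theorem res {U' : Opens (TopCat.of M)} (h : U' ≤ U) {a : 𝓜.sec U} (ha : MemFil p n 𝒱 j a) :
    MemFil p n 𝒱 j (𝓜.res h a) := by
  intro W T y hy hyW
  rw [Triv.ev_res]
  exact ha W T y (h hy) hyW

/-- The order of vanishing can be read off in one trivialization. -/
theorem of_triv (h𝒱 : ⨆ i, 𝒱 i = ⊤) (h0 : 𝒱 0 = ⊥) {W : Opens (TopCat.of M)}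
    {T : Triv p n 𝒱 𝓜 W} (hU : U ≤ W) {a : 𝓜.sec U}
    (ha : T.equiv U hU a ∈ SmoothSec.fil p 𝒱 n (U : Opens M) j) : MemFil p n 𝒱 j a := by
  intro W' T' y hy hyW'
  have h := SmoothSec.map_mem_fil
    (((T'.ev U y hy hyW').comp (T.equiv U hU).symm.toAlgHom).toRingHom) (fun v => by
      refine FormalSym.mem_fil_one.2 ?_
      change FormalSym.body p 𝒱 (T'.ev U y hy hyW' ((T.equiv U hU).symm _)) = 0
      rw [Triv.body_ev_eq (T := T) T' h𝒱 h0 hy (hU hy), Triv.ev_symm hU _ hy]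
      exact FormalSym.body_ι v) ha
  have e : (((T'.ev U y hy hyW').comp (T.equiv U hU).symm.toAlgHom).toRingHom)
      (T.equiv U hU a) = T'.ev U y hy hyW' a :=
    congrArg (T'.ev U y hy hyW') (AlgEquiv.symm_apply_apply _ a)
  rwa [e] at h

theorem equiv_mem {W : Opens (TopCat.of M)} {T : Triv p n 𝒱 𝓜 W} (hU : U ≤ W) {a : 𝓜.sec U}
    (ha : MemFil p n 𝒱 j a) : T.equiv U hU a ∈ SmoothSec.fil p 𝒱 n (U : Opens M) j := by
  intro y
  rw [Triv.equiv_apply]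
  exact ha W T y y.2 (hU y.2)

theorem of_local {a : 𝓜.sec U} (h : ∀ x ∈ U, ∃ (U' : Opens (TopCat.of M)) (hU' : U' ≤ U), x ∈ U' ∧
    MemFil p n 𝒱 j (𝓜.res hU' a)) : MemFil p n 𝒱 j a := by
  intro W T y hy hyW
  obtain ⟨U', hU', hyU', h'⟩ := h y hy
  have h'' := h' W T y hyU' hyW
  rwa [Triv.ev_res] at h''

end MemFil

end Triv

/-! ### Charts give trivializations -/

section Chart

theorem contMDiffAt_comp_opens {n : ℕ} {N N' : Type*} [TopologicalSpace N]
    [ChartedSpace (EuclideanSpace ℝ (Fin n)) N] [TopologicalSpace N']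
    [ChartedSpace (EuclideanSpace ℝ (Fin n)) N'] {F : Type*} [NormedAddCommGroup F]
    [NormedSpace ℝ F] {U : Opens N} {f : U → F} {h : N' → N} (hU : ∀ y, h y ∈ U) {x : N'}
    (hf : ContMDiffAt (𝓡 n) 𝓘(ℝ, F) ∞ f ⟨h x, hU x⟩) (hh : ContMDiffAt (𝓡 n) (𝓡 n) ∞ h x) :
    ContMDiffAt (𝓡 n) 𝓘(ℝ, F) ∞ (fun y => f ⟨h y, hU y⟩) x := by
  classical
  let g : N → F := fun y => if hy : y ∈ U then f ⟨y, hy⟩ else 0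
  have e : (fun y : U => g y) = f := funext fun y => dif_pos y.2
  have e' : g ∘ h = fun y => f ⟨h y, hU y⟩ := funext fun y => dif_pos (hU y)
  rw [← e']
  refine ContMDiffAt.comp x ?_ hh
  rw [← e] at hf
  exact contMDiffAt_subtype_iff.1 hf

variable {n : ℕ} {M : Type u} [TopologicalSpace M]

/-- The image of an open subset of `M` under a chart. -/
def chartImage (e : OpenPartialHomeomorph M (EuclideanSpace ℝ (Fin n)))
    (U : Opens (TopCat.of M)) : Opens (EuclideanSpace ℝ (Fin n)) :=
  ⟨e.target ∩ e.symm ⁻¹' U, e.isOpen_inter_preimage_symm U.2⟩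

theorem chartImage_mono (e : OpenPartialHomeomorph M (EuclideanSpace ℝ (Fin n)))
    {U U' : Opens (TopCat.of M)} (h : U' ≤ U) : chartImage e U' ≤ chartImage e U :=
  fun _ hx => ⟨hx.1, h hx.2⟩

theorem apply_mem_chartImage (e : OpenPartialHomeomorph M (EuclideanSpace ℝ (Fin n)))
    {U : Opens (TopCat.of M)} (hU : (U : Set M) ⊆ e.source) {y : M} (hy : y ∈ U) :
    e y ∈ chartImage e U := by
  refine ⟨e.map_source (hU hy), ?_⟩
  change e.symm (e y) ∈ U
  rw [e.left_inv (hU hy)]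
  exact hy

theorem chartPreimage_chartImage_le (e : OpenPartialHomeomorph M (EuclideanSpace ℝ (Fin n)))
    (U : Opens (TopCat.of M)) : chartPreimage e (chartImage e U) ≤ U := by
  rintro x ⟨hx, -, hx'⟩
  change e.symm (e x) ∈ U at hx'
  rwa [e.left_inv hx] at hx'

theorem le_chartPreimage_chartImage (e : OpenPartialHomeomorph M (EuclideanSpace ℝ (Fin n)))
    {U : Opens (TopCat.of M)} (hU : (U : Set M) ⊆ e.source) :
    U ≤ chartPreimage e (chartImage e U) :=
  fun _ hx => ⟨hU hx, apply_mem_chartImage e hU hx⟩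

variable {𝓘 : Type*} [NonUnitalCommSemiring 𝓘] {p : 𝓘 →+ ZMod 2}

/-- The restriction maps between equal open subsets are isomorphisms. -/
noncomputable def GradedRingedSpace.resEquiv {X : TopCat.{u}} (𝓜 : GradedRingedSpace 𝓘 X)
    {U U' : Opens X} (h : U' ≤ U) (h' : U ≤ U') : 𝓜.sec U ≃ₐ[ℝ] 𝓜.sec U' :=
  AlgEquiv.ofAlgHom (𝓜.res h) (𝓜.res h')
    (AlgHom.ext fun a => (𝓜.res_res h' h a).trans (𝓜.res_self _ a))
    (AlgHom.ext fun a => (𝓜.res_res h h' a).trans (𝓜.res_self _ a))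

variable [ChartedSpace (EuclideanSpace ℝ (Fin n)) M] {m : 𝓘 →₀ ℕ}

variable (p m) in
/-- The smooth functions on an open subset of `M` in terms of a chart. -/
noncomputable def chartPull [IsManifold (𝓡 n) ∞ M]
    (e : OpenPartialHomeomorph M (EuclideanSpace ℝ (Fin n)))
    (he : e ∈ IsManifold.maximalAtlas (𝓡 n) ∞ M)
    {U : Opens (TopCat.of M)} (hU : (U : Set M) ⊆ e.source) :
    domainSec p n m (chartImage e U) ≃ₐ[ℝ] LocSec p n (modelGrading m) U where
  toFun f := ⟨fun y => f.1 ⟨e y, apply_mem_chartImage e hU y.2⟩, fun x k l =>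
    contMDiffAt_comp_opens (h := fun y : (U : Opens M) => e y)
      (fun y => apply_mem_chartImage e hU y.2) (f.2 _ k l)
      (contMDiffAt_subtype_iff.2 ((contMDiffOn_of_mem_maximalAtlas he).contMDiffAt
        (e.open_source.mem_nhds (hU x.2))))⟩
  invFun g := ⟨fun z => g.1 ⟨e.symm z, z.2.2⟩, fun x k l =>
    contMDiffAt_comp_opens (U := (U : Opens M)) (h := fun z : chartImage e U => e.symm z)
      (fun z => z.2.2) (g.2 _ k l)
      (contMDiffAt_subtype_iff.2 ((contMDiffOn_symm_of_mem_maximalAtlas he).contMDiffAt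
        (e.open_target.mem_nhds x.2.1)))⟩
  left_inv f := Subtype.ext (funext fun z => congrArg f.1 (Subtype.ext (e.right_inv z.2.1)))
  right_inv g := SmoothSec.ext fun y => congrArg g.1 (Subtype.ext (e.left_inv (hU y.2)))
  map_mul' _ _ := rfl
  map_add' _ _ := rfl
  commutes' _ := rfl

variable {𝓜 : GradedRingedSpace 𝓘 (TopCat.of M)}

/-- The trivialization given by a chart. -/
noncomputable def GradedChart.toTriv [IsManifold (𝓡 n) ∞ M] (c : GradedChart p n m 𝓜) :
    Triv p n (modelGrading m) 𝓜 ⟨c.e.source, c.e.open_source⟩ where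
  equiv U hU := ((𝓜.resEquiv (chartPreimage_chartImage_le c.e U)
    (le_chartPreimage_chartImage c.e hU)).trans
      (c.iso (chartImage c.e U) Set.inter_subset_left).symm).trans
        (chartPull p m c.e c.mem_atlas hU)
  natural U hU U' h a := by
    let f := (c.iso (chartImage c.e U) Set.inter_subset_left).symm
      (𝓜.res (chartPreimage_chartImage_le c.e U) a)
    let f' : domainSec p n m (chartImage c.e U') :=
      ⟨fun z => f.1 ⟨z, chartImage_mono c.e h z.2⟩, fun z =>
        SmoothAt.opens_congr (chartImage_mono c.e h z.2) z.2 (fun _ _ _ => rfl) (f.2 _)⟩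
    have e1 := c.natural (chartImage c.e U) Set.inter_subset_left (chartImage c.e U')
      Set.inter_subset_left (chartImage_mono c.e h) f f' fun _ => rfl
    have e2 : (c.iso (chartImage c.e U') Set.inter_subset_left).symm
        (𝓜.res (chartPreimage_chartImage_le c.e U') (𝓜.res h a)) = f' := by
      rw [AlgEquiv.symm_apply_eq, ← e1, AlgEquiv.apply_symm_apply, 𝓜.res_res, 𝓜.res_res]
    refine SmoothSec.ext fun y => ?_
    exact congrArg (fun g : domainSec p n m (chartImage c.e U') =>
      g.1 ⟨c.e y, apply_mem_chartImage c.e (h.trans hU) y.2⟩) e2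
  deg_iff U hU a i := by
    let f := (c.iso (chartImage c.e U) Set.inter_subset_left).symm
      (𝓜.res (chartPreimage_chartImage_le c.e U) a)
    have e1 := c.deg_iff (chartImage c.e U) Set.inter_subset_left f i
    rw [AlgEquiv.apply_symm_apply] at e1
    have e2 : 𝓜.res (chartPreimage_chartImage_le c.e U) a ∈ 𝓜.deg _ i ↔ a ∈ 𝓜.deg U i := by
      refine ⟨fun h => ?_, 𝓜.map_mem _ _ _ i a⟩
      have h' := 𝓜.map_mem _ _ (le_chartPreimage_chartImage c.e hU) i _ h
      have e3 := 𝓜.res_res (chartPreimage_chartImage_le c.e U)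
        (le_chartPreimage_chartImage c.e hU) a
      rw [𝓜.res_self] at e3
      rwa [← e3]
    rw [← e2, e1]
    refine ⟨fun h z => ?_, fun h y => h _⟩
    have h' := h ⟨c.e.symm z, z.2.2⟩
    have e4 : (⟨c.e (c.e.symm z), apply_mem_chartImage c.e hU z.2.2⟩ : chartImage c.e U) = z :=
      Subtype.ext (c.e.right_inv z.2.1)
    change f.1 _ ∈ _ at h'
    rwa [e4] at h'

end Chart

/-! ### The body map -/

section Body

variable {𝓘 : Type*} [NonUnitalCommSemiring 𝓘] {p : 𝓘 →+ ZMod 2} {n : ℕ}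
variable {M : Type u} [TopologicalSpace M] [ChartedSpace (EuclideanSpace ℝ (Fin n)) M]
variable {V : Type*} [AddCommGroup V] [Module ℝ V] [FiniteDimensional ℝ V]
variable {𝒱 : 𝓘 → Submodule ℝ V} {𝓜 : GradedRingedSpace 𝓘 (TopCat.of M)}

/-- In each trivialization `ε` is the constant term. -/
theorem BodyMap.app_apply (ε : BodyMap n 𝓜) (h𝒱 : ⨆ i, 𝒱 i = ⊤) (h0 : 𝒱 0 = ⊥)
    {W : Opens (TopCat.of M)} (T : Triv p n 𝒱 𝓜 W) {U : Opens (TopCat.of M)} (a : 𝓜.sec U) {x : M}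
    (hx : x ∈ U) (hxW : x ∈ W) :
    ε.app U a ⟨x, hx⟩ = FormalSym.body p 𝒱 (T.ev U x hx hxW a) :=
  Triv.functional_eq h𝒱 h0 hxW
    (fun U hx => { toFun := fun a => ε.app U a ⟨x, hx⟩
                   map_one' := by rw [map_one]; rfl
                   map_mul' := fun a b => by rw [map_mul]; rfl
                   map_zero' := by rw [map_zero]; rfl
                   map_add' := fun a b => by rw [map_add]; rfl
                   commutes' := fun r => by rw [AlgHom.commutes]; rfl })
    (fun U U' h hx a => by
      change ε.app U' (𝓜.res h a) ⟨x, hx⟩ = ε.app U a ⟨x, h hx⟩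
      rw [ε.app_res]
      rfl)
    (fun U hx i hi a ha => by
      have e : ε.app U a = 0 := ε.map_deg U i hi a ha
      change ε.app U a ⟨x, hx⟩ = 0
      rw [e]
      rfl) U hx a

variable {D : M → Opens (TopCat.of M)}

theorem BodyMap.ext_of_atlas (h𝒱 : ⨆ i, 𝒱 i = ⊤) (h0 : 𝒱 0 = ⊥) (hD : ∀ x, x ∈ D x)
    (A : ∀ x, Triv p n 𝒱 𝓜 (D x)) (ε ε' : BodyMap n 𝓜) : ε' = ε := by
  have h : ε'.hom = ε.hom := by
    refine NatTrans.ext (funext fun U => AlgCat.Hom.ext (AlgHom.ext fun a => ?_))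
    refine ContMDiffMap.ext fun y => ?_
    exact (ε'.app_apply h𝒱 h0 (A y.1) a y.2 (hD _)).trans
      (ε.app_apply h𝒱 h0 (A y.1) a y.2 (hD _)).symm
  cases ε
  cases ε'
  cases h
  rfl

theorem exists_bodyMap (h𝒱 : ⨆ i, 𝒱 i = ⊤) (h0 : 𝒱 0 = ⊥) (hD : ∀ x, x ∈ D x)
    (A : ∀ x, Triv p n 𝒱 𝓜 (D x)) : Nonempty (BodyMap n 𝓜) := by
  have hsm : ∀ (U : Opens (TopCat.of M)) (a : 𝓜.sec U), ContMDiff (𝓡 n) 𝓘(ℝ) ∞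
      fun y : (U : Opens M) => FormalSym.body p 𝒱 ((A y).ev U y y.2 (hD y) a) := by
    intro U a x
    have hx : x.1 ∈ U ⊓ D x := ⟨x.2, hD x⟩
    refine contMDiffAt_opens_congr (U := (U ⊓ D x : Opens (TopCat.of M)))
      (f := fun y => FormalSym.body p 𝒱 ((A x).ev (U ⊓ D x) y y.2 y.2.2
        (𝓜.res inf_le_left a))) hx x.2 (fun y hy hy' => ?_) ?_
    · rw [Triv.ev_res]
      exact Triv.body_ev_eq (T := A y) (A x) h𝒱 h0 hy' (hD y) hy.2 a
    · exact SmoothAt.body (Triv.smoothAt_ev (T := A x) inf_le_right (𝓜.res inf_le_left a) _)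
  let E : ∀ U : Opens (TopCat.of M), 𝓜.sec U →ₐ[ℝ] Csm n U := fun U =>
    { toFun := fun a => ⟨_, hsm U a⟩
      map_one' := ContMDiffMap.ext fun y => by
        change FormalSym.body p 𝒱 ((A y).ev U y y.2 (hD y) 1) = 1
        rw [map_one, map_one]
      map_mul' := fun a b => ContMDiffMap.ext fun y => by
        change FormalSym.body p 𝒱 ((A y).ev U y y.2 (hD y) (a * b)) = _
        rw [map_mul, map_mul]
        rfl
      map_zero' := ContMDiffMap.ext fun y => by
        change FormalSym.body p 𝒱 ((A y).ev U y y.2 (hD y) 0) = 0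
        rw [map_zero, map_zero]
      map_add' := fun a b => ContMDiffMap.ext fun y => by
        change FormalSym.body p 𝒱 ((A y).ev U y y.2 (hD y) (a + b)) = _
        rw [map_add, map_add]
        rfl
      commutes' := fun r => ContMDiffMap.ext fun y => by
        change FormalSym.body p 𝒱 ((A y).ev U y y.2 (hD y) (algebraMap ℝ _ r)) = _
        rw [AlgHom.commutes, AlgHom.commutes]
        rfl }
  refine ⟨⟨{ app := fun U => AlgCat.ofHom (E U.unop), naturality := fun U U' h => ?_ }, ?_⟩⟩
  · refine AlgCat.Hom.ext (AlgHom.ext fun a => ContMDiffMap.ext fun y => ?_)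
    exact congrArg (FormalSym.body p 𝒱) (Triv.ev_res (T := A y.1) (leOfHom h.unop) y.2 (hD y.1) a)
  · intro U i hi a ha
    refine ContMDiffMap.ext fun y => ?_
    exact FormalSym.body_eq_zero_of_mem_deg hi (Triv.ev_mem_deg ha y.2 (hD _))

variable (ε : BodyMap n 𝓜) {U : Opens (TopCat.of M)}

/-- The sections of order at least `1` form the kernel `𝓞¹` of `ε`. -/
theorem memFil_one_iff (h𝒱 : ⨆ i, 𝒱 i = ⊤) (h0 : 𝒱 0 = ⊥) (hD : ∀ x, x ∈ D x)
    (A : ∀ x, Triv p n 𝒱 𝓜 (D x)) {a : 𝓜.sec U} : MemFil p n 𝒱 1 a ↔ ε.app U a = 0 := by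
  refine ⟨fun h => ContMDiffMap.ext fun y => ?_, fun h W T y hy hyW => ?_⟩
  · refine (ε.app_apply h𝒱 h0 (A y.1) a y.2 (hD _)).trans ?_
    exact FormalSym.mem_fil_one.1 (h _ (A y.1) y y.2 (hD _))
  · rw [FormalSym.mem_fil_one, ← ε.app_apply h𝒱 h0 T a hy hyW, h]
    rfl

/-- The sections of order at least `2` form `𝓞²`: in a trivialization they are combinations of the
linear coordinates with coefficients of order at least `1`. -/
theorem memFil_two_iff (h𝒱 : ⨆ i, 𝒱 i = ⊤) (h0 : 𝒱 0 = ⊥) (hD : ∀ x, x ∈ D x)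
    (A : ∀ x, Triv p n 𝒱 𝓜 (D x)) {a : 𝓜.sec U} : MemFil p n 𝒱 2 a ↔ ε.MemSq a := by
  have hker : ∀ {W : Opens (TopCat.of M)} {b : 𝓜.sec W},
      b ∈ RingHom.ker (ε.app W) ↔ MemFil p n 𝒱 1 b := fun {W b} =>
    RingHom.mem_ker.trans (memFil_one_iff ε h𝒱 h0 hD A).symm
  refine ⟨fun h x hx => ?_, fun h => MemFil.of_local fun x hx => ?_⟩
  · have hU' : U ⊓ D x ≤ D x := inf_le_right
    refine ⟨U ⊓ D x, inf_le_left, ⟨hx, hD x⟩, ?_⟩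
    have h1 := MemFil.equiv_mem (T := A x) hU' (h.res inf_le_left)
    obtain ⟨g, hg, e⟩ := SmoothSec.exists_eq_sum_coord (j := 1) h1
    have e' := congrArg ((A x).equiv _ hU').symm e
    rw [AlgEquiv.symm_apply_apply, map_sum] at e'
    rw [e']
    refine Submodule.sum_mem _ fun b _ => ?_
    rw [map_mul]
    refine Ideal.mul_mem_mul (hker.2 ?_) (hker.2 ?_)
    · refine MemFil.of_triv (T := A x) h𝒱 h0 hU' ?_
      rw [AlgEquiv.apply_symm_apply]
      exact fun _ => FormalSym.ι_mem_fil _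
    · refine MemFil.of_triv (T := A x) h𝒱 h0 hU' ?_
      rw [AlgEquiv.apply_symm_apply]
      exact hg b
  · obtain ⟨W, hW, hxW, h1⟩ := h x hx
    refine ⟨W, hW, hxW, ?_⟩
    refine Submodule.smul_induction_on h1 (fun r hr s hs => ?_) fun r s hr hs => hr.add hs
    exact (hker.1 hr).mul (hker.1 hs)

end Body

section Euler

variable {𝓘 : Type*} [NonUnitalCommSemiring 𝓘] {p : 𝓘 →+ ZMod 2} {n : ℕ}
variable {M : Type u} [TopologicalSpace M] [ChartedSpace (EuclideanSpace ℝ (Fin n)) M]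
variable {V : Type*} [AddCommGroup V] [Module ℝ V] [FiniteDimensional ℝ V]
variable {𝒱 : 𝓘 → Submodule ℝ V} {𝓜 : GradedRingedSpace 𝓘 (TopCat.of M)}

/-! ### Real functions and the Euler operator in a trivialization -/

namespace Triv

variable {W : Opens (TopCat.of M)} (T : Triv p n 𝒱 𝓜 W) {U : Opens (TopCat.of M)} (hU : U ≤ W)

/-- The real functions, as sections of `𝓞`, in a trivialization. -/
noncomputable def ofFun : Csm n U →ₐ[ℝ] 𝓜.sec U :=
  (T.equiv U hU).symm.toAlgHom.comp (SmoothSec.ofFun p 𝒱)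

theorem equiv_ofFun (c : Csm n U) : T.equiv U hU (T.ofFun hU c) = SmoothSec.ofFun p 𝒱 c :=
  AlgEquiv.apply_symm_apply _ _

theorem ofFun_mem_deg (c : Csm n U) : T.ofFun hU c ∈ 𝓜.deg U 0 := by
  rw [← T.deg_iff U hU, equiv_ofFun]
  exact SmoothSec.ofFun_mem_deg c

theorem res_ofFun {U' : Opens (TopCat.of M)} (h : U' ≤ U) (c : Csm n U) :
    𝓜.res h (T.ofFun hU c) = T.ofFun (h.trans hU) (smoothRes n h c) :=
  symm_res hU h _

theorem ofFun_commute (h𝒱 : ⨆ i, 𝒱 i = ⊤) (c : Csm n U) (a : 𝓜.sec U) :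
    T.ofFun hU c * a = a * T.ofFun hU c := by
  apply (T.equiv U hU).injective
  rw [map_mul, map_mul, equiv_ofFun]
  exact SmoothSec.commute_of_mem_deg_zero h𝒱 (SmoothSec.ofFun_mem_deg c) _

/-- The Euler operator of a trivialization. -/
noncomputable def euler : 𝓜.sec U →ₗ[ℝ] 𝓜.sec U :=
  (T.equiv U hU).symm.toLinearMap ∘ₗ SmoothSec.euler p 𝒱 n (U : Opens M) ∘ₗ
    (T.equiv U hU).toLinearMap

theorem equiv_euler (a : 𝓜.sec U) :
    T.equiv U hU (T.euler hU a) = SmoothSec.euler p 𝒱 n (U : Opens M) (T.equiv U hU a) :=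
  AlgEquiv.apply_symm_apply _ _

theorem euler_mul (a b : 𝓜.sec U) :
    T.euler hU (a * b) = T.euler hU a * b + a * T.euler hU b := by
  apply (T.equiv U hU).injective
  rw [equiv_euler, map_add, map_mul (T.equiv U hU), map_mul (T.equiv U hU),
    map_mul (T.equiv U hU), equiv_euler, equiv_euler, SmoothSec.euler_mul]

theorem euler_ofFun (c : Csm n U) : T.euler hU (T.ofFun hU c) = 0 := by
  apply (T.equiv U hU).injective
  rw [equiv_euler, equiv_ofFun, SmoothSec.euler_ofFun, map_zero]

theorem euler_mem_deg {a : 𝓜.sec U} {i : 𝓘} (ha : a ∈ 𝓜.deg U i) :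
    T.euler hU a ∈ 𝓜.deg U i := by
  rw [← T.deg_iff U hU] at ha ⊢
  rw [equiv_euler]
  exact SmoothSec.euler_mem_deg ha

theorem euler_sub_memFil (h𝒱 : ⨆ i, 𝒱 i = ⊤) (h0 : 𝒱 0 = ⊥) {j : ℕ} {a : 𝓜.sec U}
    (ha : MemFil p n 𝒱 j a) : MemFil p n 𝒱 (j + 1) (T.euler hU a - (j : ℝ) • a) := by
  refine MemFil.of_triv (T := T) h𝒱 h0 hU ?_
  rw [map_sub, map_smul, equiv_euler]
  exact SmoothSec.euler_sub_mem_fil (ha.equiv_mem hU)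

theorem res_euler {U' : Opens (TopCat.of M)} (h : U' ≤ U) (a : 𝓜.sec U) :
    𝓜.res h (T.euler hU a) = T.euler (h.trans hU) (𝓜.res h a) := by
  apply (T.equiv U' (h.trans hU)).injective
  rw [equiv_euler, T.natural U hU, T.natural U hU, equiv_euler]
  rfl

end Triv

/-! ### Euler operators on a graded manifold -/

variable (p n 𝒱 𝓜) in
/-- An Euler operator: a degree-preserving derivation of `𝓞`, given on sufficiently small open
sets, which is multiplication by `j` on the `j`-th graded piece for the filtration by order. -/
structure EulerOp where
  /-- the open sets on which the operator is given -/
  good : Opens (TopCat.of M) → Prop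
  good_mono : ∀ {W W'}, good W → W' ≤ W → good W'
  exists_good : ∀ {U : Opens (TopCat.of M)} {x : M}, x ∈ U → ∃ W ≤ U, x ∈ W ∧ good W
  exists_triv : ∀ {W}, good W → Nonempty (Triv p n 𝒱 𝓜 W)
  /-- the operator -/
  op : ∀ W, 𝓜.sec W →ₗ[ℝ] 𝓜.sec W
  res_op : ∀ {W W'} (h : W' ≤ W), good W → ∀ a, 𝓜.res h (op W a) = op W' (𝓜.res h a)
  op_mul : ∀ {W}, good W → ∀ a b, op W (a * b) = op W a * b + a * op W b
  op_mem_deg : ∀ {W}, good W → ∀ {i} {a : 𝓜.sec W}, a ∈ 𝓜.deg W i → op W a ∈ 𝓜.deg W i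
  op_sub_memFil : ∀ {W}, good W → ∀ {j : ℕ} {a : 𝓜.sec W}, MemFil p n 𝒱 j a →
    MemFil p n 𝒱 (j + 1) (op W a - (j : ℝ) • a)

/-- Euler operators of trivializations can be added up by means of a partition of unity: each of
them acts as `j` on the `j`-th graded piece, and so does their weighted sum. If real functions correspond
to the sections `φ c` in all trivializations, then these are killed. -/
theorem exists_eulerOp [T2Space M] [SecondCountableTopology M] [IsManifold (𝓡 n) ∞ M]
    (h𝒱 : ⨆ i, 𝒱 i = ⊤) (h0 : 𝒱 0 = ⊥) {D : M → Opens (TopCat.of M)} (hD : ∀ x, x ∈ D x)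
    (A : ∀ x, Triv p n 𝒱 𝓜 (D x)) :
    ∃ L : EulerOp p n 𝒱 𝓜, ∀ (φ : ∀ U : Opens (TopCat.of M), Csm n U → 𝓜.sec U),
      (∀ U i (h : U ≤ D i) c, φ U c = (A i).ofFun h c) →
        ∀ W, L.good W → ∀ c, L.op W (φ W c) = 0 := by
  classical
  have : LocallyCompactSpace M := Manifold.locallyCompact_of_finiteDimensional (𝓡 n)
  obtain ⟨ρ, hρ⟩ := SmoothPartitionOfUnity.exists_isSubordinate (𝓡 n) (s := (Set.univ : Set M))
    isClosed_univ (fun x => (D x : Set M)) (fun x => (D x).isOpen)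
    (fun x _ => Set.mem_iUnion.2 ⟨x, hD x⟩)
  let r : ∀ (U : Opens (TopCat.of M)) (i : M), Csm n U := fun U i =>
    ⟨fun y => ρ i y, (ρ i).contMDiff.comp contMDiff_subtype_val⟩
  let term : ∀ (W : Opens (TopCat.of M)) (i : M), 𝓜.sec W →ₗ[ℝ] 𝓜.sec W := fun W i =>
    if h : W ≤ D i then LinearMap.mulLeft ℝ ((A i).ofFun h (r W i)) ∘ₗ (A i).euler h else 0
  -- over `W` only the functions with indices in `s` are non-zero, and their trivializations are
  -- defined on all of `W`; the terms of other indices vanish there, even if `W` is not contained in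
  -- their domains
  let Good : Opens (TopCat.of M) → Finset M → Prop := fun W s =>
    (∀ i ∈ s, W ≤ D i) ∧ ∀ i ∉ s, ∀ y ∈ W, ρ i y = 0
  have hterm : ∀ {W i} (h : W ≤ D i) a, term W i a = (A i).ofFun h (r W i) * (A i).euler h a := by
    intro W i h a
    have e : term W i =
      LinearMap.mulLeft ℝ ((A i).ofFun h (r W i)) ∘ₗ (A i).euler h := dif_pos h
    rw [e]
    rfl
  have hterm0 : ∀ {W s i}, Good W s → i ∉ s → term W i = 0 := by
    intro W s i hW hi
    by_cases h : W ≤ D i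
    · refine LinearMap.ext fun a => ?_
      have e : r W i = 0 := ContMDiffMap.ext fun y => hW.2 i hi y y.2
      rw [hterm h, e, map_zero, zero_mul]
      rfl
    · exact dif_neg h
  have hsum : ∀ {W s}, Good W s → ∑ᶠ i, term W i = ∑ i ∈ s, term W i := fun {W s} hW =>
    finsum_eq_sum_of_support_subset _ fun i hi => by
      by_contra h
      exact hi (hterm0 hW h)
  have hsum' : ∀ {W s}, Good W s → ∀ a, (∑ᶠ i, term W i) a = ∑ i ∈ s, term W i a :=
    fun {W s} hW a => by rw [hsum hW, LinearMap.sum_apply]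
  refine ⟨{ good := fun W => (∃ i, W ≤ D i) ∧ ∃ s, Good W s
            good_mono := ?_
            exists_good := ?_
            exists_triv := ?_
            op := fun W => ∑ᶠ i, term W i
            res_op := ?_
            op_mul := ?_
            op_mem_deg := ?_
            op_sub_memFil := ?_ }, ?_⟩
  · rintro W W' ⟨⟨i, hi⟩, s, hs⟩ h
    exact ⟨⟨i, h.trans hi⟩, s, fun i hi => h.trans (hs.1 i hi), fun i hi y hy =>
      hs.2 i hi y (h hy)⟩
  · intro U x hx
    obtain ⟨s, N, hN, hNs, hs⟩ := ρ.toPartitionOfUnity.exists_finset_nhds_support_subset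
      hρ.toPartitionOfUnity (fun x => (D x).isOpen) x
    obtain ⟨O, hON, hO, hxO⟩ := mem_nhds_iff.1 hN
    let O' : Opens (TopCat.of M) := ⟨O, hO⟩
    refine ⟨U ⊓ D x ⊓ O', inf_le_left.trans inf_le_left, ⟨⟨hx, hD x⟩, hxO⟩,
      ⟨x, inf_le_left.trans inf_le_right⟩, s, fun i hi y hy => ?_, fun i hi y hy => ?_⟩
    · exact Set.mem_iInter₂.1 (hNs (hON hy.2)) i hi
    · by_contra hne
      exact hi (hs y (hON hy.2) hne)
  · rintro W ⟨⟨i, hi⟩, -⟩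
    exact ⟨(A i).restrict hi⟩
  · rintro W W' h ⟨-, s, hs⟩ a
    have hs' : Good W' s := ⟨fun i hi => h.trans (hs.1 i hi), fun i hi y hy => hs.2 i hi y (h hy)⟩
    rw [hsum' hs, hsum' hs', map_sum]
    refine Finset.sum_congr rfl fun i hi => ?_
    rw [hterm (hs.1 i hi), hterm (hs'.1 i hi), map_mul, Triv.res_ofFun, Triv.res_euler]
    rfl
  · rintro W ⟨-, s, hs⟩ a b
    rw [hsum' hs, hsum' hs, hsum' hs, Finset.sum_mul, Finset.mul_sum, ← Finset.sum_add_distrib]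
    refine Finset.sum_congr rfl fun i hi => ?_
    rw [hterm (hs.1 i hi), hterm (hs.1 i hi), hterm (hs.1 i hi), Triv.euler_mul, mul_add,
      mul_assoc, ← mul_assoc a, ← (A i).ofFun_commute _ h𝒱 _ a, mul_assoc]
  · rintro W ⟨-, s, hs⟩ i a ha
    rw [hsum' hs]
    refine Submodule.sum_mem _ fun j hj => ?_
    rw [hterm (hs.1 j hj), ← zero_add i]
    exact 𝓜.mul_mem _ _ _ _ _ ((A j).ofFun_mem_deg _ _) ((A j).euler_mem_deg _ ha)
  · rintro W ⟨⟨i₀, hi₀⟩, s, hs⟩ j a ha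
    have e : (∑ᶠ i, term W i) a - (j : ℝ) • a =
        ∑ i ∈ s.attach, (A i).ofFun (hs.1 i i.2) (r W i) *
          ((A i).euler (hs.1 i i.2) a - (j : ℝ) • a) +
        (∑ i ∈ s.attach, (A i).ofFun (hs.1 i i.2) (r W i) - 1) * ((j : ℝ) • a) := by
      rw [hsum' hs, ← Finset.sum_attach, sub_mul, one_mul, Finset.sum_mul, ← add_sub_assoc,
        ← Finset.sum_add_distrib]
      congr 1
      refine Finset.sum_congr rfl fun i _ => ?_
      rw [← mul_add, sub_add_cancel, hterm]
    rw [e]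
    refine MemFil.add (MemFil.sum _ fun i _ => MemFil.mul_left
      ((A i).euler_sub_memFil _ h𝒱 h0 ha)) ?_
    -- the functions of the partition of unity, each of them read in its own trivialization, add up
    -- to `1` only modulo sections of positive order
    have h1 : MemFil p n 𝒱 1 (∑ i ∈ s.attach, (A i).ofFun (hs.1 i i.2) (r W i) - 1) := by
      intro W' T' y hy hyW'
      rw [FormalSym.mem_fil_one, map_sub, map_one, map_sum, map_sub, map_one, map_sum,
        sub_eq_zero]
      have e1 : ∀ i ∈ s.attach, FormalSym.body p 𝒱 (T'.ev W y hy hyW'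
          ((A i).ofFun (hs.1 i i.2) (r W i))) = ρ i y := by
        intro i _
        rw [Triv.body_ev_eq (T := A i) T' h𝒱 h0 hy (hs.1 i i.2 hy)]
        refine (congrArg (FormalSym.body p 𝒱) (Triv.ev_symm (hs.1 i i.2) _ hy)).trans ?_
        exact (FormalSym.body p 𝒱).commutes _
      rw [Finset.sum_congr rfl e1, Finset.sum_attach s (fun i => ρ i y)]
      refine ρ.sum_finsupport' y (Set.mem_univ y) fun i hi => ?_
      by_contra h
      exact (ρ.mem_finsupport y).1 hi (hs.2 i h y hy)
    have h2 := h1.mul (b := (j : ℝ) • a) (j := j) fun W' T' y hy hyW' => by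
      rw [map_smul]
      exact Submodule.smul_mem _ _ (ha W' T' y hy hyW')
    rwa [add_comm 1 j] at h2
  · rintro φ hφ W ⟨-, s, hs⟩ c
    change (∑ᶠ i, term W i) _ = 0
    rw [hsum' hs]
    refine Finset.sum_eq_zero fun i hi => ?_
    rw [hterm (hs.1 i hi), hφ W i (hs.1 i hi), Triv.euler_ofFun, mul_zero]

namespace EulerOp

variable (L : EulerOp p n 𝒱 𝓜)

/-- The section `b` is an eigenvector with eigenvalue `j` of an Euler operator, on all open sets on
which the operator is given. -/
def Eig (j : ℕ) {U : Opens (TopCat.of M)} (b : 𝓜.sec U) : Prop :=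
  ∀ W (hW : W ≤ U), L.good W → L.op W (𝓜.res hW b) = (j : ℝ) • 𝓜.res hW b

variable {L} {U : Opens (TopCat.of M)} {j : ℕ}

theorem Eig.res {b : 𝓜.sec U} (hb : L.Eig j b) {U' : Opens (TopCat.of M)} (h : U' ≤ U) :
    L.Eig j (𝓜.res h b) := fun W hW hg => by
  rw [𝓜.res_res]
  exact hb W _ hg

theorem Eig.sub {a b : 𝓜.sec U} (ha : L.Eig j a) (hb : L.Eig j b) : L.Eig j (a - b) :=
  fun W hW hg => by rw [map_sub, map_sub, ha W hW hg, hb W hW hg, smul_sub]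

theorem Eig.add {a b : 𝓜.sec U} (ha : L.Eig j a) (hb : L.Eig j b) : L.Eig j (a + b) :=
  fun W hW hg => by rw [map_add, map_add, ha W hW hg, hb W hW hg, smul_add]

theorem Eig.mul {i : ℕ} {a b : 𝓜.sec U} (ha : L.Eig i a) (hb : L.Eig j b) :
    L.Eig (i + j) (a * b) := fun W hW hg => by
  rw [map_mul, L.op_mul hg, ha W hW hg, hb W hW hg, smul_mul_assoc, mul_smul_comm, ← add_smul,
    Nat.cast_add]

theorem Eig.algebraMap (r : ℝ) : L.Eig 0 (algebraMap ℝ (𝓜.sec U) r) := fun W hW hg => by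
  have h := L.op_mul hg 1 1
  rw [mul_one, mul_one, one_mul, left_eq_add] at h
  rw [AlgHom.commutes, Algebra.algebraMap_eq_smul_one, map_smul, h, smul_zero, Nat.cast_zero,
    zero_smul]

theorem Eig.of_local {b : 𝓜.sec U} (h : ∀ x ∈ U, ∃ (W : Opens (TopCat.of M)) (hW : W ≤ U), x ∈ W ∧
    L.Eig j (𝓜.res hW b)) : L.Eig j b := fun W hW hg => 𝓜.eq_of_local fun x hx => by
  obtain ⟨W', hW', hxW', h'⟩ := h x (hW hx)
  have hg' := L.good_mono hg (inf_le_left : W ⊓ W' ≤ W)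
  refine ⟨W ⊓ W', inf_le_left, ⟨hx, hxW'⟩, ?_⟩
  have e := h' (W ⊓ W') inf_le_right hg'
  rw [𝓜.res_res] at e
  rw [L.res_op _ hg, map_smul, 𝓜.res_res]
  exact e

/-- On the open sets where an Euler operator is given, each class in the `j`-th graded piece has
exactly one representative with eigenvalue `j`. -/
theorem good_solution {W : Opens (TopCat.of M)} (h𝒱 : ⨆ i, 𝒱 i = ⊤) (h0 : 𝒱 0 = ⊥)
    (hg : L.good W) (j : ℕ) :
    (∀ b, MemFil p n 𝒱 (j + 1) b → L.op W b = (j : ℝ) • b → b = 0) ∧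
    ∀ a : 𝓜.sec W, MemFil p n 𝒱 j a → ∃ b, MemFil p n 𝒱 (j + 1) (b - a) ∧
      L.op W b = (j : ℝ) • b ∧ ∀ i, a ∈ 𝓜.deg W i → b ∈ 𝓜.deg W i := by
  obtain ⟨T⟩ := L.exists_triv hg
  let E := T.equiv W le_rfl
  let K : LocSec p n 𝒱 W →ₗ[ℝ] LocSec p n 𝒱 W :=
    E.toLinearMap ∘ₗ L.op W ∘ₗ E.symm.toLinearMap
  have hK : ∀ b, K (E b) = E (L.op W b) := fun b =>
    congrArg (fun z => E (L.op W z)) (E.symm_apply_apply b)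
  have hK' : ∀ f, K f = E (L.op W (E.symm f)) := fun _ => rfl
  obtain ⟨h1, h2⟩ := SmoothSec.existsUnique_eigenvector K (fun j f hf => by
    have h := L.op_sub_memFil hg (MemFil.of_triv (T := T) h𝒱 h0 le_rfl (a := E.symm f) (j := j)
      (by rwa [AlgEquiv.apply_symm_apply]))
    have h' := h.equiv_mem (T := T) le_rfl
    rw [map_sub, map_smul, AlgEquiv.apply_symm_apply] at h'
    exact h') j
  refine ⟨fun b hb hb' => ?_, fun a ha => ?_⟩
  · apply E.injective
    rw [map_zero]
    refine h1 _ (hb.equiv_mem le_rfl) ?_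
    rw [hK, hb', map_smul]
  · obtain ⟨f, hf1, hf2, hf3⟩ := h2 (E a) (ha.equiv_mem le_rfl)
    refine ⟨E.symm f, ?_, ?_, fun i hi => ?_⟩
    · refine MemFil.of_triv (T := T) h𝒱 h0 le_rfl ?_
      rwa [map_sub, AlgEquiv.apply_symm_apply]
    · apply E.injective
      rw [map_smul, AlgEquiv.apply_symm_apply, ← hK', hf2]
    · rw [← T.deg_iff W le_rfl, AlgEquiv.apply_symm_apply]
      refine hf3 i (fun h hh => ?_) ((T.deg_iff W le_rfl a i).2 hi)
      refine (T.deg_iff W le_rfl _ i).2 (L.op_mem_deg hg ?_)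
      refine (T.deg_iff W le_rfl _ i).1 ?_
      have e : T.equiv W le_rfl (E.symm.toLinearMap h) = h := E.apply_symm_apply h
      rwa [e]

theorem eq_zero_of_eig (h𝒱 : ⨆ i, 𝒱 i = ⊤) (h0 : 𝒱 0 = ⊥) {b : 𝓜.sec U}
    (hb : MemFil p n 𝒱 (j + 1) b) (hb' : L.Eig j b) : b = 0 := by
  refine 𝓜.eq_of_local fun x hx => ?_
  obtain ⟨W, hW, hxW, hg⟩ := L.exists_good hx
  refine ⟨W, hW, hxW, ?_⟩
  rw [map_zero]
  exact (good_solution h𝒱 h0 hg j).1 _ (hb.res hW) (hb' W hW hg)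

/-- Each class in the `j`-th graded piece has a representative with eigenvalue `j`, over any open
set: the local representatives are unique, so that they glue. -/
theorem exists_eig (h𝒱 : ⨆ i, 𝒱 i = ⊤) (h0 : 𝒱 0 = ⊥) {a : 𝓜.sec U}
    (ha : MemFil p n 𝒱 j a) : ∃ b, MemFil p n 𝒱 (j + 1) (b - a) ∧ L.Eig j b ∧
      ∀ i, a ∈ 𝓜.deg U i → b ∈ 𝓜.deg U i := by
  obtain ⟨b, hb⟩ := 𝓜.exists_glue (U := U) (fun W hW b =>
    MemFil p n 𝒱 (j + 1) (b - 𝓜.res hW a) ∧ L.Eig j b ∧ ∀ i, a ∈ 𝓜.deg U i → b ∈ 𝓜.deg W i)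
    (fun W hW W' h b hb => ⟨by
      have h' := hb.1.res h
      rwa [map_sub, 𝓜.res_res] at h', hb.2.1.res h,
        fun i hi => 𝓜.map_mem _ _ h i _ (hb.2.2 i hi)⟩)
    (fun W hW b b' hb hb' => by
      have h' := hb.1.sub hb'.1
      rw [sub_sub_sub_cancel_right] at h'
      exact sub_eq_zero.1 (eq_zero_of_eig h𝒱 h0 h' (hb.2.1.sub hb'.2.1)))
    (fun x hx => by
      obtain ⟨W, hW, hxW, hg⟩ := L.exists_good hx
      obtain ⟨b, hb, hb', hb''⟩ := (good_solution h𝒱 h0 hg j).2 _ (ha.res hW)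
      refine ⟨W, hW, hxW, b, hb, fun W' hW' _ => ?_, fun i hi =>
        hb'' i (𝓜.map_mem _ _ hW i _ hi)⟩
      rw [← L.res_op hW' hg, hb', map_smul])
  refine ⟨b, MemFil.of_local fun x hx => ?_, Eig.of_local fun x hx => ?_, fun i hi =>
    𝓜.mem_of_local U i b fun x hx => ?_⟩
  · obtain ⟨W, hW, hxW, h1, -⟩ := hb x hx
    exact ⟨W, hW, hxW, by rwa [map_sub]⟩
  · obtain ⟨W, hW, hxW, -, h1, -⟩ := hb x hx
    exact ⟨W, hW, hxW, h1⟩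
  · obtain ⟨W, hW, hxW, -, -, h1⟩ := hb x hx
    exact ⟨W, hW, hxW, h1 i hi⟩

/-- The body map restricts to an isomorphism from the kernel of an Euler operator to the algebra of
smooth functions; the inverse is a projection. -/
theorem exists_projection (L : EulerOp p n 𝒱 𝓜) (ε : BodyMap n 𝓜) (h𝒱 : ⨆ i, 𝒱 i = ⊤)
    (h0 : 𝒱 0 = ⊥) {D : M → Opens (TopCat.of M)} (hD : ∀ x, x ∈ D x)
    (A : ∀ x, Triv p n 𝒱 𝓜 (D x)) : Nonempty (Projection ε) := by
  have hfil : ∀ {U : Opens (TopCat.of M)} {a b : 𝓜.sec U}, ε.app U a = ε.app U b →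
      MemFil p n 𝒱 (0 + 1) (a - b) := fun {U a b} h =>
    (memFil_one_iff ε h𝒱 h0 hD A).2 (by rw [map_sub, h, sub_self])
  have huniq : ∀ (U : Opens (TopCat.of M)) (a b : 𝓜.sec U), ε.app U a = ε.app U b → L.Eig 0 a →
      L.Eig 0 b → a = b := fun U a b h ha hb =>
    sub_eq_zero.1 (eq_zero_of_eig h𝒱 h0 (hfil h) (ha.sub hb))
  have hex : ∀ (U : Opens (TopCat.of M)) (c : Csm n U), ∃ b : 𝓜.sec U,
      ε.app U b = c ∧ L.Eig 0 b ∧ b ∈ 𝓜.deg U 0 := by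
    intro U c
    obtain ⟨b, hb⟩ := 𝓜.exists_glue (U := U) (fun W hW b =>
      ε.app W b = smoothRes n hW c ∧ L.Eig 0 b ∧ b ∈ 𝓜.deg W 0)
      (fun W hW W' h b hb => ⟨by rw [ε.app_res, hb.1]; rfl, hb.2.1.res h,
        𝓜.map_mem _ _ h _ _ hb.2.2⟩)
      (fun W hW b b' hb hb' => huniq W b b' (hb.1.trans hb'.1.symm) hb.2.1 hb'.2.1)
      (fun x hx => by
        have hW : U ⊓ D x ≤ D x := inf_le_right
        have e : ε.app _ ((A x).ofFun hW (smoothRes n inf_le_left c)) =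
            smoothRes n inf_le_left c := by
          refine ContMDiffMap.ext fun y => ?_
          refine (ε.app_apply h𝒱 h0 (A x) _ y.2 y.2.2).trans ?_
          refine (congrArg (FormalSym.body p 𝒱) (Triv.ev_symm hW _ y.2)).trans ?_
          exact (FormalSym.body p 𝒱).commutes _
        obtain ⟨b, hb, hb', hb''⟩ := exists_eig (L := L) h𝒱 h0 (MemFil.zero_order
          ((A x).ofFun hW (smoothRes n inf_le_left c)))
        refine ⟨U ⊓ D x, inf_le_left, ⟨hx, hD x⟩, b, ?_, hb', hb'' 0 ((A x).ofFun_mem_deg _ _)⟩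
        rw [zero_add, memFil_one_iff ε h𝒱 h0 hD A, map_sub, e, sub_eq_zero] at hb
        exact hb)
    refine ⟨b, ContMDiffMap.ext fun y => ?_, Eig.of_local fun x hx => ?_,
      𝓜.mem_of_local U 0 b fun x hx => ?_⟩
    · obtain ⟨W, hW, hyW, h1, -⟩ := hb y y.2
      rw [ε.app_res] at h1
      exact DFunLike.congr_fun h1 (⟨y.1, hyW⟩ : (W : Opens M))
    · obtain ⟨W, hW, hxW, -, h1, -⟩ := hb x hx
      exact ⟨W, hW, hxW, h1⟩
    · obtain ⟨W, hW, hxW, -, -, h1⟩ := hb x hx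
      exact ⟨W, hW, hxW, h1⟩
  choose F hF1 hF2 hF3 using hex
  let Φ : ∀ U : Opens (TopCat.of M), Csm n U →ₐ[ℝ] 𝓜.sec U := fun U =>
    AlgHom.ofLinearMap
      { toFun := F U
        map_add' := fun c d => huniq U _ _ (by rw [map_add, hF1, hF1, hF1]) (hF2 U _)
          ((hF2 U c).add (hF2 U d))
        map_smul' := fun r c => huniq U _ _
          (by rw [RingHom.id_apply, map_smul, hF1, hF1]) (hF2 U _)
          (by
            rw [RingHom.id_apply, Algebra.smul_def]
            exact (Eig.algebraMap r).mul (hF2 U c)) }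
      (huniq U _ _ (by rw [map_one (ε.app U)]; exact hF1 U 1) (hF2 U _) (by
        have h := Eig.algebraMap (L := L) (U := U) 1
        rwa [map_one] at h))
      (fun c d => huniq U _ _ (by
        rw [map_mul (ε.app U)]
        exact (hF1 U _).trans (congrArg₂ (· * ·) (hF1 U c).symm (hF1 U d).symm)) (hF2 U _)
        ((hF2 U c).mul (hF2 U d)))
  refine ⟨⟨{ app := fun U => AlgCat.ofHom (Φ U.unop), naturality := fun U U' h => ?_ }, ?_, ?_⟩⟩
  · refine AlgCat.Hom.ext (AlgHom.ext fun c => ?_)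
    refine huniq U'.unop (F U'.unop (smoothRes n (leOfHom h.unop) c))
      (𝓜.res (leOfHom h.unop) (F U.unop c)) ?_ (hF2 _ _) ((hF2 _ _).res _)
    rw [hF1, ε.app_res]
    exact congrArg _ (hF1 U.unop c).symm
  · refine NatTrans.ext (funext fun U => AlgCat.Hom.ext (AlgHom.ext fun c => ?_))
    exact hF1 U.unop c
  · exact hF3

end EulerOp

end Euler

section Degree

variable {𝓘 : Type*} [NonUnitalCommSemiring 𝓘] {p : 𝓘 →+ ZMod 2}
variable {R : Type*} [CommRing R] {V : Type*} [AddCommGroup V] [Module R V]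
variable {𝒱 : 𝓘 → Submodule R V}

theorem Sym.lin_mem {i : 𝓘} {x : Sym p 𝒱} (hx : x ∈ Sym.component p 𝒱 1 i) :
    Sym.lin p 𝒱 x ∈ 𝒱 i := by
  induction hx using Submodule.span_induction with
  | mem x hx =>
    obtain ⟨d, v, hv, hd, rfl⟩ := hx
    rw [Fin.sum_univ_one] at hd
    subst hd
    simpa using hv 0
  | zero => rw [map_zero]; exact Submodule.zero_mem _
  | add x y _ _ hx hy => rw [map_add]; exact Submodule.add_mem _ hx hy
  | smul r x _ hx => rw [_root_.map_smul]; exact Submodule.smul_mem _ _ hx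

theorem FormalSym.lin_mem {i : 𝓘} {f : FormalSym p 𝒱} (hf : f ∈ FormalSym.deg p 𝒱 i) :
    FormalSym.lin f ∈ 𝒱 i :=
  Sym.lin_mem (FormalSym.mem_deg.1 hf 1)

end Degree

section Split

variable {𝓘 : Type*} [NonUnitalCommSemiring 𝓘] {p : 𝓘 →+ ZMod 2} {n : ℕ}
variable {M : Type u} [TopologicalSpace M] [ChartedSpace (EuclideanSpace ℝ (Fin n)) M]
variable {𝓜 : GradedRingedSpace 𝓘 (TopCat.of M)} {ε : BodyMap n 𝓜} (φ : Projection ε)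

/-! ### The modules `𝓞¹` and `𝓕` -/

namespace Projection

variable {U : Opens (TopCat.of M)}

/-- The inclusion of `𝓞¹` into `𝓞`. -/
noncomputable def val : φ.O1 U →+ 𝓜.sec U := (φ.O1 U).subtype.toAddMonoidHom

/-- A section of `𝓞¹`. -/
def mkO1 (a : 𝓜.sec U) (h : ε.app U a = 0) : φ.O1 U := ⟨a, h⟩

variable {φ}

@[simp] theorem val_mkO1 (a : 𝓜.sec U) (h : ε.app U a = 0) : φ.val (φ.mkO1 a h) = a := rfl

theorem val_smul (c : Csm n U) (a : φ.O1 U) : φ.val (c • a) = φ.app U c * φ.val a := rfl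

theorem val_resO1 {U' : Opens (TopCat.of M)} (h : U' ≤ U) (a : φ.O1 U) :
    φ.val (φ.resO1 h a) = 𝓜.res h (φ.val a) := rfl

theorem val_injective : Function.Injective (φ.val : φ.O1 U → 𝓜.sec U) := Subtype.val_injective

theorem app_val (a : φ.O1 U) : ε.app U (φ.val a) = 0 := a.2

theorem π_eq_iff {a b : φ.O1 U} : φ.π U a = φ.π U b ↔ ε.MemSq (φ.val a - φ.val b) :=
  Submodule.Quotient.eq _

theorem π_surjective (s : φ.F U) : ∃ a, φ.π U a = s := Submodule.mkQ_surjective _ s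

theorem π_mem_degF {a : φ.O1 U} {i : 𝓘} (ha : φ.val a ∈ 𝓜.deg U i) : φ.π U a ∈ φ.degF U i :=
  ⟨a, ha, rfl⟩

theorem exists_of_mem_degF {s : φ.F U} {i : 𝓘} (hs : s ∈ φ.degF U i) :
    ∃ a, φ.val a ∈ 𝓜.deg U i ∧ φ.π U a = s := hs

theorem app_app (c : Csm n U) : ε.app U (φ.app U c) = c :=
  congrArg (fun F : smoothFunctions n M ⟶ smoothFunctions n M => (F.app (op U)).hom c) φ.hom_comp

/-- A splitting makes `𝓕` a direct summand of the sheaf `𝓞¹`, so that no sheafification is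
needed. -/
theorem isSheaf_presheafF (h : φ.IsSplit) : φ.presheafF.IsSheaf := by
  obtain ⟨σ, hσ, hres, -⟩ := h
  rw [TopCat.Presheaf.isSheaf_iff_isSheafUniqueGluing]
  intro ι U
  change ∀ s : (∀ i, φ.F (U i)), _ → _
  intro s hs
  have hs' : ∀ i j, φ.resF (inf_le_left : U i ⊓ U j ≤ U i) (s i) =
      φ.resF (inf_le_right : U i ⊓ U j ≤ U j) (s j) := hs
  obtain ⟨a, ha, -⟩ := 𝓜.sheaf.existsUnique_gluing U (fun i => φ.val (σ (U i) (s i)))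
    fun i j => by
      change 𝓜.res inf_le_left _ = 𝓜.res inf_le_right _
      rw [← val_resO1, ← val_resO1, hres, hres, hs']
  have ha' : ∀ i, 𝓜.res (le_iSup U i) a = φ.val (σ (U i) (s i)) := ha
  have ha1 : ε.app _ a = 0 := by
    refine ContMDiffMap.ext fun y => ?_
    obtain ⟨i, hi⟩ := Opens.mem_iSup.1 y.2
    have e := congrArg (ε.app (U i)) (ha' i)
    rw [app_val, ε.app_res] at e
    exact DFunLike.congr_fun e (⟨y.1, hi⟩ : (U i : Opens M))
  refine ⟨φ.π _ (φ.mkO1 a ha1), fun i => ?_, fun t ht => ?_⟩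
  · change φ.resF (le_iSup U i) (φ.π _ (φ.mkO1 a ha1)) = s i
    have e : φ.resO1 (le_iSup U i) (φ.mkO1 a ha1) = σ (U i) (s i) := val_injective (ha' i)
    rw [resF_π, e, hσ]
  · obtain ⟨b, rfl⟩ := π_surjective t
    refine π_eq_iff.2 fun x hx => ?_
    obtain ⟨i, hi⟩ := Opens.mem_iSup.1 hx
    have e : φ.resF (le_iSup U i) (φ.π _ b) = s i := ht i
    rw [← hσ (U i) (s i), resF_π, π_eq_iff] at e
    obtain ⟨W, hW, hxW, h⟩ := e x hi
    refine ⟨W, hW.trans (le_iSup U i), hxW, ?_⟩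
    rw [val_resO1, map_sub, 𝓜.res_res] at h
    rw [map_sub, val_mkO1]
    have e2 := congrArg (𝓜.res hW) (ha' i)
    rw [𝓜.res_res] at e2
    rwa [e2]

end Projection

variable {V : Type*} [AddCommGroup V] [Module ℝ V] [FiniteDimensional ℝ V]
variable {𝒱 : 𝓘 → Submodule ℝ V}

/-- The eigenvectors with eigenvalue `1` of an Euler operator which is linear over smooth functions
form a complement of `𝓞²` in `𝓞¹`. -/
theorem EulerOp.isSplit (L : EulerOp p n 𝒱 𝓜) (hL : ∀ W, L.good W → ∀ c, L.op W (φ.app W c) = 0)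
    (h𝒱 : ⨆ i, 𝒱 i = ⊤) (h0 : 𝒱 0 = ⊥) {D : M → Opens (TopCat.of M)} (hD : ∀ x, x ∈ D x)
    (A : ∀ x, Triv p n 𝒱 𝓜 (D x)) : φ.IsSplit := by
  have h1 : ∀ {U : Opens (TopCat.of M)} (a : φ.O1 U), MemFil p n 𝒱 1 (φ.val a) := fun a =>
    (memFil_one_iff ε h𝒱 h0 hD A).2 (Projection.app_val a)
  have hφ : ∀ (U : Opens (TopCat.of M)) (c : Csm n U), L.Eig 0 (φ.app U c) :=
    fun U c W hW hg => by
      rw [← φ.app_res, hL W hg, Nat.cast_zero, zero_smul]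
  have huniq : ∀ {U : Opens (TopCat.of M)} {a b : φ.O1 U}, φ.π U a = φ.π U b →
      L.Eig 1 (φ.val a) → L.Eig 1 (φ.val b) → a = b := fun {U a b} h ha hb =>
    Projection.val_injective (sub_eq_zero.1 (eq_zero_of_eig h𝒱 h0
      ((memFil_two_iff ε h𝒱 h0 hD A).2 (Projection.π_eq_iff.1 h)) (ha.sub hb)))
  have hex : ∀ (U : Opens (TopCat.of M)) (a : φ.O1 U), ∃ b : φ.O1 U, φ.π U b = φ.π U a ∧
      L.Eig 1 (φ.val b) ∧ ∀ i, φ.val a ∈ 𝓜.deg U i → φ.val b ∈ 𝓜.deg U i := fun U a => by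
    obtain ⟨b, hb, hb', hb''⟩ := exists_eig (L := L) h𝒱 h0 (h1 a)
    have h2 := (hb.anti one_le_two).add (h1 a)
    rw [sub_add_cancel, memFil_one_iff ε h𝒱 h0 hD A] at h2
    exact ⟨φ.mkO1 b h2, Projection.π_eq_iff.2 ((memFil_two_iff ε h𝒱 h0 hD A).1 hb), hb', hb''⟩
  have hex' : ∀ (U : Opens (TopCat.of M)) (s : φ.F U), ∃ b : φ.O1 U, φ.π U b = s ∧
      L.Eig 1 (φ.val b) := fun U s => by
    obtain ⟨a, rfl⟩ := Projection.π_surjective s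
    obtain ⟨b, hb, hb', -⟩ := hex U a
    exact ⟨b, hb, hb'⟩
  choose S hS hS' using hex'
  refine ⟨fun U =>
    { toFun := S U
      map_add' := fun s t => huniq (by rw [map_add, hS, hS, hS]) (hS' U _) (by
        rw [map_add]
        exact (hS' U s).add (hS' U t))
      map_smul' := fun c s => huniq (by rw [RingHom.id_apply, map_smul, hS, hS]) (hS' U _) (by
        rw [RingHom.id_apply, Projection.val_smul]
        have h := (hφ U c).mul (hS' U s)
        rwa [zero_add] at h) }, hS, fun U W h s => ?_, fun U i s hs => ?_⟩
  · refine huniq ?_ ((hS' U s).res h) (hS' W _)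
    change φ.π W (φ.resO1 h (S U s)) = φ.π W (S W _)
    rw [← φ.resF_π, hS, hS]
  · obtain ⟨a, ha, rfl⟩ := Projection.exists_of_mem_degF hs
    obtain ⟨b, hb, hb', hb''⟩ := hex U a
    have e : S U (φ.π U a) = b := huniq ((hS U _).trans hb.symm) (hS' U _) hb'
    change φ.val (S U (φ.π U a)) ∈ 𝓜.deg U i
    rw [e]
    exact hb'' i ha

/-! ### Trivializations adapted to a projection and to a splitting -/

namespace Triv

variable {W : Opens (TopCat.of M)}

/-- A trivialization can be changed so that real functions correspond to a given projection and the
linear coordinates to given homogeneous sections with the same linear parts. -/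
theorem exists_change (h𝒱 : ⨆ i, 𝒱 i = ⊤) (h0 : 𝒱 0 = ⊥) (T : Triv p n 𝒱 𝓜 W)
    (ξ : V →ₗ[ℝ] 𝓜.sec W) (hξ : ∀ i, ∀ v ∈ 𝒱 i, ξ v ∈ 𝓜.deg W i)
    (hξ' : ∀ v, T.equiv W le_rfl (ξ v) - SmoothSec.const n _ (FormalSym.ι p 𝒱 v) ∈
      SmoothSec.fil p 𝒱 n (W : Opens M) 2) :
    ∃ T' : Triv p n 𝒱 𝓜 W, (∀ U (hU : U ≤ W) c, T'.ofFun hU c = φ.app U c) ∧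
      ∀ v, T'.equiv W le_rfl (ξ v) = SmoothSec.const n _ (FormalSym.ι p 𝒱 v) := by
  let φT : ∀ U (hU : U ≤ W), Csm n U →ₐ[ℝ] LocSec p n 𝒱 U := fun U hU =>
    (T.equiv U hU).toAlgHom.comp (φ.app U)
  let ξT : ∀ U (hU : U ≤ W), V →ₗ[ℝ] LocSec p n 𝒱 U := fun U hU =>
    (T.equiv U hU).toLinearMap ∘ₗ (𝓜.res hU).toLinearMap ∘ₗ ξ
  have hφT : ∀ U (hU : U ≤ W) c, φT U hU c = T.equiv U hU (φ.app U c) := fun _ _ _ => rfl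
  have hξT : ∀ U (hU : U ≤ W) v, ξT U hU v = T.equiv U hU (𝓜.res hU (ξ v)) := fun _ _ _ => rfl
  have key : ∀ U (hU : U ≤ W), ∃ Φ : LocSec p n 𝒱 U ≃ₐ[ℝ] LocSec p n 𝒱 U,
      (∀ c, Φ (SmoothSec.ofFun p 𝒱 c) = φT U hU c) ∧
      (∀ v, Φ (SmoothSec.const n _ (FormalSym.ι p 𝒱 v)) = ξT U hU v) ∧
      (∀ i f, Φ f ∈ SmoothSec.deg p 𝒱 n (U : Opens M) i ↔
        f ∈ SmoothSec.deg p 𝒱 n (U : Opens M) i) ∧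
      ∀ j, ∀ f ∈ SmoothSec.fil p 𝒱 n (U : Opens M) j,
        Φ f - f ∈ SmoothSec.fil p 𝒱 n (U : Opens M) (j + 1) := fun U hU => by
    refine SmoothSec.exists_change_of_generators h𝒱 (φT U hU) (fun c => ?_) (fun c => ?_)
      (ξT U hU) (fun i v hv => ?_) (fun v => ?_)
    · rw [hφT, T.deg_iff U hU]
      exact φ.map_deg U c
    · rw [SmoothSec.mem_fil_one, map_sub, sub_eq_zero]
      refine ContMDiffMap.ext fun y => ?_
      have e : FormalSym.body p 𝒱 ((T.equiv U hU (φ.app U c)).1 y) = c y := by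
        rw [equiv_apply, ← ε.app_apply h𝒱 h0 T (φ.app U c) y.2 (hU y.2), Projection.app_app]
      exact e.trans ((FormalSym.body p 𝒱).commutes _).symm
    · rw [hξT, T.deg_iff U hU]
      exact 𝓜.map_mem _ _ hU i _ (hξ i v hv)
    · intro y
      rw [hξT, T.natural W le_rfl]
      exact hξ' v ⟨y.1, hU y.2⟩
  choose Φ hΦφ hΦξ hΦd hΦf using key
  have hΦf' : ∀ U (hU : U ≤ W) j, ∀ f ∈ SmoothSec.fil p 𝒱 n (U : Opens M) j,
      Φ U hU f ∈ SmoothSec.fil p 𝒱 n (U : Opens M) j := fun U hU j f hf => by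
    have h := Submodule.add_mem _ (SmoothSec.fil_anti (Nat.le_succ j) (hΦf U hU j f hf)) hf
    rwa [sub_add_cancel] at h
  -- the automorphisms are compatible with restrictions, as they are determined by their values on
  -- real functions and on the coordinates
  have hnat : ∀ U (hU : U ≤ W) U' (h : U' ≤ U) f,
      Φ U' (h.trans hU) (SmoothSec.res p 𝒱 h f) = SmoothSec.res p 𝒱 h (Φ U hU f) := by
    intro U hU U' h f
    refine SmoothSec.ext fun y => ?_
    have e := SmoothSec.ringHom_ext
      (Φ := (((SmoothSec.eval y).comp (Φ U' (h.trans hU)).toAlgHom).comp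
        (SmoothSec.res p 𝒱 h)).toRingHom)
      (Ψ := ((SmoothSec.eval (⟨y.1, h y.2⟩ : (U : Opens M))).comp (Φ U hU).toAlgHom).toRingHom)
      (fun j f hf => hΦf' U' (h.trans hU) j _ (fun z => hf _) y)
      (fun j f hf => hΦf' U hU j _ hf _)
      (fun c => by
        have e1 := hΦφ U' (h.trans hU) (smoothRes n h c)
        rw [hφT, φ.app_res, T.natural U hU] at e1
        have e2 := congrArg (fun g => g.1 y) e1
        refine Eq.trans e2 ?_
        exact congrArg (fun g => g.1 (⟨y.1, h y.2⟩ : (U : Opens M))) (hΦφ U hU c).symm)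
      (fun v => by
        have e1 := hΦξ U' (h.trans hU) v
        rw [hξT, ← 𝓜.res_res hU h, T.natural U hU] at e1
        have e2 := congrArg (fun g => g.1 y) e1
        refine Eq.trans e2 ?_
        exact congrArg (fun g => g.1 (⟨y.1, h y.2⟩ : (U : Opens M))) (hΦξ U hU v).symm)
    exact DFunLike.congr_fun e f
  refine ⟨{ equiv := fun U hU => (T.equiv U hU).trans (Φ U hU).symm
            natural := fun U hU U' h a => ?_
            deg_iff := fun U hU a i => ?_ }, fun U hU c => ?_, fun v => ?_⟩
  · change (Φ U' (h.trans hU)).symm (T.equiv U' _ (𝓜.res h a)) =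
      SmoothSec.res p 𝒱 h ((Φ U hU).symm (T.equiv U hU a))
    rw [AlgEquiv.symm_apply_eq, hnat U hU, AlgEquiv.apply_symm_apply, T.natural U hU]
  · change (Φ U hU).symm (T.equiv U hU a) ∈ _ ↔ _
    rw [← T.deg_iff U hU, ← hΦd U hU i ((Φ U hU).symm (T.equiv U hU a)),
      AlgEquiv.apply_symm_apply]
  · change (T.equiv U hU).symm (Φ U hU (SmoothSec.ofFun p 𝒱 c)) = φ.app U c
    rw [hΦφ, AlgEquiv.symm_apply_eq, hφT]
  · change (Φ W le_rfl).symm (T.equiv W le_rfl (ξ v)) = _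
    rw [AlgEquiv.symm_apply_eq, hΦξ, hξT, 𝓜.res_self]

/-- Real functions can be made to correspond to a given projection. -/
theorem exists_change_ofFun (h𝒱 : ⨆ i, 𝒱 i = ⊤) (h0 : 𝒱 0 = ⊥) (T : Triv p n 𝒱 𝓜 W) :
    ∃ T' : Triv p n 𝒱 𝓜 W, ∀ U (hU : U ≤ W) c, T'.ofFun hU c = φ.app U c := by
  let ξ : V →ₗ[ℝ] 𝓜.sec W := (T.equiv W le_rfl).symm.toLinearMap ∘ₗ
    (SmoothSec.const n (W : Opens M)).toLinearMap ∘ₗ FormalSym.ι p 𝒱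
  have hξ : ∀ v, T.equiv W le_rfl (ξ v) = SmoothSec.const n _ (FormalSym.ι p 𝒱 v) := fun v =>
    AlgEquiv.apply_symm_apply _ _
  obtain ⟨T', hT', -⟩ := exists_change φ h𝒱 h0 T ξ
    (fun i v hv => by
      rw [← T.deg_iff W le_rfl, hξ]
      exact fun _ => FormalSym.ι_mem_deg hv)
    (fun v => by
      rw [hξ, sub_self]
      exact Submodule.zero_mem _)
  exact ⟨T', hT'⟩

/-- The homogeneous linear coordinates can be made to correspond to the sections of `𝓞¹` given by a
splitting. -/
theorem exists_adapted (h𝒱 : ⨆ i, 𝒱 i = ⊤) (h0 : 𝒱 0 = ⊥) {D : M → Opens (TopCat.of M)}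
    (hD : ∀ x, x ∈ D x) (A : ∀ x, Triv p n 𝒱 𝓜 (D x))
    (σ : ∀ U : Opens (TopCat.of M), φ.F U →ₗ[Csm n U] φ.O1 U) (hσ : ∀ U s, φ.π U (σ U s) = s)
    (hres : ∀ (U U' : Opens (TopCat.of M)) (h : U' ≤ U) (s : φ.F U),
      φ.resO1 h (σ U s) = σ U' (φ.resF h s))
    (hdeg : ∀ U i, ∀ s ∈ φ.degF U i, φ.val (σ U s) ∈ 𝓜.deg U i) (T : Triv p n 𝒱 𝓜 W) :
    ∃ T' : Triv p n 𝒱 𝓜 W, (∀ U (hU : U ≤ W) c, T'.ofFun hU c = φ.app U c) ∧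
      ∀ U, U ≤ W → ∀ (a : φ.O1 U) y (hy : y ∈ U) (hyW : y ∈ W),
        T'.ev U y hy hyW (φ.val (σ U (φ.π U a))) =
          FormalSym.ι p 𝒱 (FormalSym.lin (T'.ev U y hy hyW (φ.val a))) := by
  -- the sections of `𝓞¹` given by the coordinates of `T`, and their images under the splitting
  have hε : ∀ v, ε.app W ((T.equiv W le_rfl).symm
      (SmoothSec.const n _ (FormalSym.ι p 𝒱 v))) = 0 := fun v => by
    refine ContMDiffMap.ext fun y => ?_
    refine (ε.app_apply h𝒱 h0 T _ y.2 y.2).trans ?_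
    refine (congrArg (FormalSym.body p 𝒱) (Triv.ev_symm le_rfl _ y.2)).trans ?_
    exact FormalSym.body_ι v
  let ℓ : V → φ.O1 W := fun v => φ.mkO1 _ (hε v)
  have hℓ : ∀ v, φ.val (ℓ v) = (T.equiv W le_rfl).symm
      (SmoothSec.const n _ (FormalSym.ι p 𝒱 v)) := fun v => rfl
  have hℓadd : ∀ v w, ℓ (v + w) = ℓ v + ℓ w := fun v w => Projection.val_injective (by
    rw [map_add, hℓ, hℓ, hℓ, map_add, map_add, map_add])
  have hℓsmul : ∀ (r : ℝ) v, ℓ (r • v) = algebraMap ℝ (Csm n W) r • ℓ v := fun r v =>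
    Projection.val_injective (by
      rw [Projection.val_smul, hℓ, hℓ, map_smul, map_smul, map_smul, AlgHom.commutes,
        ← Algebra.smul_def])
  let ξ : V →ₗ[ℝ] 𝓜.sec W :=
    { toFun := fun v => φ.val (σ W (φ.π W (ℓ v)))
      map_add' := fun v w => by rw [hℓadd, map_add, map_add, map_add]
      map_smul' := fun r v => by
        rw [hℓsmul, map_smul, map_smul, Projection.val_smul, AlgHom.commutes, ← Algebra.smul_def]
        rfl }
  have hξ : ∀ v, ξ v = φ.val (σ W (φ.π W (ℓ v))) := fun _ => rfl
  obtain ⟨T', hT', hT'ξ⟩ := exists_change φ h𝒱 h0 T ξ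
    (fun i v hv => hdeg W i _ (Projection.π_mem_degF (by
      rw [hℓ, ← T.deg_iff W le_rfl, AlgEquiv.apply_symm_apply]
      exact fun _ => FormalSym.ι_mem_deg hv)))
    (fun v => by
      have h := (memFil_two_iff ε h𝒱 h0 hD A).2 (Projection.π_eq_iff.1 (hσ W (φ.π W (ℓ v))))
      have h' := h.equiv_mem (T := T) le_rfl
      rwa [map_sub, hℓ, AlgEquiv.apply_symm_apply, ← hξ] at h')
  refine ⟨T', hT', fun U hU a y hy hyW => ?_⟩
  let b := Module.finBasis ℝ V
  have hsm : ∀ (v : Module.Dual ℝ V), ContMDiff (𝓡 n) 𝓘(ℝ) ∞ fun z : (U : Opens M) =>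
      v (FormalSym.lin ((T'.equiv U hU (φ.val a)).1 z)) := fun v z =>
    ((T'.equiv U hU (φ.val a)).2 z).lin v
  let c : Fin (Module.finrank ℝ V) → Csm n U := fun j => ⟨_, hsm (b.coord j)⟩
  -- the section with the same linear part which is a combination of the new coordinates
  let a' : φ.O1 U := ∑ j, c j • φ.resO1 hU (σ W (φ.π W (ℓ (b j))))
  have ha' : ∀ z (hz : z ∈ U), T'.ev U z hz (hU hz) (φ.val a') =
      FormalSym.ι p 𝒱 (FormalSym.lin (T'.ev U z hz (hU hz) (φ.val a))) := by
    intro z hz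
    rw [map_sum, map_sum]
    have e : ∀ j, T'.ev U z hz (hU hz)
        (φ.val (c j • φ.resO1 hU (σ W (φ.π W (ℓ (b j)))))) =
        FormalSym.ι p 𝒱 (b.repr (FormalSym.lin (T'.ev U z hz (hU hz) (φ.val a))) j • b j) := by
      intro j
      rw [Projection.val_smul, ← hT' U hU, map_mul, Projection.val_resO1, ev_res, ← hξ,
        map_smul, ← equiv_apply hU _ ⟨z, hz⟩, equiv_ofFun,
        ← equiv_apply le_rfl (ξ (b j)) ⟨z, hU hz⟩, hT'ξ, Algebra.smul_def]
      rw [← equiv_apply hU _ ⟨z, hz⟩]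
      rfl
    rw [Finset.sum_congr rfl fun j _ => e j, ← map_sum, b.sum_repr]
  -- `𝓕` only sees the linear part
  have hπ : φ.π U a' = φ.π U a := by
    rw [Projection.π_eq_iff, ← memFil_two_iff ε h𝒱 h0 hD A]
    refine MemFil.of_triv (T := T') h𝒱 h0 hU fun z => ?_
    have h1 : ∀ x : φ.O1 U, T'.ev U z z.2 (hU z.2) (φ.val x) ∈ FormalSym.fil p 𝒱 1 := fun x => by
      rw [FormalSym.mem_fil_one, ← ε.app_apply h𝒱 h0 T' (φ.val x) z.2 (hU z.2),
        Projection.app_val]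
      rfl
    rw [equiv_apply, map_sub]
    refine FormalSym.mem_fil_two (Submodule.sub_mem _ (h1 _) (h1 _)) ?_
    rw [map_sub, ha', FormalSym.lin_ι, sub_self]
  have hσa' : σ U (φ.π U a') = a' := by
    rw [map_sum, map_sum]
    refine Finset.sum_congr rfl fun j _ => ?_
    rw [map_smul, map_smul, ← φ.resF_π, hσ, hres]
  rw [← hπ, hσa']
  exact ha' y hy

end Triv

end Split

section LinearAtlas

variable {𝓘 : Type*} [NonUnitalCommSemiring 𝓘] {p : 𝓘 →+ ZMod 2} {n : ℕ}
variable {M : Type u} [TopologicalSpace M] [ChartedSpace (EuclideanSpace ℝ (Fin n)) M]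
variable {𝓜 : GradedRingedSpace 𝓘 (TopCat.of M)} {ε : BodyMap n 𝓜} (φ : Projection ε)
variable {V : Type*} [AddCommGroup V] [Module ℝ V] [FiniteDimensional ℝ V]
variable {𝒱 : 𝓘 → Submodule ℝ V}

/-! ### Linear transition maps -/

namespace Triv

variable {W W' : Opens (TopCat.of M)} (T : Triv p n 𝒱 𝓜 W) (T' : Triv p n 𝒱 𝓜 W')

/-- The section of `𝓞` given by a vector, which is constant in a trivialization. -/
noncomputable def coord : V →ₗ[ℝ] 𝓜.sec W :=
  (T.equiv W le_rfl).symm.toLinearMap ∘ₗ (SmoothSec.const n (W : Opens M)).toLinearMap ∘ₗ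
    FormalSym.ι p 𝒱

theorem equiv_coord (v : V) :
    T.equiv W le_rfl (T.coord v) = SmoothSec.const n _ (FormalSym.ι p 𝒱 v) :=
  AlgEquiv.apply_symm_apply _ _

theorem ev_coord (v : V) {y : M} (hy : y ∈ W) : T.ev W y hy hy (T.coord v) = FormalSym.ι p 𝒱 v :=
  ev_symm le_rfl _ hy

theorem coord_mem_deg {v : V} {i : 𝓘} (hv : v ∈ 𝒱 i) : T.coord v ∈ 𝓜.deg W i := by
  rw [← T.deg_iff W le_rfl, equiv_coord]
  exact fun _ => FormalSym.ι_mem_deg hv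

theorem app_coord (h𝒱 : ⨆ i, 𝒱 i = ⊤) (h0 : 𝒱 0 = ⊥) (v : V) : ε.app W (T.coord v) = 0 := by
  refine ContMDiffMap.ext fun y => ?_
  refine (ε.app_apply h𝒱 h0 T _ y.2 y.2).trans ?_
  rw [ev_coord]
  exact FormalSym.body_ι v

/-- The linear part at a point of the change of trivialization from `T'` to `T`. -/
noncomputable def trans (y : M) (hy : y ∈ W) (hy' : y ∈ W') : V →ₗ[ℝ] V :=
  FormalSym.lin ∘ₗ (T.ev W' y hy' hy).toLinearMap ∘ₗ T'.coord

theorem trans_apply (y : M) (hy : y ∈ W) (hy' : y ∈ W') (v : V) :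
    T.trans T' y hy hy' v = FormalSym.lin (T.ev W' y hy' hy (T'.coord v)) := rfl

theorem trans_mem {y : M} (hy : y ∈ W) (hy' : y ∈ W') (i : 𝓘) (v : V) (hv : v ∈ 𝒱 i) :
    T.trans T' y hy hy' v ∈ 𝒱 i :=
  FormalSym.lin_mem (ev_mem_deg (T'.coord_mem_deg hv) hy' hy)

theorem trans_self {y : M} (hy : y ∈ W) (v : V) : T.trans T y hy hy v = v := by
  rw [trans_apply, ev_coord, FormalSym.lin_ι]

end Triv

variable (p 𝒱) in
/-- An atlas of trivializations which are compatible with a projection and whose transition maps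
are linear, that is, induced by automorphisms of the graded vector space `V`. -/
structure LinearAtlas where
  /-- the domain of the trivialization around a point -/
  dom : M → Opens (TopCat.of M)
  mem_dom : ∀ x, x ∈ dom x
  /-- the trivialization around a point -/
  triv : ∀ x, Triv p n 𝒱 𝓜 (dom x)
  ofFun_eq : ∀ x U (hU : U ≤ dom x) c, (triv x).ofFun hU c = φ.app U c
  ev_eq : ∀ (z w : M) (U : Opens (TopCat.of M)) (y : M) (hy : y ∈ U) (hz : y ∈ dom z)
    (hw : y ∈ dom w) (a : 𝓜.sec U), (triv z).ev U y hy hz a =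
      FormalSym.map p ((triv z).trans (triv w) y hz hw) ((triv z).trans_mem (triv w) hz hw)
        ((triv w).ev U y hy hw a)

/-- Trivializations which are adapted to a projection and to a splitting have linear transition
maps, because a degree-preserving homomorphism is determined by its values on real functions and on
coordinates. -/
theorem Projection.IsSplit.exists_linearAtlas (h : φ.IsSplit) (h𝒱 : ⨆ i, 𝒱 i = ⊤)
    (h0 : 𝒱 0 = ⊥) {D : M → Opens (TopCat.of M)} (hD : ∀ x, x ∈ D x)
    (A : ∀ x, Triv p n 𝒱 𝓜 (D x)) : Nonempty (LinearAtlas p φ 𝒱) := by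
  obtain ⟨σ, hσ, hres, hdeg⟩ := h
  choose T hT hTσ using fun x => Triv.exists_adapted φ h𝒱 h0 hD A σ hσ hres hdeg (A x)
  refine ⟨⟨D, hD, T, hT, fun z w U y hy hz hw a => ?_⟩⟩
  have hev : ∀ x (U : Opens (TopCat.of M)) (hU : U ≤ D x) c y (hy : y ∈ U),
      (T x).ev U y hy (hU hy) (φ.app U c) = algebraMap ℝ _ (c ⟨y, hy⟩) := fun x U hU c y hy => by
    rw [← hT x U hU]
    exact Triv.ev_symm hU _ hy
  let U' : Opens (TopCat.of M) := U ⊓ (D z ⊓ D w)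
  have hyU' : y ∈ U' := ⟨hy, hz, hw⟩
  have hU'z : U' ≤ D z := inf_le_right.trans inf_le_left
  have hU'w : U' ≤ D w := inf_le_right.trans inf_le_right
  have hU' : U' ≤ U := inf_le_left
  have key := SmoothSec.ringHom_ext
    (Φ := (((T z).ev U' y hyU' hz).comp ((T w).equiv U' hU'w).symm.toAlgHom).toRingHom)
    (Ψ := (FormalSym.map p ((T z).trans (T w) y hz hw) ((T z).trans_mem (T w) hz hw)).comp
      (SmoothSec.eval (⟨y, hyU'⟩ : (U' : Opens M))).toRingHom)
    (fun j f hf => MemFil.of_triv (T := T w) h𝒱 h0 hU'w (a := ((T w).equiv U' hU'w).symm f)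
      (by rwa [AlgEquiv.apply_symm_apply]) _ (T z) y hyU' hz)
    (fun j f hf => FormalSym.map_mem_fil _ _ (hf _))
    (fun c => by
      have e1 : (T z).ev U' y hyU' hz ((T w).ofFun hU'w c) = algebraMap ℝ _ (c ⟨y, hyU'⟩) := by
        rw [hT w, hev z U' hU'z]
      refine Eq.trans e1 (Eq.symm ?_)
      exact FormalSym.map_algebraMap p _ _ _)
    (fun v => by
      have hv : ε.app U' (𝓜.res hU'w ((T w).coord v)) = 0 := by
        rw [ε.app_res, Triv.app_coord _ h𝒱 h0, map_zero]
      -- the coordinates of `T w` are values of the splitting, so they are linear in `T z` as well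
      let b : φ.O1 U' := φ.mkO1 _ hv
      have hb : φ.val (σ U' (φ.π U' b)) = φ.val b := by
        refine Triv.ext_ev (T := T w) hU'w fun x hx => ?_
        rw [hTσ w U' hU'w, Projection.val_mkO1, Triv.ev_res, Triv.ev_coord, FormalSym.lin_ι]
      have e1 := hTσ z U' hU'z b y hyU' hz
      rw [hb, Projection.val_mkO1, Triv.ev_res, ← Triv.trans_apply] at e1
      have e2 : ((T w).equiv U' hU'w).symm (SmoothSec.const n _ (FormalSym.ι p 𝒱 v)) =
          𝓜.res hU'w ((T w).coord v) := by
        rw [AlgEquiv.symm_apply_eq, (T w).natural (D w) le_rfl, Triv.equiv_coord]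
        rfl
      change (T z).ev U' y hyU' hz (((T w).equiv U' hU'w).symm _) = FormalSym.map p _ _ _
      rw [e2, Triv.ev_res, e1]
      exact (FormalSym.map_ι _ _ v).symm)
  have e := DFunLike.congr_fun key ((T w).equiv U' hU'w (𝓜.res hU' a))
  have e1 : (T z).ev U' y hyU' hz
      (((T w).equiv U' hU'w).symm ((T w).equiv U' hU'w (𝓜.res hU' a))) =
      FormalSym.map p ((T z).trans (T w) y hz hw) ((T z).trans_mem (T w) hz hw)
        (((T w).equiv U' hU'w (𝓜.res hU' a)).1 ⟨y, hyU'⟩) := e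
  rwa [AlgEquiv.symm_apply_apply, Triv.equiv_apply, Triv.ev_res, Triv.ev_res] at e1

namespace LinearAtlas

variable {φ} (B : LinearAtlas p φ 𝒱)

theorem ev_app (x : M) {U : Opens (TopCat.of M)} (c : Csm n U) {y : M} (hy : y ∈ U)
    (hx : y ∈ B.dom x) : (B.triv x).ev U y hy hx (φ.app U c) = algebraMap ℝ _ (c ⟨y, hy⟩) := by
  have hyU : y ∈ U ⊓ B.dom x := ⟨hy, hx⟩
  have e := Triv.ev_res (T := B.triv x) (inf_le_left : U ⊓ B.dom x ≤ U) hyU hx (φ.app U c)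
  rw [← φ.app_res, ← B.ofFun_eq x _ inf_le_right] at e
  rw [← e]
  exact Triv.ev_symm (T := B.triv x) inf_le_right _ hyU

/-- The cocycle condition for the transition maps. -/
theorem trans_trans (x z w : M) {y : M} (hx : y ∈ B.dom x) (hz : y ∈ B.dom z) (hw : y ∈ B.dom w)
    (v : V) : (B.triv x).trans (B.triv w) y hx hw v =
      (B.triv x).trans (B.triv z) y hx hz ((B.triv z).trans (B.triv w) y hz hw v) := by
  rw [Triv.trans_apply, B.ev_eq x z _ _ hw hx hz, FormalSym.lin_map, ← Triv.trans_apply]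

/-- The sections that agree at all points in all trivializations are equal. -/
theorem ext_ev {U : Opens (TopCat.of M)} {a b : 𝓜.sec U}
    (h : ∀ y (hy : y ∈ U), (B.triv y).ev U y hy (B.mem_dom y) a =
      (B.triv y).ev U y hy (B.mem_dom y) b) : a = b := by
  refine 𝓜.eq_of_local fun x hx => ⟨U ⊓ B.dom x, inf_le_left, ⟨hx, B.mem_dom x⟩, ?_⟩
  refine Triv.ext_ev (T := B.triv x) inf_le_right fun y hy => ?_
  rw [Triv.ev_res, Triv.ev_res, B.ev_eq x y U y hy.1 hy.2 (B.mem_dom y),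
    B.ev_eq x y U y hy.1 hy.2 (B.mem_dom y), h]

/-- A family of values that is smooth in local trivializations comes from a section. -/
theorem exists_section {U : Opens (TopCat.of M)} (f : ∀ y, y ∈ U → FormalSym p 𝒱)
    (hf : ∀ x ∈ U, ∃ (W : Opens (TopCat.of M)) (_ : W ≤ U) (hD : W ≤ B.dom x) (g : LocSec p n 𝒱 W),
      x ∈ W ∧ ∀ y (hy : y ∈ U) (hyW : y ∈ W), g.1 ⟨y, hyW⟩ =
        FormalSym.map p ((B.triv x).trans (B.triv y) y (hD hyW) (B.mem_dom y))
          ((B.triv x).trans_mem (B.triv y) (hD hyW) (B.mem_dom y)) (f y hy)) :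
    ∃ a : 𝓜.sec U, ∀ y (hy : y ∈ U), (B.triv y).ev U y hy (B.mem_dom y) a = f y hy := by
  obtain ⟨a, ha⟩ := 𝓜.exists_glue (U := U) (fun W hW b => ∀ y (hy : y ∈ W),
      (B.triv y).ev W y hy (B.mem_dom y) b = f y (hW hy))
    (fun W hW W' h b hb y hy => by rw [Triv.ev_res, hb])
    (fun W hW b b' hb hb' => B.ext_ev fun y hy => by rw [hb, hb'])
    (fun x hx => by
      obtain ⟨W, hW, hD, g, hxW, hg⟩ := hf x hx
      refine ⟨W, hW, hxW, ((B.triv x).equiv W hD).symm g, fun y hy => ?_⟩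
      rw [B.ev_eq y x W y hy (B.mem_dom y) (hD hy), Triv.ev_symm hD, hg y (hW hy) hy]
      rw [← FormalSym.map_map (ρ'' := RingHom.id ℝ) p _ _ _ _
        ((B.triv y).trans (B.triv y) y (B.mem_dom y) (B.mem_dom y))
        ((B.triv y).trans_mem (B.triv y) (B.mem_dom y) (B.mem_dom y)) (fun _ => rfl)
        (fun v => B.trans_trans y x y (B.mem_dom y) (hD hy) (B.mem_dom y) v)]
      exact FormalSym.map_eq_self p _ _ (fun v => Triv.trans_self _ _ v) _)
  refine ⟨a, fun y hy => ?_⟩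
  obtain ⟨W, hW, hyW, h⟩ := ha y hy
  rw [← h y hyW, Triv.ev_res]

/-- The transition maps of a linear atlas depend smoothly on the point. -/
theorem smoothAt_trans (z w : M) {N : Opens (TopCat.of M)} (hz : N ≤ B.dom z) (hw : N ≤ B.dom w)
    {f : ↥(N : Opens M) → FormalSym p 𝒱} {x : (N : Opens M)} (hf : SmoothAt n f x) :
    SmoothAt n (fun y : (N : Opens M) => FormalSym.map p
      ((B.triv z).trans (B.triv w) y (hz y.2) (hw y.2))
      ((B.triv z).trans_mem (B.triv w) (hz y.2) (hw y.2)) (f y)) x := by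
  refine smoothAt_iff.2 fun k => ?_
  let b := Module.finBasis ℝ (Sym.power p 𝒱 k)
  -- the sections that are constant, with values in a basis of `Sᵏ(V)`, in one trivialization
  let a : Fin (Module.finrank ℝ (Sym.power p 𝒱 k)) → 𝓜.sec N := fun j =>
    ((B.triv w).equiv N hw).symm (SmoothSec.const n _ (FormalSym.ofSym p 𝒱 (b j)))
  have ha : ∀ j (y : (N : Opens M)), FormalSym.coeff k ((B.triv z).ev N y y.2 (hz y.2) (a j)) =
      Sym.map p ((B.triv z).trans (B.triv w) y (hz y.2) (hw y.2))
        ((B.triv z).trans_mem (B.triv w) (hz y.2) (hw y.2)) (b j) := fun j y => by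
    rw [B.ev_eq z w N y y.2 (hz y.2) (hw y.2), FormalSym.coeff_map', Triv.ev_symm hw _ y.2,
      SmoothSec.const_apply, FormalSym.coeff_ofSym (b j).2, if_pos rfl]
  have e : (fun y : (N : Opens M) => FormalSym.coeff k (FormalSym.map p
      ((B.triv z).trans (B.triv w) y (hz y.2) (hw y.2))
      ((B.triv z).trans_mem (B.triv w) (hz y.2) (hw y.2)) (f y))) = fun y => ∑ j,
        b.coord j ⟨FormalSym.coeff k (f y), FormalSym.coeff_mem_power k (f y)⟩ •
          FormalSym.coeff k ((B.triv z).ev N y y.2 (hz y.2) (a j)) := by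
    funext y
    have h := congrArg (Submodule.subtype _)
      (b.sum_repr ⟨FormalSym.coeff k (f y), FormalSym.coeff_mem_power k (f y)⟩)
    rw [map_sum] at h
    rw [FormalSym.coeff_map']
    refine (congrArg _ h.symm).trans ?_
    rw [map_sum]
    refine Finset.sum_congr rfl fun j _ => ?_
    rw [ha, _root_.map_smul]
    exact Sym.map_smul _ _ _ _
  rw [e]
  refine WeaklySmoothAt.sum fun j _ => WeaklySmoothAt.smul ?_ ?_
  · exact (smoothAt_iff.1 hf k).comp_linear_on (fun y => FormalSym.coeff_mem_power k (f y))
      (b.coord j) LinearMap.id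
  · exact smoothAt_iff.1 (Triv.smoothAt_ev (T := B.triv z) hz (a j) x) k

end LinearAtlas

end LinearAtlas

/-! ### Blocks of degree-preserving maps of the model space -/

section Block

variable {𝓘 : Type*} {m : 𝓘 →₀ ℕ}

open Classical in
/-- The block of degree `k` of a linear map of the model space. -/
noncomputable def block (g : Model m →ₗ[ℝ] Model m) (k : 𝓘) :
    (Fin (m k) → ℝ) →ₗ[ℝ] (Fin (m k) → ℝ) :=
  DirectSum.component ℝ 𝓘 (fun k => Fin (m k) → ℝ) k ∘ₗ g ∘ₗ
    DirectSum.lof ℝ 𝓘 (fun k => Fin (m k) → ℝ) k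

theorem apply_eq_block {g : Model m →ₗ[ℝ] Model m}
    (hg : ∀ i, ∀ v ∈ modelGrading m i, g v ∈ modelGrading m i) (v : Model m) (k : 𝓘) :
    g v k = block g k (v k) := by
  classical
  induction v using DirectSum.induction_on with
  | zero => simp
  | add v w hv hw =>
    rw [map_add, DirectSum.add_apply, DirectSum.add_apply, hv, hw, map_add]
  | of j f =>
    by_cases h : j = k
    · subst h
      rw [DirectSum.of_eq_same]
      change _ = g (DirectSum.lof ℝ 𝓘 (fun k => Fin (m k) → ℝ) j f) j
      congr!
    · obtain ⟨f', hf'⟩ := hg j (DirectSum.of (fun k => Fin (m k) → ℝ) j f) ⟨f, by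
        change DirectSum.of _ _ _ = _
        congr!⟩
      rw [DirectSum.of_eq_of_ne _ _ _ (Ne.symm h), map_zero, ← hf']
      exact DirectSum.of_eq_of_ne _ _ _ (Ne.symm h)

theorem block_comp {g h : Model m →ₗ[ℝ] Model m}
    (hg : ∀ i, ∀ v ∈ modelGrading m i, g v ∈ modelGrading m i) (k : 𝓘) :
    block (g ∘ₗ h) k = block g k ∘ₗ block h k :=
  LinearMap.ext fun _ => apply_eq_block hg _ k

theorem block_id (k : 𝓘) : block (LinearMap.id : Model m →ₗ[ℝ] Model m) k = LinearMap.id := by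
  classical
  exact LinearMap.ext fun f =>
    DirectSum.component.lof_self (R := ℝ) (M := fun k => Fin (m k) → ℝ) k f

/-- The transpose of the block of degree `k` of a linear map of the model space. -/
noncomputable def transposeBlock (g : Model m →ₗ[ℝ] Model m) (k : 𝓘) :
    (Fin (m k) → ℝ) →L[ℝ] (Fin (m k) → ℝ) :=
  (Matrix.toLin' (LinearMap.toMatrix' (block g k)).transpose).toContinuousLinearMap

theorem transposeBlock_single (g : Model m →ₗ[ℝ] Model m) (k : 𝓘) (a b : Fin (m k)) :
    transposeBlock g k (Pi.single a 1) b = block g k (Pi.single b 1) a := by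
  change Matrix.toLin' (LinearMap.toMatrix' (block g k)).transpose (Pi.single a 1) b = _
  rw [Matrix.toLin'_apply, Matrix.mulVec_single_one]
  simp [LinearMap.toMatrix'_apply]

theorem transposeBlock_comp {g h : Model m →ₗ[ℝ] Model m}
    (hg : ∀ i, ∀ v ∈ modelGrading m i, g v ∈ modelGrading m i) (k : 𝓘) (v : Fin (m k) → ℝ) :
    transposeBlock (g ∘ₗ h) k v = transposeBlock h k (transposeBlock g k v) := by
  change Matrix.toLin' _ v = Matrix.toLin' _ (Matrix.toLin' _ v)
  rw [block_comp hg, LinearMap.toMatrix'_comp, Matrix.transpose_mul, Matrix.toLin'_mul]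
  rfl

theorem transposeBlock_id (k : 𝓘) (v : Fin (m k) → ℝ) :
    transposeBlock (LinearMap.id : Model m →ₗ[ℝ] Model m) k v = v := by
  change Matrix.toLin' _ v = v
  rw [block_id, LinearMap.toMatrix'_id, Matrix.transpose_one, Matrix.toLin'_one]
  rfl

theorem transposeBlock_eq_sum (g : Model m →ₗ[ℝ] Model m) (k : 𝓘) :
    transposeBlock g k = ∑ b, ∑ a, block g k (Pi.single b 1) a •
      (Matrix.toLin' (Matrix.single b a (1 : ℝ))).toContinuousLinearMap := by
  have h : (LinearMap.toMatrix' (block g k)).transpose =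
      ∑ b, ∑ a, block g k (Pi.single b 1) a • Matrix.single b a (1 : ℝ) := by
    conv_lhs => rw [Matrix.matrix_eq_sum_single (LinearMap.toMatrix' (block g k)).transpose]
    refine Finset.sum_congr rfl fun b _ => Finset.sum_congr rfl fun a _ => ?_
    rw [Matrix.smul_single, smul_eq_mul, mul_one, Matrix.transpose_apply,
      LinearMap.toMatrix'_apply]
  rw [transposeBlock, h]
  simp only [map_sum, map_smul]

end Block

/-! ### The vector bundle given by linear transition maps -/

section Bundle

variable {𝓘 : Type*} [NonUnitalCommSemiring 𝓘] {p : 𝓘 →+ ZMod 2} {n : ℕ}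
variable {M : Type u} [TopologicalSpace M] [ChartedSpace (EuclideanSpace ℝ (Fin n)) M]
variable {𝓜 : GradedRingedSpace 𝓘 (TopCat.of M)} {ε : BodyMap n 𝓜} {φ : Projection ε}

/-- The component in `Eₖ*` of an element of the fibre `⨁ₖ Eₖ*`. -/
def GradedVectorBundle.dualComponent {m : 𝓘 →₀ ℕ} (E : GradedVectorBundle n M m) {x : M}
    (l : E.Dual x) (k : 𝓘) : Module.Dual ℝ (E.fiber k x) :=
  (show ⨁ k, Module.Dual ℝ (E.fiber k x) from l) k

namespace LinearAtlas

variable {V : Type*} [AddCommGroup V] [Module ℝ V] [FiniteDimensional ℝ V]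
variable {𝒱 : 𝓘 → Submodule ℝ V}

theorem mem_deg_of_ev (B : LinearAtlas p φ 𝒱) {U : Opens (TopCat.of M)} {a : 𝓜.sec U} {i : 𝓘}
    (h : ∀ y (hy : y ∈ U), (B.triv y).ev U y hy (B.mem_dom y) a ∈ FormalSym.deg p 𝒱 i) :
    a ∈ 𝓜.deg U i := by
  refine 𝓜.mem_of_local U i a fun x hx => ⟨U ⊓ B.dom x, inf_le_left, ⟨hx, B.mem_dom x⟩, ?_⟩
  refine Triv.mem_deg_of_ev (T := B.triv x) inf_le_right fun y hy => ?_
  have e := Triv.ev_res (T := B.triv x) (inf_le_left : U ⊓ B.dom x ≤ U) hy hy.2 a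
  rw [e, B.ev_eq x y U y hy.1 hy.2 (B.mem_dom y)]
  exact FormalSym.map_mem_deg _ _ (h y hy.1)

variable {m : 𝓘 →₀ ℕ} (B : LinearAtlas p φ (modelGrading m))

/-- If the dual of a graded vector bundle has the transition maps of a linear atlas, then `𝓞` is
the sheaf of sections of the formal symmetric power of this dual. -/
theorem isoBundle (E : GradedVectorBundle n M m) (K : ∀ y, Model m →ₗ[ℝ] E.Dual y)
    (hK : ∀ y i, ∀ v ∈ modelGrading m i, K y v ∈ E.dualGrading y i)
    (htriv : ∀ x y (hx : y ∈ B.dom x) v, E.dualTriv x y (K y v) =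
      (B.triv x).trans (B.triv y) y hx (B.mem_dom y) v)
    (hinv : ∀ y l, K y (E.dualTriv y y l) = l) : φ.IsoBundle p E := by
  have hev : ∀ x (U : Opens (TopCat.of M)) y (hy : y ∈ U) (hx : y ∈ B.dom x) (a : 𝓜.sec U),
      FormalSym.map p (E.dualTriv x y) (E.dualTriv_mem x y) (FormalSym.map p (K y) (hK y)
        ((B.triv y).ev U y hy (B.mem_dom y) a)) = (B.triv x).ev U y hy hx a := by
    intro x U y hy hx a
    rw [B.ev_eq x y U y hy hx (B.mem_dom y)]
    exact (FormalSym.map_map (ρ'' := RingHom.id ℝ) p _ _ _ _ _ _ (fun _ => rfl)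
      (fun v => (htriv x y hx v).symm) _).symm
  have hchange : ∀ x x' y (hx : y ∈ B.dom x) (hx' : y ∈ B.dom x') (f : E.SymDual p y),
      FormalSym.map p (E.dualTriv x y) (E.dualTriv_mem x y) f =
        FormalSym.map p ((B.triv x).trans (B.triv x') y hx hx')
          ((B.triv x).trans_mem (B.triv x') hx hx')
          (FormalSym.map p (E.dualTriv x' y) (E.dualTriv_mem x' y) f) := by
    intro x x' y hx hx' f
    refine FormalSym.map_map (ρ'' := RingHom.id ℝ) p _ _ _ _ _ _ (fun _ => rfl) (fun l => ?_) _
    rw [← hinv y l, htriv x y hx, htriv x' y hx']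
    exact B.trans_trans x x' y hx hx' (B.mem_dom y) _
  have hback : ∀ y (f : E.SymDual p y), FormalSym.map p (K y) (hK y)
      (FormalSym.map p (E.dualTriv y y) (E.dualTriv_mem y y) f) = f := by
    intro y f
    rw [← FormalSym.map_map (ρ'' := RingHom.id ℝ) p _ _ _ _ LinearMap.id (fun _ _ h => h)
      (fun _ => rfl) (fun l => (hinv y l).symm)]
    exact FormalSym.map_eq_self p _ _ (fun _ => rfl) f
  have hsm : ∀ (U : Opens (TopCat.of M)) (a : 𝓜.sec U),
      (fun y : (U : Opens M) => FormalSym.map p (K y) (hK y)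
        ((B.triv y).ev U y y.2 (B.mem_dom y) a)) ∈ E.sections p U := by
    intro U a x
    have hx : x.1 ∈ U ⊓ B.dom x := ⟨x.2, B.mem_dom x⟩
    refine SmoothAt.opens_congr (U := (U ⊓ B.dom x : Opens (TopCat.of M)))
      (f := fun y => (B.triv x).ev (U ⊓ B.dom x) y y.2 y.2.2 (𝓜.res inf_le_left a)) hx x.2
      (fun y hy hy' => ?_) (Triv.smoothAt_ev (T := B.triv x) inf_le_right _ _)
    rw [hev x U y hy' hy.2, Triv.ev_res]
  let Ψ : ∀ U : Opens (TopCat.of M), 𝓜.sec U →ₐ[ℝ] E.sections p U := fun U =>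
    { toFun := fun a => ⟨_, hsm U a⟩
      map_one' := Subtype.ext (funext fun y => by
        change FormalSym.map p (K y) (hK y) ((B.triv y).ev U y y.2 (B.mem_dom y) (1)) = _
        rw [map_one, map_one]
        rfl)
      map_mul' := fun a b => Subtype.ext (funext fun y => by
        change FormalSym.map p (K y) (hK y) ((B.triv y).ev U y y.2 (B.mem_dom y) (a * b)) = _
        rw [map_mul, map_mul]
        rfl)
      map_zero' := Subtype.ext (funext fun y => by
        change FormalSym.map p (K y) (hK y) ((B.triv y).ev U y y.2 (B.mem_dom y) (0)) = _
        rw [map_zero, map_zero]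
        rfl)
      map_add' := fun a b => Subtype.ext (funext fun y => by
        change FormalSym.map p (K y) (hK y) ((B.triv y).ev U y y.2 (B.mem_dom y) (a + b)) = _
        rw [map_add, map_add]
        rfl)
      commutes' := fun r => Subtype.ext (funext fun y => by
        change FormalSym.map p (K y) (hK y) ((B.triv y).ev U y y.2 (B.mem_dom y)
          (algebraMap ℝ _ r)) = _
        rw [AlgHom.commutes]
        exact FormalSym.map_algebraMap p _ _ r) }
  have hΨ : ∀ U a (y : (U : Opens M)), (Ψ U a).1 y = FormalSym.map p (K y) (hK y)
      ((B.triv y).ev U y y.2 (B.mem_dom y) a) := fun _ _ _ => rfl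
  have hbij : ∀ U, Function.Bijective (Ψ U) := by
    refine fun U => ⟨fun a b hab => B.ext_ev fun y hy => ?_, fun s => ?_⟩
    · have e := congrArg (fun s : E.sections p U => FormalSym.map p (E.dualTriv y y)
        (E.dualTriv_mem y y) (s.1 ⟨y, hy⟩)) hab
      rwa [hΨ, hΨ, hev y U y hy (B.mem_dom y), hev y U y hy (B.mem_dom y)] at e
    · obtain ⟨a, ha⟩ := B.exists_section (U := U)
        (fun y hy => FormalSym.map p (E.dualTriv y y) (E.dualTriv_mem y y) (s.1 ⟨y, hy⟩))
        (fun x hx => by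
          let W : Opens (TopCat.of M) := U ⊓ B.dom x
          refine ⟨W, inf_le_left, inf_le_right, ⟨fun y => FormalSym.map p (E.dualTriv x y)
            (E.dualTriv_mem x y) (s.1 ⟨y, y.2.1⟩), fun x' => ?_⟩, ⟨hx, B.mem_dom x⟩,
            fun y hy hyW => hchange x y y hyW.2 (B.mem_dom y) _⟩
          -- near `x'` the family is smooth in the trivialization around `x'`
          have hx' : x'.1 ∈ W ⊓ B.dom x' := ⟨x'.2, B.mem_dom x'⟩
          have h1 : SmoothAt n (fun y : ((W ⊓ B.dom x' : Opens (TopCat.of M)) : Opens M) =>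
              FormalSym.map p (E.dualTriv x' y) (E.dualTriv_mem x' y) (s.1 ⟨y, y.2.1.1⟩))
              ⟨x', hx'⟩ :=
            SmoothAt.opens_congr (U := (U : Opens M)) x'.2.1 hx' (fun _ _ _ => rfl)
              (s.2 ⟨x', x'.2.1⟩)
          refine SmoothAt.opens_congr (U := (W ⊓ B.dom x' : Opens (TopCat.of M))) hx' x'.2
            (fun y hy hy' => ?_) (B.smoothAt_trans x x' (inf_le_left.trans inf_le_right)
              inf_le_right h1)
          exact (hchange x x' y hy'.2 hy.2 _).symm)
      refine ⟨a, Subtype.ext (funext fun y => ?_)⟩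
      rw [hΨ, ha]
      exact hback y _
  refine ⟨fun U => AlgEquiv.ofBijective (Ψ U) (hbij U), fun U U' h a y => ?_, fun U c y => ?_,
    fun U k a => ⟨fun ha y => FormalSym.map_mem_deg _ _ (Triv.ev_mem_deg ha y.2 (B.mem_dom y)),
      fun ha => B.mem_deg_of_ev fun y hy => ?_⟩⟩
  · exact congrArg (FormalSym.map p (K y) (hK y)) (Triv.ev_res h y.2 (B.mem_dom y) a)
  · change FormalSym.map p (K y) (hK y) _ = _
    rw [B.ev_app]
    exact FormalSym.map_algebraMap p _ _ _
  · rw [← hev y U y hy (B.mem_dom y)]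
    exact FormalSym.map_mem_deg _ _ (ha ⟨y, hy⟩)

open Classical in
/-- The transition maps of `Eₖ`: the transposes of the blocks of degree `k` of the transition maps
of a linear atlas. The map from the trivialization around `z` to the one around `w` is the transpose of
the map from `w` to `z`. Outside the common domain the value is `0`. -/
noncomputable def dualTransition (k : 𝓘) (z w y : M) : (Fin (m k) → ℝ) →L[ℝ] (Fin (m k) → ℝ) :=
  if h : y ∈ B.dom z ∧ y ∈ B.dom w then
    transposeBlock ((B.triv z).trans (B.triv w) y h.1 h.2) k else 0

theorem dualTransition_eq (k : 𝓘) {z w y : M} (hz : y ∈ B.dom z) (hw : y ∈ B.dom w) :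
    B.dualTransition k z w y = transposeBlock ((B.triv z).trans (B.triv w) y hz hw) k :=
  dif_pos ⟨hz, hw⟩

theorem contMDiffOn_dualTransition (k : 𝓘) (z w : M) :
    ContMDiffOn (𝓡 n) 𝓘(ℝ, (Fin (m k) → ℝ) →L[ℝ] (Fin (m k) → ℝ)) ∞ (B.dualTransition k z w)
      ((B.dom z : Set M) ∩ B.dom w) := by
  classical
  intro x hx
  let N : Opens (TopCat.of M) := B.dom z ⊓ B.dom w
  have hN : ContMDiffAt (𝓡 n) 𝓘(ℝ, (Fin (m k) → ℝ) →L[ℝ] (Fin (m k) → ℝ)) ∞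
      (fun y : (N : Opens M) => B.dualTransition k z w y) ⟨x, hx⟩ := by
    have e : (fun y : (N : Opens M) => B.dualTransition k z w y) =
        fun y : (N : Opens M) => ∑ b, ∑ a,
          block ((B.triv z).trans (B.triv w) y y.2.1 y.2.2) k (Pi.single b 1) a •
          (Matrix.toLin' (Matrix.single b a (1 : ℝ))).toContinuousLinearMap := by
      funext y
      rw [B.dualTransition_eq k y.2.1 y.2.2, transposeBlock_eq_sum]
    rw [e]
    refine ContMDiffAt.sum fun b _ => ContMDiffAt.sum fun a _ => ?_
    let v : Model m := DirectSum.lof ℝ 𝓘 (fun k => Fin (m k) → ℝ) k (Pi.single b 1)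
    have h1 := (Triv.smoothAt_ev (T := B.triv z) (U := N) inf_le_left
      (𝓜.res inf_le_right ((B.triv w).coord v)) ⟨x, hx⟩).lin
        (LinearMap.proj a ∘ₗ DirectSum.component ℝ 𝓘 (fun k => Fin (m k) → ℝ) k)
    have e2 : (fun y : (N : Opens M) =>
        block ((B.triv z).trans (B.triv w) y y.2.1 y.2.2) k (Pi.single b 1) a) =
        fun y : (N : Opens M) =>
          (LinearMap.proj a ∘ₗ DirectSum.component ℝ 𝓘 (fun k => Fin (m k) → ℝ) k)
          (FormalSym.lin ((B.triv z).ev N y y.2 y.2.1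
            (𝓜.res inf_le_right ((B.triv w).coord v)))) := by
      funext y
      rw [Triv.ev_res]
      rfl
    rw [← e2] at h1
    exact h1.smul (contMDiffAt_const
      (c := (Matrix.toLin' (Matrix.single b a (1 : ℝ))).toContinuousLinearMap))
  exact (contMDiffAt_subtype_iff.1 hN).contMDiffWithinAt

/-- The bundle `Eₖ`, given by its transition maps. -/
noncomputable def core (k : 𝓘) : VectorBundleCore ℝ M (Fin (m k) → ℝ) M where
  baseSet z := B.dom z
  isOpen_baseSet z := (B.dom z).isOpen
  indexAt y := y
  mem_baseSet_at := B.mem_dom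
  coordChange := B.dualTransition k
  coordChange_self z y hy v := by
    have e : (B.triv z).trans (B.triv z) y hy hy = LinearMap.id :=
      LinearMap.ext fun v => Triv.trans_self _ _ v
    rw [B.dualTransition_eq k hy hy, e, transposeBlock_id]
  continuousOn_coordChange z w := (B.contMDiffOn_dualTransition k z w).continuousOn
  coordChange_comp x z w y hy v := by
    have e : (B.triv x).trans (B.triv w) y hy.1.1 hy.2 =
        (B.triv x).trans (B.triv z) y hy.1.1 hy.1.2 ∘ₗ
          (B.triv z).trans (B.triv w) y hy.1.2 hy.2 :=
      LinearMap.ext fun v => B.trans_trans x z w hy.1.1 hy.1.2 hy.2 v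
    rw [B.dualTransition_eq k hy.1.1 hy.2, B.dualTransition_eq k hy.1.1 hy.1.2,
      B.dualTransition_eq k hy.1.2 hy.2, e, transposeBlock_comp (Triv.trans_mem _ _ _ _)]

instance (k : 𝓘) : (B.core k).IsContMDiff (𝓡 n) ∞ :=
  ⟨B.contMDiffOn_dualTransition k⟩

/-- The graded vector bundle whose dual has the transition maps of a linear atlas. -/
noncomputable def bundle [IsManifold (𝓡 n) ∞ M] : GradedVectorBundle n M m where
  fiber k := (B.core k).Fiber

/-- In the dual trivialization of `Eₖ*`, a functional on the fibre is given by its values on the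
vectors of the standard basis. -/
theorem bundle_dualTriv [IsManifold (𝓡 n) ∞ M] {x y : M} (hx : y ∈ B.dom x) (l : B.bundle.Dual y)
    (k : 𝓘) (a : Fin (m k)) :
    (show Model m from B.bundle.dualTriv x y l) k a =
      B.bundle.dualComponent l k
      (transposeBlock ((B.triv x).trans (B.triv y) y hx (B.mem_dom y)) k (Pi.single a 1)) := by
  have h := VectorBundleCore.trivializationAt_symmL (B.core k) (b₀ := x) (b := y) hx
  have h' := DFunLike.congr_fun h (Pi.single a 1)
  have e : (B.core k).coordChange ((B.core k).indexAt x) ((B.core k).indexAt y) y =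
      transposeBlock ((B.triv x).trans (B.triv y) y hx (B.mem_dom y)) k :=
    B.dualTransition_eq k hx (B.mem_dom y)
  rw [e] at h'
  exact congrArg (B.bundle.dualComponent l k) h'

/-- The sections of the formal symmetric power of the dual of `bundle` are the sections of `𝓞`. -/
theorem exists_isoBundle (B : LinearAtlas p φ (modelGrading m)) [IsManifold (𝓡 n) ∞ M] :
    ∃ E : GradedVectorBundle n M m, φ.IsoBundle p E := by
  classical
  -- `ℝᵐ` is identified with its dual by the standard scalar product
  let P : ∀ k, (Fin (m k) → ℝ) →ₗ[ℝ] ((Fin (m k) → ℝ) →ₗ[ℝ] ℝ) := fun k =>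
    (Module.piEquiv (Fin (m k)) ℝ ℝ).toLinearMap
  have hP : ∀ k v w, P k v w = ∑ b, w b * v b := fun k v w => by
    simp [P, Module.piEquiv_apply_apply]
  let K : ∀ y, Model m →ₗ[ℝ] B.bundle.Dual y := fun y => DirectSum.lmap P
  have htriv : ∀ x y (hx : y ∈ B.dom x) v, B.bundle.dualTriv x y (K y v) =
      (B.triv x).trans (B.triv y) y hx (B.mem_dom y) v := by
    intro x y hx v
    refine DFinsupp.ext fun k => funext fun a => ?_
    refine (B.bundle_dualTriv hx _ k a).trans ?_
    refine (hP k (v k) _).trans ?_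
    have e := apply_eq_block ((B.triv x).trans_mem (B.triv y) hx (B.mem_dom y)) v k
    refine Eq.trans ?_ (congrFun e a).symm
    conv_rhs => rw [pi_eq_sum_univ' (v k), map_sum]
    rw [Finset.sum_apply]
    refine Finset.sum_congr rfl fun b _ => ?_
    rw [transposeBlock_single, map_smul, Pi.smul_apply, smul_eq_mul, mul_comm]
  refine ⟨B.bundle, B.isoBundle B.bundle K (fun y i v hv => ?_) htriv fun y l => ?_⟩
  · obtain ⟨f, rfl⟩ := hv
    exact ⟨P i f, (DirectSum.lmap_lof (f := P) i f).symm⟩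
  · refine DFinsupp.ext fun k => ?_
    have e : P k (B.bundle.dualTriv y y l k) = B.bundle.dualComponent l k := by
      refine LinearMap.pi_ext' fun a => LinearMap.ext_ring ?_
      refine (hP k _ _).trans ?_
      change _ = B.bundle.dualComponent l k (Pi.single a (1 : ℝ))
      have e1 : (B.triv y).trans (B.triv y) y (B.mem_dom y) (B.mem_dom y) = LinearMap.id :=
        LinearMap.ext fun v => Triv.trans_self _ _ v
      have e2 := B.bundle_dualTriv (B.mem_dom y) l k
      simp only [e1, transposeBlock_id] at e2
      simp only [e2]
      simp [Pi.single_apply]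
    exact e

end LinearAtlas

end Bundle

/-! ### Formal symmetric powers of free modules of smooth functions -/

section FreeModule

variable {𝓘 : Type*} [NonUnitalCommSemiring 𝓘] {p : 𝓘 →+ ZMod 2} {n : ℕ}
variable {N : Type*} [TopologicalSpace N] [ChartedSpace (EuclideanSpace ℝ (Fin n)) N]
variable {V : Type*} [AddCommGroup V] [Module ℝ V] [FiniteDimensional ℝ V]
variable {𝒱 : 𝓘 → Submodule ℝ V}

variable (n) in
/-- Evaluation of smooth functions at a point. -/
noncomputable def pointEval (y : N) : C^∞⟮𝓡 n, N; 𝓘(ℝ), ℝ⟯ →+* ℝ where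
  toFun c := c y
  map_one' := rfl
  map_mul' _ _ := rfl
  map_zero' := rfl
  map_add' _ _ := rfl

variable {F : Type*} [AddCommGroup F] [Module C^∞⟮𝓡 n, N; 𝓘(ℝ), ℝ⟯ F]
variable {ℱ : 𝓘 → Submodule C^∞⟮𝓡 n, N; 𝓘(ℝ), ℝ⟯ F}
variable (ℓ : ∀ y : N, F →ₛₗ[pointEval n y] V) (hℓ : ∀ y i, ∀ s ∈ ℱ i, ℓ y s ∈ 𝒱 i)

/-- If the elements of a module over smooth functions have smooth values in `V`, then the elements
of its formal symmetric power have smooth values in the formal symmetric power of `V`. -/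
theorem smoothAt_map (hs : ∀ s x, WeaklySmoothAt n (fun y => ℓ y s) x) (f : FormalSym p ℱ) (x : N) :
    SmoothAt n (fun y => FormalSym.map p (ℓ y) (hℓ y) f) x := by
  refine smoothAt_iff.2 fun k => ?_
  simp only [FormalSym.coeff_map']
  have hf := FormalSym.coeff_mem_power k f
  generalize FormalSym.coeff k f = z at hf
  rw [Sym.power] at hf
  induction hf using Submodule.pow_induction_on_left' with
  | algebraMap c =>
    have e : (fun y => Sym.map p (ℓ y) (hℓ y) (algebraMap _ (Sym p ℱ) c)) =
        fun y => c y • (1 : Sym p 𝒱) := funext fun y => by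
      rw [Sym.map_algebraMap, Algebra.algebraMap_eq_smul_one]
      rfl
    rw [e]
    exact WeaklySmoothAt.smul (c.contMDiff x) (WeaklySmoothAt.const 1 x)
  | add z w i _ _ hz hw =>
    simp only [map_add]
    exact hz.add hw
  | mem_mul u hu i z hz ih =>
    obtain ⟨s, rfl⟩ := hu
    simp only [map_mul, Sym.map_ι]
    exact contMDiffAt_functional_mul (Sym.power p 𝒱 1) (Sym.power p 𝒱 i)
      (fun y => Sym.ι_mem_power _) (fun y => Sym.map_mem_power p _ _ i hz)
      ((hs s x).comp_linear (Sym.ι p 𝒱)) ih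

variable (κ : V →ₛₗ[algebraMap ℝ C^∞⟮𝓡 n, N; 𝓘(ℝ), ℝ⟯] F)

theorem map_map_eq (hκ : ∀ i, ∀ v ∈ 𝒱 i, κ v ∈ ℱ i) (hℓκ : ∀ y v, ℓ y (κ v) = v) (y : N)
    (x : Sym p 𝒱) :
    Sym.map p (ℓ y) (hℓ y) (Sym.map p κ hκ x) = x := by
  have key : (Sym.map p (ℓ y) (hℓ y)).comp (Sym.map p κ hκ) = RingHom.id _ :=
    Sym.ringHom_ext p
      (fun r => by
        rw [RingHom.comp_apply, Sym.map_algebraMap, Sym.map_algebraMap]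
        rfl)
      (fun v => by
        rw [RingHom.comp_apply, Sym.map_ι, Sym.map_ι, hℓκ]
        rfl)
  exact DFunLike.congr_fun key x

/-- If an element of `F` is determined by its smooth values in `V`, and `κ` embeds `V` as elements
with constant values, then `Sᵏ(F)` is spanned by the images of a basis of `Sᵏ(V)`. -/
theorem exists_eq_sum_map (hκ : ∀ i, ∀ v ∈ 𝒱 i, κ v ∈ ℱ i)
    (hs : ∀ s x, WeaklySmoothAt n (fun y => ℓ y s) x)
    (hinj : ∀ s, (∀ y, ℓ y s = 0) → s = 0) (hℓκ : ∀ y v, ℓ y (κ v) = v) {k : ℕ} {x : Sym p ℱ}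
    (hx : x ∈ Sym.power p ℱ k) {r : ℕ} (b : Module.Basis (Fin r) ℝ (Sym.power p 𝒱 k)) :
    ∃ c : Fin r → C^∞⟮𝓡 n, N; 𝓘(ℝ), ℝ⟯, ∑ j, c j • Sym.map p κ hκ (b j) = x := by
  have h1 : LinearMap.range (Sym.ι p ℱ) ≤ Submodule.span C^∞⟮𝓡 n, N; 𝓘(ℝ), ℝ⟯
      (Sym.map p κ hκ '' (LinearMap.range (Sym.ι p 𝒱) : Set (Sym p 𝒱))) := by
    rintro _ ⟨s, rfl⟩
    obtain ⟨q, v, c, -, e⟩ := WeaklySmoothAt.exists_eq_sum (S := (⊤ : Submodule ℝ V))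
      (fun _ => Submodule.mem_top) (hs s)
    have e' : s = ∑ j, c j • κ (v j) := by
      refine sub_eq_zero.1 (hinj _ fun y => ?_)
      rw [map_sub, map_sum, e, sub_eq_zero]
      refine Finset.sum_congr rfl fun j _ => ?_
      rw [map_smulₛₗ, hℓκ]
      rfl
    rw [e', map_sum]
    refine Submodule.sum_mem _ fun j _ => ?_
    rw [_root_.map_smul, ← Sym.map_ι p κ hκ]
    exact Submodule.smul_mem _ _ (Submodule.subset_span ⟨_, ⟨_, rfl⟩, rfl⟩)
  have h2 := pow_le_pow_left' h1 k hx
  rw [Submodule.span_pow] at h2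
  refine (Submodule.mem_span_range_iff_exists_fun _).1 (Submodule.span_le.2 ?_ h2)
  rw [← Set.image_pow]
  rintro _ ⟨z, hz, rfl⟩
  have hz' : z ∈ Sym.power p 𝒱 k := Submodule.pow_subset_pow _ hz
  have h := congrArg (Submodule.subtype _) (b.sum_repr ⟨z, hz'⟩)
  have h' := congrArg (Sym.map p κ hκ) h
  rw [map_sum, map_sum] at h'
  refine h'.symm ▸ Submodule.sum_mem _ fun j _ => ?_
  rw [_root_.map_smul, Submodule.subtype_apply, Sym.map_smul]
  exact Submodule.smul_mem _ _ (Submodule.subset_span ⟨j, rfl⟩)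

/-- An element of the formal symmetric power of a free module with fibres `V` is determined by its
values. -/
theorem eq_zero_of_map_eq_zero (hκ : ∀ i, ∀ v ∈ 𝒱 i, κ v ∈ ℱ i)
    (hs : ∀ s x, WeaklySmoothAt n (fun y => ℓ y s) x)
    (hinj : ∀ s, (∀ y, ℓ y s = 0) → s = 0) (hℓκ : ∀ y v, ℓ y (κ v) = v) {f : FormalSym p ℱ}
    (hf : ∀ y, FormalSym.map p (ℓ y) (hℓ y) f = 0) : f = 0 := by
  ext k
  let b := Module.finBasis ℝ (Sym.power p 𝒱 k)
  obtain ⟨c, hc⟩ := exists_eq_sum_map ℓ κ hκ hs hinj hℓκ (FormalSym.coeff_mem_power k f) b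
  have h : ∀ y j, c j y = 0 := fun y => by
    have e := congrArg (FormalSym.coeff k) (hf y)
    rw [FormalSym.coeff_map', ← hc, map_sum, map_zero] at e
    simp only [Sym.map_smul, map_map_eq ℓ hℓ κ hκ hℓκ] at e
    refine Fintype.linearIndependent_iff.1 b.linearIndependent (fun j => c j y) (Subtype.ext ?_)
    rw [← Submodule.subtype_apply, map_sum]
    exact e
  have h' : ∀ j, c j = 0 := fun j => ContMDiffMap.ext fun y => h y j
  rw [← hc, map_zero]
  simp only [h', zero_smul, Finset.sum_const_zero]

/-- A smooth function with values in the formal symmetric power of `V` comes from an element of the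
formal symmetric power of a free module with fibres `V`. -/
theorem exists_map_eq (hκ : ∀ i, ∀ v ∈ 𝒱 i, κ v ∈ ℱ i)
    (hs : ∀ s x, WeaklySmoothAt n (fun y => ℓ y s) x)
    (hinj : ∀ s, (∀ y, ℓ y s = 0) → s = 0) (hℓκ : ∀ y v, ℓ y (κ v) = v) (g : SmoothSec p 𝒱 n N) :
    ∃ f : FormalSym p ℱ, (∀ y, FormalSym.map p (ℓ y) (hℓ y) f = g.1 y) ∧
      ∀ i, g ∈ SmoothSec.deg p 𝒱 n N i → f ∈ FormalSym.deg p ℱ i := by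
  have key : ∀ (S : ℕ → Submodule ℝ (Sym p 𝒱)) (_ : ∀ k, S k ≤ Sym.power p 𝒱 k)
      (T : ℕ → Submodule C^∞⟮𝓡 n, N; 𝓘(ℝ), ℝ⟯ (Sym p ℱ))
      (_ : ∀ k, ∀ x ∈ S k, Sym.map p κ hκ x ∈ T k), (∀ k y, FormalSym.coeff k (g.1 y) ∈ S k) →
      ∃ f : FormalSym p ℱ, (∀ y, FormalSym.map p (ℓ y) (hℓ y) f = g.1 y) ∧
        ∀ k, FormalSym.coeff k f ∈ T k := by
    intro S hS T hT hg
    have hfin : ∀ k, FiniteDimensional ℝ (S k) := fun k => Submodule.finiteDimensional_of_le (hS k)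
    choose r s c hsS e using fun k => WeaklySmoothAt.exists_eq_sum (hg k) (g.coeff_smooth k)
    refine ⟨FormalSym.mk (fun k => ∑ j, c k j • Sym.map p κ hκ (s k j)) fun k =>
      Submodule.sum_mem _ fun j _ => Submodule.smul_mem _ _
        (Sym.map_mem_power p κ hκ k (hS k (hsS k j))), fun y => ?_, fun k => ?_⟩
    · ext k
      rw [FormalSym.coeff_map', FormalSym.coeff_mk, map_sum, e]
      refine Finset.sum_congr rfl fun j _ => ?_
      rw [Sym.map_smul, map_map_eq ℓ hℓ κ hκ hℓκ]
      rfl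
    · rw [FormalSym.coeff_mk]
      exact Submodule.sum_mem _ fun j _ => Submodule.smul_mem _ _ (hT k _ (hsS k j))
  obtain ⟨f, hf, -⟩ := key (Sym.power p 𝒱) (fun _ => le_rfl) (Sym.power p ℱ)
    (fun k _ hx => Sym.map_mem_power p κ hκ k hx) fun k y => FormalSym.coeff_mem_power k _
  refine ⟨f, hf, fun i hi => ?_⟩
  obtain ⟨f', hf', h⟩ := key (fun k => Sym.component p 𝒱 k i)
    (fun k => Sym.component_le_power k i) (fun k => Sym.component p ℱ k i)
    (fun k _ hx => Sym.map_mem_component κ hκ hx) fun k y => hi y k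
  have e : f - f' = 0 := eq_zero_of_map_eq_zero ℓ hℓ κ hκ hs hinj hℓκ fun y => by
    rw [map_sub, hf, hf', sub_self]
  rw [sub_eq_zero.1 e]
  exact h

end FreeModule

/-! ### The structure sheaf as a formal symmetric power of `𝓕` -/

section SymF

variable {𝓘 : Type*} [NonUnitalCommSemiring 𝓘] {p : 𝓘 →+ ZMod 2} {n : ℕ}
variable {M : Type u} [TopologicalSpace M] [ChartedSpace (EuclideanSpace ℝ (Fin n)) M]
variable {𝓜 : GradedRingedSpace 𝓘 (TopCat.of M)} {ε : BodyMap n 𝓜} {φ : Projection ε}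
variable {V : Type*} [AddCommGroup V] [Module ℝ V] [FiniteDimensional ℝ V]
variable {𝒱 : 𝓘 → Submodule ℝ V}

namespace LinearAtlas

variable (B : LinearAtlas p φ 𝒱) (h𝒱 : ⨆ i, 𝒱 i = ⊤) (h0 : 𝒱 0 = ⊥)

/-- The value at a point of a section of `𝓕`, in a trivialization. -/
noncomputable def linF (z : M) {U : Opens (TopCat.of M)} (y : (U : Opens M)) (hz : y.1 ∈ B.dom z) :
    φ.F U →ₛₗ[pointEval n y] V :=
  Submodule.liftQ _
    { toFun := fun a : φ.O1 U => FormalSym.lin ((B.triv z).ev U y y.2 hz (φ.val a))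
      map_add' := fun a b => by rw [map_add, map_add, map_add]
      map_smul' := fun c a => by
        rw [Projection.val_smul, map_mul, B.ev_app z c y.2 hz, FormalSym.lin_algebraMap_mul]
        rfl }
    (by
      intro a ha
      exact FormalSym.lin_eq_zero_of_mem_fil
        ((memFil_two_iff ε h𝒱 h0 B.mem_dom B.triv).2 ha _ (B.triv z) y y.2 hz))

theorem linF_π (z : M) {U : Opens (TopCat.of M)} (y : (U : Opens M)) (hz : y.1 ∈ B.dom z)
    (a : φ.O1 U) : B.linF h𝒱 h0 z y hz (φ.π U a) =
      FormalSym.lin ((B.triv z).ev U y y.2 hz (φ.val a)) := rfl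

theorem linF_mem (z : M) {U : Opens (TopCat.of M)} (y : (U : Opens M)) (hz : y.1 ∈ B.dom z)
    (i : 𝓘) (s : φ.F U) (hs : s ∈ φ.degF U i) : B.linF h𝒱 h0 z y hz s ∈ 𝒱 i := by
  obtain ⟨a, ha, rfl⟩ := Projection.exists_of_mem_degF hs
  exact FormalSym.lin_mem (Triv.ev_mem_deg ha y.2 hz)

theorem linF_trans (z w : M) {U : Opens (TopCat.of M)} (y : (U : Opens M)) (hz : y.1 ∈ B.dom z)
    (hw : y.1 ∈ B.dom w) (s : φ.F U) : B.linF h𝒱 h0 z y hz s =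
      (B.triv z).trans (B.triv w) y hz hw (B.linF h𝒱 h0 w y hw s) := by
  obtain ⟨a, rfl⟩ := Projection.π_surjective s
  rw [linF_π, linF_π, B.ev_eq z w U y y.2 hz hw, FormalSym.lin_map]

theorem linF_resF (z : M) {U U' : Opens (TopCat.of M)} (h : U' ≤ U) (y : (U' : Opens M))
    (hz : y.1 ∈ B.dom z) (s : φ.F U) : B.linF h𝒱 h0 z y hz (φ.resF h s) =
      B.linF h𝒱 h0 z (⟨y, h y.2⟩ : (U : Opens M)) hz s := by
  obtain ⟨a, rfl⟩ := Projection.π_surjective s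
  rw [Projection.resF_π, linF_π, linF_π, Projection.val_resO1, Triv.ev_res]

theorem smoothAt_linF (z : M) {U : Opens (TopCat.of M)} (hU : U ≤ B.dom z) (s : φ.F U)
    (x : (U : Opens M)) :
    WeaklySmoothAt n (fun y : (U : Opens M) => B.linF h𝒱 h0 z y (hU y.2) s) x := by
  obtain ⟨a, rfl⟩ := Projection.π_surjective s
  exact (Triv.smoothAt_ev (T := B.triv z) hU (φ.val a) x).lin

theorem eq_zero_of_linF (z : M) {U : Opens (TopCat.of M)} (hU : U ≤ B.dom z) (s : φ.F U)
    (hs : ∀ y : (U : Opens M), B.linF h𝒱 h0 z y (hU y.2) s = 0) : s = 0 := by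
  obtain ⟨a, rfl⟩ := Projection.π_surjective s
  have h1 : MemFil p n 𝒱 1 (φ.val a) :=
    (memFil_one_iff ε h𝒱 h0 B.mem_dom B.triv).2 (Projection.app_val a)
  rw [← map_zero (φ.π U), Projection.π_eq_iff, map_zero, sub_zero,
    ← memFil_two_iff ε h𝒱 h0 B.mem_dom B.triv]
  refine MemFil.of_triv (T := B.triv z) h𝒱 h0 hU fun y => ?_
  have h2 := MemFil.equiv_mem (T := B.triv z) hU h1 y
  rw [Triv.equiv_apply] at h2 ⊢
  exact FormalSym.mem_fil_two h2 (hs y)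

/-- The sections of `𝓕` with constant values in a trivialization. -/
noncomputable def coordF (z : M) {U : Opens (TopCat.of M)} (hU : U ≤ B.dom z) :
    V →ₛₗ[algebraMap ℝ (Csm n U)] φ.F U where
  toFun v := φ.π U (φ.mkO1 (𝓜.res hU ((B.triv z).coord v)) (by
    rw [ε.app_res, Triv.app_coord _ h𝒱 h0, map_zero]))
  map_add' v w := by
    rw [← map_add]
    refine congrArg (φ.π U) (Projection.val_injective ?_)
    exact (congrArg (𝓜.res hU) (map_add _ v w)).trans (map_add (𝓜.res hU) _ _)
  map_smul' r v := by
    rw [← map_smul]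
    refine congrArg (φ.π U) (Projection.val_injective ?_)
    rw [Projection.val_smul, Projection.val_mkO1, Projection.val_mkO1, map_smul, map_smul,
      AlgHom.commutes, ← Algebra.smul_def]

theorem coordF_mem (z : M) {U : Opens (TopCat.of M)} (hU : U ≤ B.dom z) (i : 𝓘) (v : V)
    (hv : v ∈ 𝒱 i) : B.coordF h𝒱 h0 z hU v ∈ φ.degF U i :=
  Projection.π_mem_degF (𝓜.map_mem _ _ hU i _ ((B.triv z).coord_mem_deg hv))

theorem linF_coordF (z : M) {U : Opens (TopCat.of M)} (hU : U ≤ B.dom z) (y : (U : Opens M))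
    (v : V) : B.linF h𝒱 h0 z y (hU y.2) (B.coordF h𝒱 h0 z hU v) = v := by
  refine (B.linF_π h𝒱 h0 z y (hU y.2) _).trans ?_
  rw [Projection.val_mkO1, Triv.ev_res, Triv.ev_coord, FormalSym.lin_ι]

theorem map_linF (z w : M) {U : Opens (TopCat.of M)} (y : (U : Opens M)) (hz : y.1 ∈ B.dom z)
    (hw : y.1 ∈ B.dom w) (f : φ.SymF p U) :
    FormalSym.map p (B.linF h𝒱 h0 z y hz) (B.linF_mem h𝒱 h0 z y hz) f =
      FormalSym.map p ((B.triv z).trans (B.triv w) y hz hw) ((B.triv z).trans_mem (B.triv w) hz hw)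
        (FormalSym.map p (B.linF h𝒱 h0 w y hw) (B.linF_mem h𝒱 h0 w y hw) f) :=
  FormalSym.map_map p _ _ _ _ _ _ (fun _ => rfl) (B.linF_trans h𝒱 h0 z w y hz hw) f

theorem map_linF_resSymF (z : M) {U U' : Opens (TopCat.of M)} (h : U' ≤ U) (y : (U' : Opens M))
    (hz : y.1 ∈ B.dom z) (f : φ.SymF p U) :
    FormalSym.map p (B.linF h𝒱 h0 z y hz) (B.linF_mem h𝒱 h0 z y hz) (φ.resSymF p h f) =
      FormalSym.map p (B.linF h𝒱 h0 z (⟨y, h y.2⟩ : (U : Opens M)) hz)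
        (B.linF_mem h𝒱 h0 z (⟨y, h y.2⟩ : (U : Opens M)) hz) f :=
  (FormalSym.map_map p (φ.resF h) (φ.resF_mem_degF h) _ _ _ _ (fun _ => rfl)
    (fun s => (B.linF_resF h𝒱 h0 z h y hz s).symm) f).symm

/-- The values of an element of the formal symmetric power of `𝓕(U)` are compatible with the linear
transition maps, so they come from a section of `𝓞`. -/
theorem exists_ev_eq_map {U : Opens (TopCat.of M)} (f : φ.SymF p U) :
    ∃ a : 𝓜.sec U, ∀ (z : M) (y : (U : Opens M)) (hz : y.1 ∈ B.dom z),
      (B.triv z).ev U y y.2 hz a =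
        FormalSym.map p (B.linF h𝒱 h0 z y hz) (B.linF_mem h𝒱 h0 z y hz) f := by
  obtain ⟨a, ha⟩ := B.exists_section (U := U)
    (fun y hy => FormalSym.map p (B.linF h𝒱 h0 y (⟨y, hy⟩ : (U : Opens M)) (B.mem_dom y))
      (B.linF_mem h𝒱 h0 y (⟨y, hy⟩ : (U : Opens M)) (B.mem_dom y)) f)
    (fun x hx => by
      have hW : U ⊓ B.dom x ≤ B.dom x := inf_le_right
      refine ⟨U ⊓ B.dom x, inf_le_left, hW,
        ⟨fun y => FormalSym.map p (B.linF h𝒱 h0 x y (hW y.2)) (B.linF_mem h𝒱 h0 x y (hW y.2))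
          (φ.resSymF p inf_le_left f), smoothAt_map
            (fun y => B.linF h𝒱 h0 x y (hW y.2)) (fun y => B.linF_mem h𝒱 h0 x y (hW y.2))
            (B.smoothAt_linF h𝒱 h0 x hW) _⟩,
        ⟨hx, B.mem_dom x⟩, fun y hy hyW => ?_⟩
      refine (B.map_linF_resSymF h𝒱 h0 x _ ⟨y, hyW⟩ (hW hyW) f).trans ?_
      exact B.map_linF h𝒱 h0 x y ⟨y, hy⟩ (hW hyW) (B.mem_dom y) f)
  refine ⟨a, fun z y hz => ?_⟩
  rw [B.ev_eq z y U y y.2 hz (B.mem_dom _), B.map_linF h𝒱 h0 z y y hz (B.mem_dom _)]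
  exact congrArg _ (ha y y.2)

/-- The multiplicative extension of the inclusion of linear sections: the homomorphism from the
formal symmetric power of `𝓕` to `𝓞` that in each trivialization is given by evaluation of sections
of `𝓕`. -/
noncomputable def ofSymF (U : Opens (TopCat.of M)) : φ.SymF p U →ₐ[ℝ] 𝓜.sec U where
  toFun f := (B.exists_ev_eq_map h𝒱 h0 f).choose
  map_one' := B.ext_ev fun y hy =>
    ((B.exists_ev_eq_map h𝒱 h0 1).choose_spec y ⟨y, hy⟩ (B.mem_dom y)).trans
      ((map_one _).trans (map_one _).symm)
  map_mul' f g := B.ext_ev fun y hy =>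
    ((B.exists_ev_eq_map h𝒱 h0 (f * g)).choose_spec y ⟨y, hy⟩ (B.mem_dom y)).trans
      ((map_mul _ _ _).trans ((congrArg₂ (· * ·)
        ((B.exists_ev_eq_map h𝒱 h0 f).choose_spec y ⟨y, hy⟩ (B.mem_dom y)).symm
        ((B.exists_ev_eq_map h𝒱 h0 g).choose_spec y ⟨y, hy⟩ (B.mem_dom y)).symm).trans
          (map_mul _ _ _).symm))
  map_zero' := B.ext_ev fun y hy =>
    ((B.exists_ev_eq_map h𝒱 h0 0).choose_spec y ⟨y, hy⟩ (B.mem_dom y)).trans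
      ((map_zero _).trans (map_zero _).symm)
  map_add' f g := B.ext_ev fun y hy =>
    ((B.exists_ev_eq_map h𝒱 h0 (f + g)).choose_spec y ⟨y, hy⟩ (B.mem_dom y)).trans
      ((map_add _ _ _).trans ((congrArg₂ (· + ·)
        ((B.exists_ev_eq_map h𝒱 h0 f).choose_spec y ⟨y, hy⟩ (B.mem_dom y)).symm
        ((B.exists_ev_eq_map h𝒱 h0 g).choose_spec y ⟨y, hy⟩ (B.mem_dom y)).symm).trans
          (map_add _ _ _).symm))
  commutes' r := B.ext_ev fun y hy =>
    ((B.exists_ev_eq_map h𝒱 h0 (algebraMap ℝ _ r)).choose_spec y ⟨y, hy⟩ (B.mem_dom y)).trans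
      ((FormalSym.map_algebraMap p _ _ (algebraMap ℝ (Csm n U) r)).trans
        (AlgHom.commutes _ r).symm)

theorem ev_ofSymF {U : Opens (TopCat.of M)} (f : φ.SymF p U) (z : M) (y : (U : Opens M))
    (hz : y.1 ∈ B.dom z) : (B.triv z).ev U y y.2 hz (B.ofSymF h𝒱 h0 U f) =
      FormalSym.map p (B.linF h𝒱 h0 z y hz) (B.linF_mem h𝒱 h0 z y hz) f :=
  (B.exists_ev_eq_map h𝒱 h0 f).choose_spec z y hz

end LinearAtlas

end SymF

section SymFIso

variable {𝓘 : Type*} [NonUnitalCommSemiring 𝓘] {p : 𝓘 →+ ZMod 2} {n : ℕ}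
variable {M : Type u} [TopologicalSpace M] [ChartedSpace (EuclideanSpace ℝ (Fin n)) M]
variable {𝓜 : GradedRingedSpace 𝓘 (TopCat.of M)} {ε : BodyMap n 𝓜} {φ : Projection ε}
variable {V : Type*} [AddCommGroup V] [Module ℝ V] [FiniteDimensional ℝ V]
variable {𝒱 : 𝓘 → Submodule ℝ V}

namespace LinearAtlas

variable (B : LinearAtlas p φ 𝒱) (h𝒱 : ⨆ i, 𝒱 i = ⊤) (h0 : 𝒱 0 = ⊥)

theorem ofSymF_res {U U' : Opens (TopCat.of M)} (h : U' ≤ U) (f : φ.SymF p U) :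
    B.ofSymF h𝒱 h0 U' (φ.resSymF p h f) = 𝓜.res h (B.ofSymF h𝒱 h0 U f) := by
  refine B.ext_ev fun y hy => ?_
  refine (B.ev_ofSymF h𝒱 h0 _ y ⟨y, hy⟩ (B.mem_dom y)).trans ?_
  rw [B.map_linF_resSymF, Triv.ev_res]
  exact (B.ev_ofSymF h𝒱 h0 f y ⟨y, h hy⟩ (B.mem_dom y)).symm

theorem ofSymF_algebraMap {U : Opens (TopCat.of M)} (c : Csm n U) :
    B.ofSymF h𝒱 h0 U (algebraMap (Csm n U) (φ.SymF p U) c) = φ.app U c := by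
  refine B.ext_ev fun y hy => ?_
  refine (B.ev_ofSymF h𝒱 h0 _ y ⟨y, hy⟩ (B.mem_dom y)).trans ?_
  rw [B.ev_app]
  exact FormalSym.map_algebraMap p _ _ c

theorem ofSymF_mem_deg {U : Opens (TopCat.of M)} {f : φ.SymF p U} {i : 𝓘}
    (hf : f ∈ FormalSym.deg p (φ.degF U) i) : B.ofSymF h𝒱 h0 U f ∈ 𝓜.deg U i := by
  refine B.mem_deg_of_ev fun y hy => ?_
  rw [show (B.triv y).ev U y hy (B.mem_dom y) (B.ofSymF h𝒱 h0 U f) = _ from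
    B.ev_ofSymF h𝒱 h0 f y ⟨y, hy⟩ (B.mem_dom y)]
  exact FormalSym.map_mem_deg _ _ hf

theorem ofSymF_injective (z : M) {U : Opens (TopCat.of M)} (hU : U ≤ B.dom z) :
    Function.Injective (B.ofSymF h𝒱 h0 U) := by
  refine (injective_iff_map_eq_zero _).2 fun f hf => ?_
  refine eq_zero_of_map_eq_zero (fun y : (U : Opens M) => B.linF h𝒱 h0 z y (hU y.2))
    (fun y => B.linF_mem h𝒱 h0 z y (hU y.2)) (B.coordF h𝒱 h0 z hU) (B.coordF_mem h𝒱 h0 z hU)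
    (B.smoothAt_linF h𝒱 h0 z hU) (B.eq_zero_of_linF h𝒱 h0 z hU)
    (B.linF_coordF h𝒱 h0 z hU) fun y => ?_
  rw [← B.ev_ofSymF, hf, map_zero]

theorem exists_ofSymF_eq (z : M) {U : Opens (TopCat.of M)} (hU : U ≤ B.dom z) (a : 𝓜.sec U) :
    ∃ f, B.ofSymF h𝒱 h0 U f = a ∧
      ∀ i, a ∈ 𝓜.deg U i → f ∈ FormalSym.deg p (φ.degF U) i := by
  obtain ⟨f, hf, hdeg⟩ := exists_map_eq (fun y : (U : Opens M) => B.linF h𝒱 h0 z y (hU y.2))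
    (fun y => B.linF_mem h𝒱 h0 z y (hU y.2)) (B.coordF h𝒱 h0 z hU) (B.coordF_mem h𝒱 h0 z hU)
    (B.smoothAt_linF h𝒱 h0 z hU) (B.eq_zero_of_linF h𝒱 h0 z hU)
    (B.linF_coordF h𝒱 h0 z hU) ((B.triv z).equiv U hU a)
  refine ⟨f, Triv.ext_ev (T := B.triv z) hU fun y hy => ?_, fun i hi => hdeg i ?_⟩
  · refine (B.ev_ofSymF h𝒱 h0 f z ⟨y, hy⟩ (hU hy)).trans ((hf ⟨y, hy⟩).trans ?_)
    exact Triv.equiv_apply (T := B.triv z) hU a ⟨y, hy⟩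
  · exact ((B.triv z).deg_iff U hU a i).2 hi

/-- The homomorphisms from the formal symmetric powers of `𝓕` to `𝓞`, as a morphism of
presheaves. -/
noncomputable def ofSymFHom : φ.presheafSymF p ⟶ 𝓜.sheaf.presheaf where
  app U := AlgCat.ofHom (B.ofSymF h𝒱 h0 U.unop)
  naturality U U' h := by
    refine AlgCat.Hom.ext (AlgHom.ext fun f => ?_)
    exact B.ofSymF_res h𝒱 h0 (leOfHom h.unop) f

theorem isLocallyInjective_ofSymFHom : Presheaf.IsLocallyInjective
    (Opens.grothendieckTopology (TopCat.of M)) (B.ofSymFHom h𝒱 h0) where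
  equalizerSieve_mem {U} f g h := by
    have key : ∀ (U U' : Opens (TopCat.of M)) (hU : U' ≤ U) (x : M) (_ : U' ≤ B.dom x)
        (f g : φ.SymF p U), B.ofSymF h𝒱 h0 U f = B.ofSymF h𝒱 h0 U g →
          φ.resSymF p hU f = φ.resSymF p hU g := fun U U' hU x hx f g h => by
      refine B.ofSymF_injective h𝒱 h0 x hx ?_
      rw [B.ofSymF_res, B.ofSymF_res, h]
    intro x hx
    exact ⟨U.unop ⊓ B.dom x, homOfLE inf_le_left,
      key U.unop _ inf_le_left x inf_le_right f g h, ⟨hx, B.mem_dom x⟩⟩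

theorem isLocallySurjective_ofSymFHom : Presheaf.IsLocallySurjective
    (Opens.grothendieckTopology (TopCat.of M)) (B.ofSymFHom h𝒱 h0) where
  imageSieve_mem {U} a := by
    intro x hx
    obtain ⟨f, hf, -⟩ := B.exists_ofSymF_eq h𝒱 h0 x (inf_le_right : U ⊓ B.dom x ≤ B.dom x)
      (𝓜.res inf_le_left a)
    exact ⟨U ⊓ B.dom x, homOfLE inf_le_left, ⟨f, hf⟩, ⟨hx, B.mem_dom x⟩⟩

/-- A locally bijective morphism to a sheaf induces an isomorphism on the sheafification. -/
theorem exists_sheafSymF_iso : ∃ Φ : φ.sheafSymF p ≅ 𝓜.sheaf.presheaf,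
    toSheafify (Opens.grothendieckTopology (TopCat.of M)) (φ.presheafSymF p) ≫ Φ.hom =
      B.ofSymFHom h𝒱 h0 := by
  let J := Opens.grothendieckTopology (TopCat.of M)
  have hQ : Presheaf.IsSheaf J 𝓜.sheaf.presheaf := 𝓜.sheaf.property
  have h1 := B.isLocallyInjective_ofSymFHom h𝒱 h0
  have h2 := B.isLocallySurjective_ofSymFHom h𝒱 h0
  have h3 : IsIso ((presheafToSheaf J (AlgCat.{u} ℝ)).map (B.ofSymFHom h𝒱 h0)) :=
    (J.W_iff _).1 ((J.W_iff_isLocallyBijective _).2 ⟨h1, h2⟩)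
  have h4 : IsIso (sheafifyMap J (B.ofSymFHom h𝒱 h0)) :=
    inferInstanceAs (IsIso ((sheafToPresheaf J (AlgCat.{u} ℝ)).map
      ((presheafToSheaf J (AlgCat.{u} ℝ)).map (B.ofSymFHom h𝒱 h0))))
  have h5 : IsIso (sheafifyLift J (𝟙 𝓜.sheaf.presheaf) hQ) := by
    rw [← isoSheafify_inv J hQ]
    infer_instance
  have h6 : IsIso (sheafifyLift J (B.ofSymFHom h𝒱 h0) hQ) := by
    rw [← Category.comp_id (B.ofSymFHom h𝒱 h0), ← sheafifyMap_sheafifyLift J _ _ hQ]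
    infer_instance
  exact ⟨@asIso _ _ _ _ (sheafifyLift J (B.ofSymFHom h𝒱 h0) hQ) h6, toSheafify_sheafifyLift J _ hQ⟩

/-- A linear atlas identifies `𝓞` with the formal symmetric power of `𝓕`. -/
theorem isoFormalSym (B : LinearAtlas p φ 𝒱) (h𝒱 : ⨆ i, 𝒱 i = ⊤) (h0 : 𝒱 0 = ⊥) :
    φ.IsoFormalSym p := by
  obtain ⟨Φ, hΦ⟩ := B.exists_sheafSymF_iso h𝒱 h0
  have hΦ' : ∀ (U : Opens (TopCat.of M)) (f : φ.SymF p U),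
      (Φ.hom.app (op U)).hom (φ.toSheafSymF p U f) = B.ofSymF h𝒱 h0 U f := fun U f =>
    congrArg (fun F : φ.presheafSymF p ⟶ 𝓜.sheaf.presheaf => (F.app (op U)).hom f) hΦ
  have hinv : ∀ (U : Opens (TopCat.of M)) s,
      (Φ.inv.app (op U)).hom ((Φ.hom.app (op U)).hom s) = s := fun U s =>
    congrArg (fun F : φ.sheafSymF p ⟶ φ.sheafSymF p => (F.app (op U)).hom s) Φ.hom_inv_id
  have hinv' : ∀ (U : Opens (TopCat.of M)) (a : 𝓜.sec U),
      (Φ.hom.app (op U)).hom ((Φ.inv.app (op U)).hom a) = a := fun U a =>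
    congrArg (fun F : 𝓜.sheaf.presheaf ⟶ 𝓜.sheaf.presheaf => (F.app (op U)).hom a) Φ.inv_hom_id
  have hnat : ∀ (U U' : Opens (TopCat.of M)) (h : U' ≤ U) (a : 𝓜.sec U),
      (Φ.inv.app (op U')).hom (𝓜.res h a) =
        ((φ.sheafSymF p).map (homOfLE h).op).hom ((Φ.inv.app (op U)).hom a) := fun U U' h a =>
    congrArg (fun F => F.hom a) (Φ.inv.naturality (homOfLE h).op)
  refine ⟨Φ.symm, fun U c => ?_, fun U k a => ⟨fun ha x hx => ?_, fun ha => ?_⟩⟩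
  · rw [← B.ofSymF_algebraMap h𝒱 h0, ← hΦ']
    exact hinv U _
  · obtain ⟨f, hf, hdeg⟩ := B.exists_ofSymF_eq h𝒱 h0 x (inf_le_right : U ⊓ B.dom x ≤ B.dom x)
      (𝓜.res inf_le_left a)
    refine ⟨U ⊓ B.dom x, inf_le_left, ⟨hx, B.mem_dom x⟩, f,
      hdeg k (𝓜.map_mem _ _ inf_le_left k a ha), ?_⟩
    refine Eq.trans ?_ (hnat U _ inf_le_left a)
    rw [← hf, ← hΦ']
    exact (hinv _ _).symm
  · refine 𝓜.mem_of_local U k a fun x hx => ?_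
    obtain ⟨U', h, hx', f, hf, e⟩ := ha x hx
    refine ⟨U', h, hx', ?_⟩
    have e' : φ.toSheafSymF p U' f = (Φ.inv.app (op U')).hom (𝓜.res h a) :=
      e.trans (hnat U U' h a).symm
    have e2 := congrArg (Φ.hom.app (op U')).hom e'
    rw [hΦ', hinv'] at e2
    change 𝓜.res h a ∈ _
    rw [← e2]
    exact B.ofSymF_mem_deg h𝒱 h0 hf

end LinearAtlas

end SymFIso

end GradedGeom

theorem mainTheorem1 {𝓘 : Type*} [NonUnitalCommSemiring 𝓘] [IsCancelAdd 𝓘] [Countable 𝓘]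
    (p : 𝓘 →+ ZMod 2) (hp : p ≠ 0)
    (n : ℕ) {M : Type u} [TopologicalSpace M] [T2Space M] [SecondCountableTopology M]
    [ChartedSpace (EuclideanSpace ℝ (Fin n)) M] [IsManifold (𝓡 n) ∞ M]
    (m : 𝓘 →₀ ℕ) (𝓜 : GradedGeom.GradedRingedSpace 𝓘 (TopCat.of M))
    (h𝓜 : GradedGeom.IsGradedManifold p n m 𝓜) :
    ∃ ε : GradedGeom.BodyMap n 𝓜, (∀ ε' : GradedGeom.BodyMap n 𝓜, ε' = ε) ∧
      Nonempty (GradedGeom.Projection ε) ∧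
      ∀ φ : GradedGeom.Projection ε,
        φ.presheafF.IsSheaf ∧ φ.IsSplit ∧ φ.IsoFormalSym p ∧
        ∃ E : GradedGeom.GradedVectorBundle n M m, φ.IsoBundle p E := by
  obtain ⟨hm, hc⟩ := h𝓜
  choose c hc using hc
  have h𝒱 := GradedGeom.iSup_modelGrading m
  have h0 := GradedGeom.modelGrading_eq_bot m hm
  let D : M → Opens (TopCat.of M) := fun x => ⟨(c x).e.source, (c x).e.open_source⟩
  have hD : ∀ x, x ∈ D x := hc
  let A : ∀ x, GradedGeom.Triv p n (GradedGeom.modelGrading m) 𝓜 (D x) := fun x => (c x).toTriv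
  obtain ⟨ε⟩ := GradedGeom.exists_bodyMap h𝒱 h0 hD A
  obtain ⟨L, -⟩ := GradedGeom.exists_eulerOp h𝒱 h0 hD A
  refine ⟨ε, GradedGeom.BodyMap.ext_of_atlas h𝒱 h0 hD A ε, L.exists_projection ε h𝒱 h0 hD A,
    fun φ => ?_⟩
  -- an Euler operator that is linear over `C^∞`, with the module structure given by `φ`
  choose A' hA' using fun x => GradedGeom.Triv.exists_change_ofFun φ h𝒱 h0 (A x)
  obtain ⟨L', hL'⟩ := GradedGeom.exists_eulerOp h𝒱 h0 hD A'
  have hφ : φ.IsSplit := GradedGeom.EulerOp.isSplit φ L'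
    (hL' (fun U => φ.app U) fun U i h c => (hA' i U h c).symm) h𝒱 h0 hD A'
  obtain ⟨B⟩ := hφ.exists_linearAtlas φ h𝒱 h0 hD A'
  exact ⟨GradedGeom.Projection.isSheaf_presheafF hφ, hφ, B.isoFormalSym h𝒱 h0, B.exists_isoBundle⟩
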